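/- Let $m\ge 1$, let $(\Omega_X,\mathcal F_X,P_X)$ and $(\Omega_\tau,\mathcal F_\tau,P_\tau)$ be probability spaces, and let $P_{X,\tau}=P_X\times P_\tau$ on $\Omega_X\times\Omega_\tau$. Let $X=X(t,\omega)$, $t\in\mathbb R^m$, $\omega\in\Omega_X$, be a real-valued random field which is jointly measurable in $(t,\omega)$ and (strict-sense) homogeneous, i.e. all its finite-dimensional distributions are invariant under the shifts of $\mathbb R^m$. Assume $E_X[X(0)^2]<\infty$ and $\mathrm{Var}_X[X(0)\mid\mathcal I_X]>0$ $P_X$-almost surely, where $\mathcal I_X$ is the $\sigma$-field of shift-invariant (mod $P_X$) events of the field: the events $\{\omega: X(\cdot,\omega)\in A\}$ where $A\subset\mathbb R^{\mathbb R^m}$ belongs to the $\sigma$-field generated by the coordinates and, for every $t\in\mathbb R^m$, $P_X\{\omega : X(\cdot,\omega)\in A\,\triangle\,\{x: x(\cdot+t)\in A\}\}=0$. Let $T_1\subset T_2\subset\cdots$ be bounded convex sets in $\mathbb R^m$ such that $T_n$ contains a ball of radius $r_n$, where $r_n\to\infty$. Let $k_n$ be positive integers with $k_n\uparrow\infty$.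 For each $n$ let $\tau_{n,1},\dots,\tau_{n,k_n}$ be independent random vectors over $(\Omega_\tau,\mathcal F_\tau,P_\tau)$, each uniformly distributed on $T_n$ with respect to Lebesgue measure $\lambda$. Put $$M_n=\frac1{\lambda(T_n)}\int_{T_n}X(t)\,\lambda(dt),\qquad V_n=\mathrm{Var}_\tau[X(\tau_{n,1})]=\frac1{\lambda(T_n)}\int_{T_n}(X(t)-M_n)^2\,\lambda(dt),$$ $$S_j=\sum_{r=1}^{j}\bigl(X(\tau_{n,r})-M_n\bigr),\qquad 0\le j\le k_n,$$ and let $Z_n=\{Z_n(t),\ t\in[0,1]\}$ be the continuous piecewise linear process on $\Omega_X\times\Omega_\tau$ with vertices $$\left(\frac{j}{k_n},\ \frac{S_j}{k_n^{1/2}V_n^{1/2}}\right),\qquad j=0,1,\dots,k_n$$ (with $Z_n$ read as $0$ where $V_n=0$). Let $W$ be standard Wiener measure on $C[0,1]$, i.e. the law under which the coordinate process is a centred Gaussian process with covariance $\min(s,t)$. Then: a) for $P_X$-almost all $\omega$, the laws of $Z_n(\omega,\cdot)$ under $P_\tau$ converge weakly in $C[0,1]$ to $W$; b) the laws of $Z_n$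 under $P_{X,\tau}$ converge weakly in $C[0,1]$ to $W$. -/

import Mathlib

open MeasureTheory ProbabilityTheory Filter Set
open scoped unitInterval Topology

noncomputable section

namespace RandomizedFCLT

/-- The Borel sigma-algebra of `C[0,1]` (with the topology of uniform convergence). -/
instance instMeasurableSpacePaths : MeasurableSpace C(I, ℝ) := borel _

instance instBorelSpacePaths : BorelSpace C(I, ℝ) := ⟨rfl⟩

/-- Standard Wiener measure on `C[0,1]`: the coordinate process is a centred Gaussian process
with covariance `min s t`. -/
structure IsWienerMeasure (W : Measure C(I, ℝ)) : Prop where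
  isGaussianProcess : IsGaussianProcess (fun (t : I) (x : C(I, ℝ)) ↦ x t) W
  mean_eq_zero : ∀ t : I, ∫ x : C(I, ℝ), x t ∂W = 0
  covariance_eq_min : ∀ s t : I,
    cov[fun x : C(I, ℝ) ↦ x s, fun x : C(I, ℝ) ↦ x t; W] = min (s : ℝ) (t : ℝ)

section Field

variable {E Ω : Type*} [MeasurableSpace Ω]

/-- Strict-sense homogeneity: all finite-dimensional distributions are shift-invariant. -/
def IsHomogeneous [Add E] (X : E → Ω → ℝ) (P : Measure Ω) : Prop :=
  ∀ (k : ℕ) (s : Fin k → E) (t : E) (A : Fin k → Set ℝ), (∀ i, MeasurableSet (A i)) →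
    P {ω | ∀ i, X (s i + t) ω ∈ A i} = P {ω | ∀ i, X (s i) ω ∈ A i}

/-- The shift `γ_t x = x (· + t)` on sample functions. -/
def shift [Add E] (t : E) (x : E → ℝ) : E → ℝ := fun s ↦ x (s + t)

lemma measurable_shift [Add E] (t : E) : Measurable (shift (E := E) t) :=
  measurable_pi_lambda _ fun s ↦ measurable_pi_apply (s + t)

/-- The sigma-algebra of the events of the space of sample functions (with the sigma-algebra
generated by the coordinates) that are invariant mod `ν` under all shifts. -/
@[reducible]
def pathInvariants [Add E] (ν : Measure (E → ℝ)) : MeasurableSpace (E → ℝ) where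
  MeasurableSet' A := MeasurableSet A ∧ ∀ t : E, shift t ⁻¹' A =ᵐ[ν] A
  measurableSet_empty := ⟨MeasurableSet.empty, fun _ ↦ EventuallyEq.rfl⟩
  measurableSet_compl A hA := ⟨hA.1.compl, fun t ↦ by
    rw [preimage_compl]
    exact (hA.2 t).compl⟩
  measurableSet_iUnion A hA := ⟨MeasurableSet.iUnion fun i ↦ (hA i).1, fun t ↦ by
    rw [preimage_iUnion]
    exact Filter.EventuallyEq.countable_iUnion fun i ↦ (hA i).2 t⟩

/-- The sigma-algebra of shift-invariant (mod `P`) events of the field `X`: the events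
`{ω | X(·, ω) ∈ A}` with `A` an event of the space of sample functions which is invariant under
all shifts modulo null sets of the law of `X`. -/
@[reducible]
def invariantEvents [Add E] (X : E → Ω → ℝ) (P : Measure Ω) : MeasurableSpace Ω :=
  (pathInvariants (P.map fun ω t ↦ X t ω)).comap fun ω t ↦ X t ω

end Field

/-- `M_n`: the spatial mean of the sample function over `T`. -/
def spatialMean {E Ω : Type*} [MeasureSpace E] (X : E → Ω → ℝ) (T : Set E) (ω : Ω) : ℝ :=
  ⨍ t in T, X t ω

/-- `V_n`: the spatial variance of the sample function over `T`, which is the variance of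
`X(τ, ω)` for fixed `ω` and `τ` uniformly distributed on `T`. -/
def spatialVar {E Ω : Type*} [MeasureSpace E] (X : E → Ω → ℝ) (T : Set E) (ω : Ω) : ℝ :=
  ⨍ t in T, (X t ω - spatialMean X T ω) ^ 2

/-- The polygonal function on `[0,1]` with vertices `(j / k, s j)`, `j = 0, ..., k`,
written as a sum of ramps; see `polygon_apply`. -/
def polygon (k : ℕ) (s : ℕ → ℝ) : C(I, ℝ) where
  toFun t := s 0 + ∑ j ∈ Finset.range k, (s (j + 1) - s j) * max 0 (min 1 (k * (t : ℝ) - j))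
  continuous_toFun := by fun_prop

/-- On `[j / k, (j + 1) / k]` the polygon is the affine interpolation of its vertices. -/
lemma polygon_apply {k : ℕ} (s : ℕ → ℝ) {j : ℕ} (hj : j < k) (t : I)
    (h₁ : (j : ℝ) ≤ k * (t : ℝ)) (h₂ : k * (t : ℝ) ≤ j + 1) :
    polygon k s t = s j + (k * (t : ℝ) - j) * (s (j + 1) - s j) := by
  obtain ⟨d, rfl⟩ := Nat.exists_eq_add_of_lt hj
  change s 0 + ∑ i ∈ Finset.range (j + d + 1), _ = _
  rw [show j + d + 1 = (j + 1) + d by ring] at *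
  rw [Finset.sum_range_add, Finset.sum_range_succ]
  have hlow : ∀ i ∈ Finset.range j, (s (i + 1) - s i) *
      max 0 (min 1 (((j + 1 + d : ℕ) : ℝ) * (t : ℝ) - i)) = s (i + 1) - s i := by
    intro i hi
    have hi' : (i : ℝ) + 1 ≤ j := by exact_mod_cast Finset.mem_range.1 hi
    rw [min_eq_left (by linarith), max_eq_right zero_le_one, mul_one]
  have hhigh : ∀ i ∈ Finset.range d, (s (j + 1 + i + 1) - s (j + 1 + i)) *
      max 0 (min 1 (((j + 1 + d : ℕ) : ℝ) * (t : ℝ) - ((j + 1 + i : ℕ) : ℝ))) = 0 := by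
    intro i _
    have hc : (j : ℝ) + 1 ≤ ((j + 1 + i : ℕ) : ℝ) := by
      push_cast
      linarith [(Nat.cast_nonneg i : (0 : ℝ) ≤ i)]
    rw [max_eq_left ((min_le_right _ _).trans (by linarith)), mul_zero]
  rw [Finset.sum_congr rfl hlow, Finset.sum_congr rfl hhigh, Finset.sum_range_sub,
    min_eq_right (by linarith), max_eq_right (by linarith), Finset.sum_const_zero]
  ring

section Construction

variable {E Ω Ω' : Type*} [MeasureSpace E]

/-- `S_j`: the sum of `X(τ_r, ω) - M` over the first `j` of the random points `τ_1, ..., τ_k`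
(the sample is indexed by `Fin k`, so `r` runs over `r < j`). -/
def partialSum (X : E → Ω → ℝ) (T : Set E) {k : ℕ} (τ : Fin k → Ω' → E) (j : ℕ)
    (p : Ω × Ω') : ℝ :=
  ∑ r ∈ Finset.univ.filter (fun r : Fin k ↦ (r : ℕ) < j), (X (τ r p.2) p.1 - spatialMean X T p.1)

/-- The random broken line with vertices `(j / k, S_j / (k V)^{1/2})`, `j = 0, ..., k`. -/
def brokenLine (X : E → Ω → ℝ) (T : Set E) {k : ℕ} (τ : Fin k → Ω' → E) (p : Ω × Ω') :
    C(I, ℝ) :=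
  polygon k fun j ↦ partialSum X T τ j p / √(k * spatialVar X T p.1)

end Construction

end RandomizedFCLT

end

/-!
By the pointwise ergodic theorem, almost every sample function `X(·, ω)` has spatial means that
converge to the conditional expectations given the invariant events, for `X` and `X ^ 2` as well as
for the tails of `X ^ 2`. So `V_n` tends to a positive limit, and the rows
`(X(τ_r, ω) - M_n) / (k_n V_n)^{1/2}` form, for fixed `ω`, a triangular array of independent
identically distributed variables that satisfies Lindeberg's condition. Donsker's invariance
principle for such arrays gives a), because the limit does not depend on `ω`; dominated convergence
then gives b).

The ergodic theorem rests on Wiener's maximal inequality for increasing convex sets, a consequence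
of Vitali's covering lemma and of `|T - T| ≤ 4^m |T|`. It shows that the functionals whose spatial
means converge are closed in `L¹`, and invariant functionals and coboundaries span `L²`.

In Donsker's theorem the finite-dimensional laws are identified by characteristic functions. For
tightness, the polygon is compared with the one through `q` equidistant vertices: by Ottaviani's
inequality, the probability that they differ by more than a fixed amount is asymptotically at most
of the order of `q` times a Gaussian tail at `√q`. Wiener measure arises as the limit of a
tight sequence rather than by a prior construction.
-/

namespace RandomizedFCLT

open scoped Pointwise ENNReal NNReal

section Geometry

lemma lintegral_measure_inter_vadd {G : Type*} [AddCommGroup G] [MeasurableSpace G]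
    [MeasurableAdd₂ G] [MeasurableNeg G] {μ : Measure G} [SFinite μ] [μ.IsAddLeftInvariant]
    [μ.IsNegInvariant] {A B : Set G} (hA : MeasurableSet A) (hB : MeasurableSet B) :
    ∫⁻ x, μ (A ∩ (x +ᵥ B)) ∂μ = μ A * μ B := by
  have hswap := measurePreserving_prod_add_swap μ μ
  rw [← Measure.prod_prod, ← hswap.measure_preimage (hA.prod hB).nullMeasurableSet,
    Measure.prod_apply (hswap.measurable (hA.prod hB)), ← lintegral_neg_eq_self]
  refine lintegral_congr fun x ↦ congrArg μ ?_
  ext y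
  simp [mem_vadd_set_iff_neg_vadd_mem, add_comm]

lemma smul_vadd_smul_subset_of_convex {E : Type*} [AddCommGroup E] [Module ℝ E] {T : Set E}
    (hT : Convex ℝ T) {x : E} (hx : x ∈ T) {a b : ℝ} (ha : 0 ≤ a) (hb : 0 ≤ b) (hab : a + b = 1) :
    a • x +ᵥ b • T ⊆ T := by
  rintro _ ⟨_, ⟨t, ht, rfl⟩, rfl⟩
  exact hT hx ht ha hb hab

variable {E : Type*} [NormedAddCommGroup E] [NormedSpace ℝ E] [FiniteDimensional ℝ E]
  [MeasurableSpace E] [BorelSpace E] {μ : Measure E} [μ.IsAddHaarMeasure]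

lemma addHaar_inter_vadd_ge {T : Set E} {u v : E} {b : ℝ} (hb : 0 ≤ b)
    (hu : u +ᵥ b • T ⊆ T) (hv : v +ᵥ b • T ⊆ T) :
    ENNReal.ofReal (b ^ Module.finrank ℝ E) * μ T ≤ μ (T ∩ ((u - v) +ᵥ T)) :=
  calc _ = μ (u +ᵥ b • T) := by
        rw [measure_vadd, Measure.addHaar_smul, abs_of_nonneg (pow_nonneg hb _)]
    _ ≤ _ := measure_mono <| subset_inter hu <| by
        rwa [subset_vadd_set_iff, vadd_vadd, neg_sub, sub_add_cancel]

/-- A weak Rogers–Shephard inequality: every `x` in the half-scaled `T - T` moves `T` so little that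
`x +ᵥ T` and `T` share a scaled copy of `T`, whereas the overlap integrates to `μ T * μ T`. -/
lemma addHaar_sub_self_le {T : Set E} (hT : Convex ℝ T) (hTo : IsOpen T) :
    μ (T - T) ≤ 4 ^ Module.finrank ℝ E * μ T := by
  rcases T.eq_empty_or_nonempty with rfl | hne
  · simp
  rcases eq_or_ne (μ T) ∞ with htop | hfin
  · simp [htop]
  set c : ℝ≥0∞ := ENNReal.ofReal ((1 / 2 : ℝ) ^ Module.finrank ℝ E)
  have hoverlap : ∀ x ∈ (1 / 2 : ℝ) • (T - T), c * μ T ≤ μ (T ∩ (x +ᵥ T)) := by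
    rintro _ ⟨_, ⟨a, ha, b, hb, rfl⟩, rfl⟩
    dsimp only
    rw [smul_sub]
    exact addHaar_inter_vadd_ge (by norm_num)
      (smul_vadd_smul_subset_of_convex hT ha (by norm_num) (by norm_num) (by norm_num))
      (smul_vadd_smul_subset_of_convex hT hb (by norm_num) (by norm_num) (by norm_num))
  have hmeas : MeasurableSet ((1 / 2 : ℝ) • (T - T)) :=
    (hTo.sub_left.smul₀ (by norm_num)).measurableSet
  have hsmul : μ ((1 / 2 : ℝ) • (T - T)) = c * μ (T - T) := by
    rw [Measure.addHaar_smul, abs_of_pos (by positivity)]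
  have hbound : c * c * μ (T - T) ≤ μ T := by
    refine (ENNReal.mul_le_mul_iff_right (hTo.measure_pos μ hne).ne' hfin).1 ?_
    calc μ T * (c * c * μ (T - T)) = ∫⁻ _ in (1 / 2 : ℝ) • (T - T), c * μ T ∂μ := by
          rw [setLIntegral_const, hsmul]
          ring
      _ ≤ ∫⁻ x, μ (T ∩ (x +ᵥ T)) ∂μ :=
          (setLIntegral_mono' hmeas hoverlap).trans (setLIntegral_le_lintegral _ _)
      _ = μ T * μ T := lintegral_measure_inter_vadd hTo.measurableSet hTo.measurableSet
  have hfour : (4 : ℝ≥0∞) ^ Module.finrank ℝ E * (c * c) = 1 := by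
    rw [← ENNReal.ofReal_ofNat, ← ENNReal.ofReal_pow (by norm_num),
      ← ENNReal.ofReal_mul (by positivity), ← ENNReal.ofReal_mul (by positivity), ← mul_pow,
      ← mul_pow]
    norm_num
  calc μ (T - T) = 4 ^ Module.finrank ℝ E * (c * c * μ (T - T)) := by
        rw [← mul_assoc, hfour, one_mul]
    _ ≤ _ := by gcongr

lemma addHaar_inter_vadd_ge_of_ball_subset {T : Set E} (hT : Convex ℝ T) {c s : E} {r ρ : ℝ}
    (hρ0 : 0 < ρ) (hρ1 : ρ ≤ 1) (hball : Metric.ball c r ⊆ T) (hs : ‖s‖ < ρ * r) :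
    ENNReal.ofReal ((1 - ρ) ^ Module.finrank ℝ E) * μ T ≤ μ (T ∩ (s +ᵥ T)) := by
  have hr : 0 < r := pos_of_mul_pos_right ((norm_nonneg s).trans_lt hs) hρ0.le
  have hcs : c + ρ⁻¹ • s ∈ T := hball <| by
    rwa [mem_ball_iff_norm, add_sub_cancel_left, norm_smul, norm_inv, Real.norm_of_nonneg hρ0.le,
      inv_mul_lt_iff₀ hρ0]
  have h := addHaar_inter_vadd_ge (μ := μ) (sub_nonneg.2 hρ1)
    (smul_vadd_smul_subset_of_convex hT hcs hρ0.le (sub_nonneg.2 hρ1) (by ring))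
    (smul_vadd_smul_subset_of_convex hT (hball (Metric.mem_ball_self hr)) hρ0.le
      (sub_nonneg.2 hρ1) (by ring))
  rwa [smul_add, smul_inv_smul₀ hρ0.ne', add_sub_cancel_left] at h

/-- With sizes `2 ^ n s` and an enlargement factor below `2`, each translate meets a selected one of
at least the same index. -/
lemma exists_pairwiseDisjoint_vadd_covering {G : Type*} [AddCommGroup G] {T : ℕ → Set G}
    (hmono : Monotone T) (hne : ∀ n, (T n).Nonempty) {D : Set G} {n : G → ℕ} {N : ℕ}
    (hn : ∀ s ∈ D, n s ≤ N) :
    ∃ u ⊆ D, u.PairwiseDisjoint (fun s ↦ s +ᵥ T (n s)) ∧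
      D ⊆ ⋃ b ∈ u, b +ᵥ (T (n b) - T (n b)) := by
  obtain ⟨u, huD, hdisj, hcov⟩ := Vitali.exists_disjoint_subfamily_covering_enlargement
    (fun s ↦ s +ᵥ T (n s)) D (fun s ↦ (2 : ℝ) ^ n s) (3 / 2) (by norm_num)
    (fun _ _ ↦ by positivity) (2 ^ N)
    (fun a ha ↦ pow_le_pow_right₀ (by norm_num) (hn a ha)) (fun a _ ↦ (hne _).vadd_set)
  refine ⟨u, huD, hdisj, fun a ha ↦ ?_⟩
  obtain ⟨b, hb, ⟨y, ⟨p, hp, hpy⟩, ⟨q, hq, hqy⟩⟩, hle⟩ := hcov a ha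
  have hnab : n a ≤ n b := by
    by_contra! hlt
    have h1 : (2 : ℝ) ^ (n b + 1) ≤ 2 ^ n a := pow_le_pow_right₀ (by norm_num) hlt
    have h2 : (0 : ℝ) < 2 ^ n b := by positivity
    rw [pow_succ] at h1
    linarith
  refine mem_iUnion₂.2 ⟨b, hb, q - p, ⟨q, hq, p, hmono hnab hp, rfl⟩, ?_⟩
  have hbq : b + q = a + p := hqy.trans hpy.symm
  simp [← add_sub_assoc, hbq]

lemma mul_addHaar_le_setLIntegral_of_convex {T : ℕ → Set E} (hmono : Monotone T)
    (hconv : ∀ n, Convex ℝ (T n)) (hopen : ∀ n, IsOpen (T n)) (hne : ∀ n, (T n).Nonempty)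
    {φ : E → ℝ≥0∞} {α : ℝ≥0∞} {N : ℕ} {D U : Set E}
    (hD : ∀ s ∈ D, ∃ n ≤ N, α * μ (T n) ≤ ∫⁻ t in s +ᵥ T n, φ t ∂μ)
    (hU : ∀ s ∈ D, ∀ n ≤ N, s +ᵥ T n ⊆ U) :
    α * μ D ≤ 4 ^ Module.finrank ℝ E * ∫⁻ t in U, φ t ∂μ := by
  choose! n hnN hn using hD
  obtain ⟨u, huD, hdisj, hcov⟩ := exists_pairwiseDisjoint_vadd_covering hmono hne hnN
  have hopen' : ∀ s, IsOpen (s +ᵥ T (n s)) := fun s ↦ (hopen _).vadd s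
  have hcount : u.Countable :=
    hdisj.countable_of_isOpen (fun s _ ↦ hopen' s) fun s _ ↦ (hne _).vadd_set
  calc α * μ D ≤ α * ∑' b : u, μ ((b : E) +ᵥ (T (n b) - T (n b))) := by
        gcongr
        exact (measure_mono hcov).trans (measure_biUnion_le _ hcount _)
    _ ≤ α * ∑' b : u, 4 ^ Module.finrank ℝ E * μ (T (n b)) := by
        gcongr with b
        rw [measure_vadd]
        exact addHaar_sub_self_le (hconv _) (hopen _)
    _ = 4 ^ Module.finrank ℝ E * ∑' b : u, α * μ (T (n b)) := by
        rw [ENNReal.tsum_mul_left, ENNReal.tsum_mul_left]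
        ring
    _ ≤ 4 ^ Module.finrank ℝ E * ∑' b : u, ∫⁻ t in (b : E) +ᵥ T (n b), φ t ∂μ := by
        gcongr with b
        exact hn b (huD b.2)
    _ = 4 ^ Module.finrank ℝ E * ∫⁻ t in ⋃ b ∈ u, (b : E) +ᵥ T (n b), φ t ∂μ := by
        rw [lintegral_biUnion hcount (fun s _ ↦ (hopen' s).measurableSet) hdisj]
    _ ≤ _ := by
        gcongr
        exact iUnion₂_subset fun b hb ↦ hU b (huD hb) _ (hnN b (huD hb))

end Geometry

section HomogeneousField

/-- The sample function `X(·, ω)` of the field `X`. -/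
def samplePath {E Ω : Type*} (X : E → Ω → ℝ) (ω : Ω) : E → ℝ := fun t ↦ X t ω

/-- The field obtained by evaluating the functional `F` along the shifts of the sample functions
of `X`. -/
def pathField {E Ω : Type*} [Add E] (X : E → Ω → ℝ) (F : (E → ℝ) → ℝ) : E → Ω → ℝ :=
  fun t ω ↦ F (shift t (samplePath X ω))

lemma shift_shift {E : Type*} [AddSemigroup E] (s t : E) (x : E → ℝ) :
    shift t (shift s x) = shift (t + s) x := by
  funext u
  simp [shift, add_assoc]

lemma shift_zero {E : Type*} [AddZeroClass E] (x : E → ℝ) : shift 0 x = x := by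
  funext u
  simp [shift]

variable {E Ω : Type*} {X : E → Ω → ℝ}

lemma pathField_zero [AddZeroClass E] (F : (E → ℝ) → ℝ) :
    pathField X F 0 = F ∘ samplePath X := by
  funext ω
  simp [pathField, shift_zero]

variable [MeasurableSpace Ω] {P : Measure Ω}

lemma measurable_samplePath (hX : ∀ t, Measurable (X t)) : Measurable (samplePath X) :=
  measurable_pi_lambda _ hX

lemma measurable_shift_samplePath [Add E] [MeasurableSpace E] [MeasurableAdd₂ E]
    (hX : Measurable (Function.uncurry X)) :
    Measurable fun p : E × Ω ↦ shift p.1 (samplePath X p.2) :=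
  measurable_pi_lambda _ fun _ ↦
    hX.comp ((measurable_const.add measurable_fst).prodMk measurable_snd)

lemma measurable_pathField [Add E] [MeasurableSpace E] [MeasurableAdd₂ E]
    (hX : Measurable (Function.uncurry X)) {F : (E → ℝ) → ℝ} (hF : Measurable F) :
    Measurable (Function.uncurry (pathField X F)) :=
  hF.comp (measurable_shift_samplePath hX)

lemma IsHomogeneous.identDistrib_shift_samplePath [Add E] [IsFiniteMeasure P]
    (hX : ∀ t, Measurable (X t)) (hhom : IsHomogeneous X P) (t : E) :
    IdentDistrib (fun ω ↦ shift t (samplePath X ω)) (samplePath X) P P := by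
  have hpath := measurable_samplePath hX
  have hshift : Measurable fun ω ↦ shift t (samplePath X ω) := (measurable_shift t).comp hpath
  refine ⟨hshift.aemeasurable, hpath.aemeasurable, ext_of_generate_finite _
    generateFrom_squareCylinders.symm
    (isPiSystem_squareCylinders (fun _ ↦ MeasurableSpace.isPiSystem_measurableSet)
      (fun _ ↦ by simp)) ?_ ?_⟩
  · rintro _ ⟨s, B, hB, rfl⟩
    have hBm : ∀ i, MeasurableSet (B i) := fun i ↦ hB i trivial
    have hS : MeasurableSet ((s : Set E).pi B) :=
      MeasurableSet.pi s.countable_toSet fun i _ ↦ hBm i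
    have hfin : ∀ x : E → ℝ, x ∈ (s : Set E).pi B ↔
        ∀ i, x (s.equivFin.symm i) ∈ B (s.equivFin.symm i) := fun x ↦ by
      rw [s.equivFin.symm.surjective.forall (p := fun i : s ↦ x i ∈ B i) |>.symm]
      simp [Set.mem_pi]
    rw [Measure.map_apply hshift hS, Measure.map_apply hpath hS]
    convert hhom s.card (fun i ↦ (s.equivFin.symm i : E)) t
      (fun i ↦ B (s.equivFin.symm i)) (fun i ↦ hBm _) using 2 <;>
    · ext ω
      exact hfin _
  · rw [Measure.map_apply hshift .univ, Measure.map_apply hpath .univ, preimage_univ,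
      preimage_univ]

lemma IsHomogeneous.identDistrib [AddZeroClass E] [IsFiniteMeasure P]
    (hX : ∀ t, Measurable (X t)) (hhom : IsHomogeneous X P) (t : E) :
    IdentDistrib (X t) (X 0) P P := by
  simpa [Function.comp_def, shift, samplePath] using
    (hhom.identDistrib_shift_samplePath hX t).comp (measurable_pi_apply 0)

lemma IsHomogeneous.lintegral_enorm_eq [AddZeroClass E] [IsFiniteMeasure P]
    (hX : ∀ t, Measurable (X t)) (hhom : IsHomogeneous X P) (t : E) :
    ∫⁻ ω, ‖X t ω‖ₑ ∂P = ∫⁻ ω, ‖X 0 ω‖ₑ ∂P :=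
  ((hhom.identDistrib hX t).comp measurable_enorm).lintegral_eq

lemma IsHomogeneous.measurePreserving_shift [Add E] [IsFiniteMeasure P]
    (hX : ∀ t, Measurable (X t)) (hhom : IsHomogeneous X P) (t : E) :
    MeasurePreserving (shift t) (P.map (samplePath X)) (P.map (samplePath X)) :=
  ⟨measurable_shift t, (Measure.map_map (measurable_shift t) (measurable_samplePath hX)).trans
    (hhom.identDistrib_shift_samplePath hX t).map_eq⟩

lemma IsHomogeneous.pathField [AddCommSemigroup E] [IsFiniteMeasure P]
    (hX : ∀ t, Measurable (X t)) (hhom : IsHomogeneous X P) {F : (E → ℝ) → ℝ}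
    (hF : Measurable F) : IsHomogeneous (pathField X F) P := by
  intro k s t A hA
  have hB : MeasurableSet {x | ∀ i, F (shift (s i) x) ∈ A i} := by
    simp only [ofPred_forall]
    exact .iInter fun i ↦ (hF.comp (measurable_shift _)) (hA i)
  simpa only [RandomizedFCLT.pathField, preimage_ofPred_eq, shift_shift] using
    (hhom.identDistrib_shift_samplePath hX t).measure_preimage_eq hB

end HomogeneousField

section SpatialIntegral

variable {E Ω : Type*} [MeasurableSpace E] [MeasurableSpace Ω] {P : Measure Ω} {Y : E → Ω → ℝ}

lemma IsHomogeneous.integrable_prod [AddZeroClass E] [IsFiniteMeasure P]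
    (hY : Measurable (Function.uncurry Y)) (hhom : IsHomogeneous Y P)
    (hY0 : Integrable (Y 0) P) (ρ : Measure E) [IsFiniteMeasure ρ] :
    Integrable (Function.uncurry Y) (ρ.prod P) := by
  refine ⟨hY.aestronglyMeasurable, ?_⟩
  rw [HasFiniteIntegral, lintegral_prod _ hY.enorm.aemeasurable]
  simp only [Function.uncurry_apply_pair, hhom.lintegral_enorm_eq fun _ ↦ hY.of_uncurry_left,
    lintegral_const]
  exact ENNReal.mul_lt_top hY0.2 (measure_lt_top _ _)

/-- By the strong law of large numbers, the integral of a random function is almost surely the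
limit of its averages over a sequence of points that does not depend on chance. -/
lemma ae_tendsto_sampleMean [SFinite P] (hY : Measurable (Function.uncurry Y)) {ρ : Measure E}
    [IsProbabilityMeasure ρ] (hint : ∀ᵐ ω ∂P, Integrable (fun t ↦ Y t ω) ρ) :
    ∀ᵐ u ∂Measure.infinitePi (fun _ : ℕ ↦ ρ), ∀ᵐ ω ∂P,
      Tendsto (fun n : ℕ ↦ (∑ i ∈ Finset.range n, Y (u i) ω) / n) atTop
        (𝓝 (∫ t, Y t ω ∂ρ)) := by
  rw [← Measure.ae_ae_comm]
  · filter_upwards [hint] with ω hω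
    have hm : Measurable fun t ↦ Y t ω := hY.of_uncurry_right
    have hmp : ∀ i, MeasurePreserving (fun u : ℕ → E ↦ u i)
        (Measure.infinitePi fun _ : ℕ ↦ ρ) ρ := measurePreserving_eval_infinitePi _
    have hslln := strong_law_ae_real (μ := Measure.infinitePi fun _ : ℕ ↦ ρ)
      (fun i u ↦ Y (u i) ω) ((hmp 0).integrable_comp_of_integrable hω)
      (fun i j hij ↦ (iIndepFun_infinitePi (P := fun _ : ℕ ↦ ρ) (X := fun _ t ↦ Y t ω)
        (fun _ ↦ hm)).indepFun hij)
      (fun i ↦ (IdentDistrib.mk (hmp i).aemeasurable (hmp 0).aemeasurable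
        ((hmp i).map_eq.trans (hmp 0).map_eq.symm)).comp hm)
    rwa [← integral_map (hmp 0).aemeasurable (f := fun t ↦ Y t ω) hm.aestronglyMeasurable,
      (hmp 0).map_eq] at hslln
  · refine measurableSet_tendsto_fun (fun n ↦ ?_) ?_
    · exact (Finset.measurable_sum _ fun i _ ↦ hY.comp
        (((measurable_pi_apply i).comp measurable_snd).prodMk measurable_fst)).div_const _
    · exact ((hY.comp measurable_swap).stronglyMeasurable.integral_prod_right'
        (ν := ρ)).measurable.comp measurable_fst

lemma identDistrib_integral {ι Ω' : Type*} [Countable ι] [MeasurableSpace Ω'] [SFinite P]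
    {P' : Measure Ω'} [SFinite P'] {Y' : E → Ω' → ℝ} (hY : Measurable (Function.uncurry Y))
    (hY' : Measurable (Function.uncurry Y'))
    (hdist : IdentDistrib (samplePath Y) (samplePath Y') P P') {ρ : ι → Measure E}
    [∀ i, IsProbabilityMeasure (ρ i)] (hint : ∀ i, ∀ᵐ ω ∂P, Integrable (fun t ↦ Y t ω) (ρ i))
    (hint' : ∀ i, ∀ᵐ ω ∂P', Integrable (fun t ↦ Y' t ω) (ρ i)) :
    IdentDistrib (fun ω i ↦ ∫ t, Y t ω ∂ρ i) (fun ω i ↦ ∫ t, Y' t ω ∂ρ i) P P' := by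
  choose u hu hu' using fun i ↦ ((ae_tendsto_sampleMean hY (hint i)).and
    (ae_tendsto_sampleMean hY' (hint' i))).exists
  set Φ : (E → ℝ) → ι → ℝ := fun x i ↦
    limsup (fun n : ℕ ↦ (∑ j ∈ Finset.range n, x (u i j)) / n) atTop
  have hΦ : Measurable Φ := measurable_pi_lambda _ fun i ↦ Measurable.limsup fun n ↦
    (Finset.measurable_sum _ fun j _ ↦ measurable_pi_apply (u i j)).div_const _
  have heq : Φ ∘ samplePath Y =ᵐ[P] fun ω i ↦ ∫ t, Y t ω ∂ρ i := by
    filter_upwards [ae_all_iff.2 hu] with ω hω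
    exact funext fun i ↦ (hω i).limsup_eq
  have heq' : Φ ∘ samplePath Y' =ᵐ[P'] fun ω i ↦ ∫ t, Y' t ω ∂ρ i := by
    filter_upwards [ae_all_iff.2 hu'] with ω hω
    exact funext fun i ↦ (hω i).limsup_eq
  have hΦdist := hdist.comp hΦ
  exact ((IdentDistrib.of_ae_eq hΦdist.aemeasurable_fst heq).symm.trans hΦdist).trans
    (IdentDistrib.of_ae_eq hΦdist.aemeasurable_snd heq')

end SpatialIntegral

section MaximalInequality

lemma measurableSet_exists_le_lt_abs {α : Type*} [MeasurableSpace α] {f : ℕ → α → ℝ}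
    (hf : ∀ n, Measurable (f n)) {a : ℝ} {N : ℕ} :
    MeasurableSet {x | ∃ n ≤ N, a < |f n x|} := by
  simp only [ofPred_exists, ofPred_and]
  exact .iUnion fun n ↦ (MeasurableSet.const _).inter
    (measurableSet_lt measurable_const (hf n).abs)

lemma spatialMean_eq_integral_cond {E Ω : Type*} [MeasureSpace E] (Y : E → Ω → ℝ) (T : Set E)
    (ω : Ω) : spatialMean Y T ω = ∫ t, Y t ω ∂(ProbabilityTheory.cond volume T) := by
  rw [spatialMean, average, Measure.restrict_apply_univ, ProbabilityTheory.cond]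

lemma measurable_spatialMean_add {E Ω : Type*} [Add E] [MeasureSpace E] [MeasurableAdd₂ E]
    [SFinite (volume : Measure E)] [MeasurableSpace Ω] {Y : E → Ω → ℝ}
    (hY : Measurable (Function.uncurry Y)) (T : Set E) :
    Measurable fun q : E × Ω ↦ spatialMean (fun t ↦ Y (t + q.1)) T q.2 := by
  have hYt : Measurable fun q : (E × Ω) × E ↦ Y (q.2 + q.1.1) q.1.2 :=
    hY.comp ((measurable_snd.add (measurable_fst.comp measurable_fst)).prodMk
      (measurable_snd.comp measurable_fst))
  simp only [spatialMean_eq_integral_cond]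
  exact hYt.stronglyMeasurable.integral_prod_right'.measurable

lemma IsHomogeneous.identDistrib_spatialMean {E Ω ι : Type*} [Countable ι] [AddCommMonoid E]
    [MeasureSpace E] [MeasurableAdd E] [MeasurableSpace Ω] {P : Measure Ω} [IsFiniteMeasure P]
    {Y : E → Ω → ℝ}
    (hY : Measurable (Function.uncurry Y)) (hhom : IsHomogeneous Y P)
    (hY0 : Integrable (Y 0) P) {T : ι → Set E} (hT0 : ∀ i, volume (T i) ≠ 0)
    (hT : ∀ i, volume (T i) ≠ ∞) (s : E) :
    IdentDistrib (fun ω i ↦ spatialMean (fun t ↦ Y (t + s)) (T i) ω)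
      (fun ω i ↦ spatialMean Y (T i) ω) P P := by
  have hmeas : ∀ t, Measurable (Y t) := fun _ ↦ hY.of_uncurry_left
  have hYs : Measurable (Function.uncurry fun t ↦ Y (t + s)) :=
    hY.comp ((measurable_fst.add_const s).prodMk measurable_snd)
  have hhoms : IsHomogeneous (fun t ↦ Y (t + s)) P := fun k u t A hA ↦ by
    simpa only [add_right_comm] using hhom k (fun i ↦ u i + s) t A hA
  have hYs0 : Integrable (Y (0 + s)) P := (hhom.identDistrib hmeas (0 + s)).integrable_iff.2 hY0
  have (i : ι) : IsProbabilityMeasure (ProbabilityTheory.cond volume (T i)) :=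
    cond_isProbabilityMeasure_of_finite (hT0 i) (hT i)
  simp only [spatialMean_eq_integral_cond]
  exact identDistrib_integral hYs hY (hhom.identDistrib_shift_samplePath hmeas s)
    (fun i ↦ (hhoms.integrable_prod hYs hYs0 _).prod_left_ae)
    fun i ↦ (hhom.integrable_prod hY hY0 _).prod_left_ae

variable {E Ω : Type*} [NormedAddCommGroup E] [NormedSpace ℝ E] [FiniteDimensional ℝ E]
  [MeasureSpace E] [BorelSpace E] [(volume : Measure E).IsAddHaarMeasure] [MeasurableSpace Ω]
  {P : Measure Ω} {T : ℕ → Set E}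

lemma ofReal_mul_volume_le_setLIntegral_of_lt_average {f : E → ℝ} {A : Set E}
    (hA0 : volume A ≠ 0) (hA : volume A ≠ ∞) {a : ℝ} {s : E}
    (h : a < |⨍ t in A, f (t + s)|) :
    ENNReal.ofReal a * volume A ≤ ∫⁻ t in s +ᵥ A, ‖f t‖ₑ := by
  have hpos : 0 < volume.real A := ENNReal.toReal_pos hA0 hA
  rw [setAverage_eq, smul_eq_mul, abs_mul, abs_of_nonneg (by positivity),
    lt_inv_mul_iff₀ hpos] at h
  calc ENNReal.ofReal a * volume A = ENNReal.ofReal (volume.real A * a) := by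
        rw [mul_comm, ENNReal.ofReal_mul hpos.le, ofReal_measureReal hA]
    _ ≤ ‖∫ t in A, f (t + s)‖ₑ := by
        rw [Real.enorm_eq_ofReal_abs]
        exact ENNReal.ofReal_le_ofReal h.le
    _ ≤ ∫⁻ t in A, ‖f (t + s)‖ₑ := enorm_integral_le_lintegral_enorm _
    _ = ∫⁻ t in s +ᵥ A, ‖f t‖ₑ := by
        rw [← image_vadd, ← (measurePreserving_vadd s volume).setLIntegral_comp_emb
          (measurableEmbedding_const_vadd s)]
        simp only [vadd_eq_add, add_comm s]

lemma mul_volume_exists_lt_average_le (hmono : Monotone T) (hconv : ∀ n, Convex ℝ (T n))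
    (hopen : ∀ n, IsOpen (T n)) (hne : ∀ n, (T n).Nonempty) {N : ℕ} {R : ℝ}
    (hTN : T N ⊆ Metric.ball 0 R) (f : E → ℝ) (a : ℝ) :
    ENNReal.ofReal a *
        volume {s ∈ Metric.ball (0 : E) R | ∃ n ≤ N, a < |⨍ t in T n, f (t + s)|} ≤
      4 ^ Module.finrank ℝ E * ∫⁻ t in Metric.ball (0 : E) (2 * R), ‖f t‖ₑ := by
  refine mul_addHaar_le_setLIntegral_of_convex hmono hconv hopen hne (N := N) ?_ ?_
  · rintro s ⟨-, n, hn, han⟩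
    refine ⟨n, hn, ofReal_mul_volume_le_setLIntegral_of_lt_average
      ((hopen n).measure_pos volume (hne n)).ne' ?_ han⟩
    exact ((measure_mono ((hmono hn).trans hTN)).trans_lt measure_ball_lt_top).ne
  · rintro s ⟨hs, -⟩ n hn _ ⟨t, ht, rfl⟩
    have hs' := mem_ball_zero_iff.1 hs
    have ht' := mem_ball_zero_iff.1 (hTN (hmono hn ht))
    exact mem_ball_zero_iff.2 ((norm_add_le s t).trans_lt (by linarith))

/-- Wiener's maximal inequality applies to each sample function, and homogeneity makes the
exceptional events at all points equally likely. -/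
lemma mul_measure_exists_le_lt_abs_spatialMean_le [IsFiniteMeasure P] (hmono : Monotone T)
    (hconv : ∀ n, Convex ℝ (T n)) (hopen : ∀ n, IsOpen (T n))
    (hbdd : ∀ n, Bornology.IsBounded (T n)) (hne : ∀ n, (T n).Nonempty) {Y : E → Ω → ℝ}
    (hY : Measurable (Function.uncurry Y)) (hhom : IsHomogeneous Y P)
    (hY0 : Integrable (Y 0) P) (a : ℝ) (N : ℕ) :
    ENNReal.ofReal a * P {ω | ∃ n ≤ N, a < |spatialMean Y (T n) ω|} ≤
      8 ^ Module.finrank ℝ E * ∫⁻ ω, ‖Y 0 ω‖ₑ ∂P := by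
  obtain ⟨R, hR0, hR⟩ := (hbdd N).subset_ball_lt 0 0
  set d := Module.finrank ℝ E
  set Q := Metric.ball (0 : E) R
  set A : Set (E × Ω) := {q | ∃ n ≤ N, a < |spatialMean (fun t ↦ Y (t + q.1)) (T n) q.2|}
  have hA : MeasurableSet A :=
    measurableSet_exists_le_lt_abs fun n ↦ measurable_spatialMean_add hY (T n)
  have hstat : ∀ s, P (Prod.mk s ⁻¹' A) = P {ω | ∃ n ≤ N, a < |spatialMean Y (T n) ω|} := fun s ↦
    (hhom.identDistrib_spatialMean hY hY0 (fun n ↦ ((hopen n).measure_pos volume (hne n)).ne')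
      (fun n ↦ (hbdd n).measure_lt_top.ne) s).measure_preimage_eq
      (measurableSet_exists_le_lt_abs measurable_pi_apply)
  have hvol : volume (Metric.ball (0 : E) (2 * R)) = 2 ^ d * volume Q := by
    rw [Measure.addHaar_ball_mul_of_pos _ _ two_pos, ENNReal.ofReal_pow two_pos.le,
      ENNReal.ofReal_ofNat]
  refine (ENNReal.mul_le_mul_iff_left (Metric.measure_ball_pos volume (0 : E) hR0).ne'
    measure_ball_lt_top.ne).1 ?_
  calc ENNReal.ofReal a * P {ω | ∃ n ≤ N, a < |spatialMean Y (T n) ω|} * volume Q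
      = ENNReal.ofReal a * (volume.restrict Q).prod P A := by
        rw [Measure.prod_apply hA]
        simp_rw [hstat]
        rw [setLIntegral_const, mul_assoc]
    _ = ENNReal.ofReal a * ∫⁻ ω, volume {s ∈ Q | (s, ω) ∈ A} ∂P := by
        rw [Measure.prod_apply_symm hA]
        simp_rw [Measure.restrict_apply (measurable_prodMk_right hA), inter_comm _ Q]
        rfl
    _ ≤ ∫⁻ ω, 4 ^ d * (∫⁻ t in Metric.ball (0 : E) (2 * R), ‖Y t ω‖ₑ) ∂P := by
        rw [← lintegral_const_mul' _ _ ENNReal.ofReal_ne_top]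
        exact lintegral_mono fun ω ↦ mul_volume_exists_lt_average_le hmono hconv hopen hne hR _ a
    _ = 4 ^ d * ∫⁻ t in Metric.ball (0 : E) (2 * R), (∫⁻ ω, ‖Y t ω‖ₑ ∂P) := by
        rw [lintegral_const_mul' _ _ (by finiteness), ← lintegral_lintegral_swap]
        exact hY.enorm.aemeasurable
    _ = 8 ^ d * (∫⁻ ω, ‖Y 0 ω‖ₑ ∂P) * volume Q := by
        simp_rw [hhom.lintegral_enorm_eq fun _ ↦ hY.of_uncurry_left]
        rw [setLIntegral_const, hvol, show (8 : ℝ≥0∞) = 4 * 2 by norm_num, mul_pow]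
        ring

lemma mul_measure_exists_lt_abs_spatialMean_le [IsFiniteMeasure P] (hmono : Monotone T)
    (hconv : ∀ n, Convex ℝ (T n)) (hopen : ∀ n, IsOpen (T n))
    (hbdd : ∀ n, Bornology.IsBounded (T n)) (hne : ∀ n, (T n).Nonempty) {Y : E → Ω → ℝ}
    (hY : Measurable (Function.uncurry Y)) (hhom : IsHomogeneous Y P)
    (hY0 : Integrable (Y 0) P) (a : ℝ) :
    ENNReal.ofReal a * P {ω | ∃ n, a < |spatialMean Y (T n) ω|} ≤
      8 ^ Module.finrank ℝ E * ∫⁻ ω, ‖Y 0 ω‖ₑ ∂P := by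
  have hUnion : {ω | ∃ n, a < |spatialMean Y (T n) ω|} =
      ⋃ N, {ω | ∃ n ≤ N, a < |spatialMean Y (T n) ω|} := by
    ext ω
    simp only [mem_iUnion, mem_ofPred_eq]
    exact ⟨fun ⟨n, h⟩ ↦ ⟨n, n, le_rfl, h⟩, fun ⟨_, n, _, h⟩ ↦ ⟨n, h⟩⟩
  rw [hUnion, Monotone.measure_iUnion, ENNReal.mul_iSup]
  · exact iSup_le
      (mul_measure_exists_le_lt_abs_spatialMean_le hmono hconv hopen hbdd hne hY hhom hY0 a)
  · exact fun N N' h ω ⟨n, hn, hω⟩ ↦ ⟨n, hn.trans h, hω⟩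

end MaximalInequality

section AveragingSequence

/-- An increasing sequence of nonempty bounded open convex sets that contain arbitrarily large
balls, along which spatial means are taken. -/
structure IsAveragingSequence {E : Type*} [NormedAddCommGroup E] [NormedSpace ℝ E]
    (T : ℕ → Set E) : Prop where
  monotone : Monotone T
  convex : ∀ n, Convex ℝ (T n)
  isOpen : ∀ n, IsOpen (T n)
  isBounded : ∀ n, Bornology.IsBounded (T n)
  nonempty : ∀ n, (T n).Nonempty
  eventually_exists_ball_subset : ∀ R : ℝ, ∀ᶠ n in atTop, ∃ c, Metric.ball c R ⊆ T n

lemma norm_setIntegral_sub_setIntegral_vadd_le {G F : Type*} [AddGroup G] [MeasurableSpace G]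
    [MeasurableAdd G] {μ : Measure G} [μ.IsAddLeftInvariant] [NormedAddCommGroup F]
    [NormedSpace ℝ F] {f : G → F} (hf : AEStronglyMeasurable f μ) {C : ℝ} (hC : ∀ t, ‖f t‖ ≤ C)
    {T : Set G} (hT : MeasurableSet T) (hμT : μ T ≠ ∞) (s : G) :
    ‖(∫ t in T, f t ∂μ) - ∫ t in T, f (s + t) ∂μ‖ ≤
      2 * C * (μ.real T - μ.real (T ∩ (s +ᵥ T))) := by
  have hsT : MeasurableSet (s +ᵥ T) := hT.const_vadd s
  have hμsT : μ (s +ᵥ T) ≠ ∞ := by rwa [measure_vadd]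
  have hint : ∀ A : Set G, μ A ≠ ∞ → IntegrableOn f A μ := fun A hA ↦
    Measure.integrableOn_of_bounded hA hf (Eventually.of_forall hC)
  have htranslate : ∫ t in T, f (s + t) ∂μ = ∫ t in s +ᵥ T, f t ∂μ := by
    rw [← image_vadd]
    exact ((measurePreserving_vadd s μ).setIntegral_image_emb
      (measurableEmbedding_const_vadd s) f T).symm
  have hdiff : ∀ A B : Set G, MeasurableSet B → μ A ≠ ∞ →
      ‖∫ t in A \ B, f t ∂μ‖ ≤ C * (μ.real A - μ.real (A ∩ B)) := fun A B hB hA ↦ by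
    rw [← measureReal_inter_add_sdiff hB hA, add_sub_cancel_left]
    exact norm_setIntegral_le_of_norm_le_const ((measure_mono sdiff_subset).trans_lt hA.lt_top)
      fun t _ ↦ hC t
  have hreal : μ.real (s +ᵥ T) = μ.real T := by
    rw [measureReal_def, measure_vadd, measureReal_def]
  have h₁ := hdiff T (s +ᵥ T) hsT hμT
  have h₂ := hdiff (s +ᵥ T) T hT hμsT
  rw [inter_comm, hreal] at h₂
  rw [htranslate, ← integral_inter_add_sdiff hsT (hint T hμT),
    ← integral_inter_add_sdiff hT (hint _ hμsT), inter_comm (s +ᵥ T), add_sub_add_left_eq_sub]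
  linarith [norm_sub_le (∫ t in T \ (s +ᵥ T), f t ∂μ) (∫ t in (s +ᵥ T) \ T, f t ∂μ)]

variable {E : Type*} [NormedAddCommGroup E] [NormedSpace ℝ E]

lemma IsAveragingSequence.measure_ne_zero [MeasurableSpace E] {μ : Measure E}
    [μ.IsOpenPosMeasure] {T : ℕ → Set E} (hT : IsAveragingSequence T) (n : ℕ) : μ (T n) ≠ 0 :=
  ((hT.isOpen n).measure_pos μ (hT.nonempty n)).ne'

variable [FiniteDimensional ℝ E]

lemma IsAveragingSequence.measure_ne_top [MeasurableSpace E] {μ : Measure E}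
    [IsFiniteMeasureOnCompacts μ] {T : ℕ → Set E} (hT : IsAveragingSequence T) (n : ℕ) :
    μ (T n) ≠ ∞ :=
  (hT.isBounded n).measure_lt_top.ne

variable [MeasurableSpace E] [BorelSpace E] {μ : Measure E} [μ.IsAddHaarMeasure]
  {T : ℕ → Set E}

lemma IsAveragingSequence.tendsto_measureReal_inter_vadd_div (hT : IsAveragingSequence T)
    (s : E) : Tendsto (fun n ↦ μ.real (T n ∩ (s +ᵥ T n)) / μ.real (T n)) atTop (𝓝 1) := by
  have hpos : ∀ n, 0 < μ.real (T n) := fun n ↦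
    ENNReal.toReal_pos (hT.measure_ne_zero n) (hT.measure_ne_top n)
  refine tendsto_order.2 ⟨fun b hb ↦ ?_, fun b hb ↦ Eventually.of_forall fun n ↦
    ((div_le_one (hpos n)).2 (measureReal_mono inter_subset_left (hT.measure_ne_top n))).trans_lt
      hb⟩
  have hlim : Tendsto (fun ρ : ℝ ↦ (1 - ρ) ^ Module.finrank ℝ E) (𝓝[>] 0) (𝓝 1) := by
    have hcont : ContinuousAt (fun ρ : ℝ ↦ (1 - ρ) ^ Module.finrank ℝ E) 0 := by fun_prop
    simpa using hcont.tendsto.mono_left nhdsWithin_le_nhds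
  obtain ⟨ρ, hbρ, hρ0, hρ1⟩ := ((hlim.eventually_const_lt hb).and
    (Ioc_mem_nhdsGT (zero_lt_one (α := ℝ)))).exists
  filter_upwards [hT.eventually_exists_ball_subset ((‖s‖ + 1) / ρ)] with n ⟨c, hc⟩
  have hinter := ENNReal.toReal_mono (measure_ne_top_of_subset inter_subset_left
    (hT.measure_ne_top n)) (addHaar_inter_vadd_ge_of_ball_subset (μ := μ) (s := s) (hT.convex n)
      hρ0 hρ1 hc (by rw [mul_div_cancel₀ _ hρ0.ne']; exact lt_add_one _))
  rw [ENNReal.toReal_mul, ENNReal.toReal_ofReal (pow_nonneg (sub_nonneg.2 hρ1) _)] at hinter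
  exact hbρ.trans_le ((le_div_iff₀ (hpos n)).2 hinter)

lemma IsAveragingSequence.tendsto_average_sub_translate (hT : IsAveragingSequence T) {f : E → ℝ}
    (hf : Measurable f) {C : ℝ} (hC : ∀ t, ‖f t‖ ≤ C) (s : E) :
    Tendsto (fun n ↦ ⨍ t in T n, (f t - f (s + t)) ∂μ) atTop (𝓝 0) := by
  have hlim : Tendsto (fun n ↦ 2 * C * (1 - μ.real (T n ∩ (s +ᵥ T n)) / μ.real (T n))) atTop
      (𝓝 0) := by
    simpa using ((hT.tendsto_measureReal_inter_vadd_div (μ := μ) s).const_sub 1).const_mul (2 * C)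
  refine squeeze_zero_norm (fun n ↦ ?_) hlim
  have hpos : 0 < μ.real (T n) := ENNReal.toReal_pos (hT.measure_ne_zero n) (hT.measure_ne_top n)
  have hint : ∀ g : E → ℝ, Measurable g → (∀ t, ‖g t‖ ≤ C) → IntegrableOn g (T n) μ :=
    fun g hg hgC ↦ Measure.integrableOn_of_bounded (hT.measure_ne_top n) hg.aestronglyMeasurable
      (Eventually.of_forall hgC)
  rw [setAverage_eq, integral_sub (hint f hf hC)
    (hint (fun t ↦ f (s + t)) (hf.comp (measurable_const_add s)) fun t ↦ hC _), norm_smul, norm_inv,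
    Real.norm_of_nonneg hpos.le, inv_mul_le_iff₀ hpos]
  refine (norm_setIntegral_sub_setIntegral_vadd_le hf.aestronglyMeasurable hC
    (hT.isOpen n).measurableSet (hT.measure_ne_top n) s).trans_eq ?_
  field_simp

end AveragingSequence

section ErgodicMeans

lemma ofReal_mul_measure_le_enorm_condExp_le {Ω : Type*} {m m₀ : MeasurableSpace Ω}
    {P : Measure Ω} (f : Ω → ℝ) (a : ℝ) :
    ENNReal.ofReal a * P {ω | ENNReal.ofReal a ≤ ‖(P[f | m]) ω‖ₑ} ≤ eLpNorm f 1 P := by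
  refine (mul_meas_ge_le_lintegral₀ integrable_condExp.aestronglyMeasurable.enorm _).trans ?_
  rw [← eLpNorm_one_eq_lintegral_enorm]
  exact eLpNorm_condExp_le_eLpNorm _ le_rfl

lemma setIntegral_preimage_comp_of_measurePreserving {α β F : Type*} [MeasurableSpace α]
    [MeasurableSpace β] [NormedAddCommGroup F] [NormedSpace ℝ F] {μ : Measure α} {ν : Measure β}
    {g : α → β} (hg : MeasurePreserving g μ ν) {f : β → F} (hf : AEStronglyMeasurable f ν)
    {s : Set β} (hs : MeasurableSet s) :
    ∫ x in g ⁻¹' s, f (g x) ∂μ = ∫ y in s, f y ∂ν := by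
  rw [← setIntegral_map hs (by rwa [hg.map_eq]) hg.aemeasurable, hg.map_eq]

variable {E Ω : Type*} [MeasurableSpace Ω] {P : Measure Ω} {X : E → Ω → ℝ}

lemma invariantEvents_le [Add E] (hX : ∀ t, Measurable (X t)) :
    invariantEvents X P ≤ ‹MeasurableSpace Ω› := by
  rintro _ ⟨A, hA, rfl⟩
  exact measurable_samplePath hX hA.1

lemma condExp_comp_samplePath_of_invariant [Add E] [IsFiniteMeasure P]
    (hX : ∀ t, Measurable (X t)) {u : (E → ℝ) → ℝ} (hum : Measurable u)
    (hui : Integrable u (P.map (samplePath X)))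
    (hu : ∀ t, u ∘ shift t =ᵐ[P.map (samplePath X)] u) :
    P[u ∘ samplePath X | invariantEvents X P] = u ∘ samplePath X := by
  refine condExp_of_stronglyMeasurable (invariantEvents_le hX) (Measurable.stronglyMeasurable ?_)
    (hui.comp_measurable (measurable_samplePath hX))
  intro B hB
  refine ⟨u ⁻¹' B, ⟨hum hB, fun t ↦ ?_⟩, rfl⟩
  filter_upwards [hu t] with x hx
  exact congrArg (· ∈ B) hx

lemma IsHomogeneous.condExp_comp_shift_comp_samplePath [Add E] [IsFiniteMeasure P]
    (hX : ∀ t, Measurable (X t)) (hhom : IsHomogeneous X P) {h : (E → ℝ) → ℝ}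
    (hh : Integrable h (P.map (samplePath X))) (s : E) :
    P[(h ∘ shift s) ∘ samplePath X | invariantEvents X P] =ᵐ[P]
      P[h ∘ samplePath X | invariantEvents X P] := by
  have hpath := measurable_samplePath hX
  have hpres : MeasurePreserving (samplePath X) P (P.map (samplePath X)) := ⟨hpath, rfl⟩
  have hshift := hhom.measurePreserving_shift hX s
  have hhs := hshift.integrable_comp_of_integrable hh
  refine (ae_eq_condExp_of_forall_setIntegral_eq (invariantEvents_le hX)
    (hh.comp_measurable hpath) (fun _ _ _ ↦ integrable_condExp.integrableOn) ?_
    stronglyMeasurable_condExp.aestronglyMeasurable)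
  rintro _ ⟨A, hA, rfl⟩ -
  have hinv : shift s ⁻¹' A =ᵐ[P.map (samplePath X)] A := hA.2 s
  rw [setIntegral_condExp (invariantEvents_le hX) (hhs.comp_measurable hpath) ⟨A, hA, rfl⟩]
  calc ∫ ω in samplePath X ⁻¹' A, (h ∘ shift s) (samplePath X ω) ∂P
      = ∫ x in A, h (shift s x) ∂P.map (samplePath X) :=
        setIntegral_preimage_comp_of_measurePreserving hpres hhs.aestronglyMeasurable hA.1
    _ = ∫ x in shift s ⁻¹' A, h (shift s x) ∂P.map (samplePath X) :=
        (setIntegral_congr_set hinv).symm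
    _ = ∫ x in A, h x ∂P.map (samplePath X) :=
        setIntegral_preimage_comp_of_measurePreserving hshift hh.aestronglyMeasurable hA.1
    _ = ∫ ω in samplePath X ⁻¹' A, h (samplePath X ω) ∂P :=
        (setIntegral_preimage_comp_of_measurePreserving hpres hh.aestronglyMeasurable hA.1).symm

lemma IsHomogeneous.comp_shift_ae_eq_of_setIntegral_eq [AddGroup E] [IsFiniteMeasure P]
    (hX : ∀ t, Measurable (X t)) (hhom : IsHomogeneous X P) {u : (E → ℝ) → ℝ}
    (hui : Integrable u (P.map (samplePath X)))
    (hu : ∀ (t : E) (B : Set (E → ℝ)), MeasurableSet B →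
      ∫ x in B, u x ∂P.map (samplePath X) = ∫ x in shift t ⁻¹' B, u x ∂P.map (samplePath X))
    (t : E) : u ∘ shift t =ᵐ[P.map (samplePath X)] u := by
  have hmp := hhom.measurePreserving_shift hX t
  refine Integrable.ae_eq_of_forall_setIntegral_eq _ _ (hmp.integrable_comp_of_integrable hui)
    hui fun A hA _ ↦ ?_
  have hAA : shift t ⁻¹' (shift (-t) ⁻¹' A) = A := by
    ext x
    simp only [mem_preimage, shift_shift, neg_add_cancel, shift_zero]
  have hAm : MeasurableSet (shift (-t) ⁻¹' A) := measurable_shift _ hA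
  rw [← hAA, ← hu t _ hAm]
  exact setIntegral_preimage_comp_of_measurePreserving hmp hui.aestronglyMeasurable hAm

/-- The functional `F` of the sample function of `X` satisfies the pointwise ergodic theorem along
the sets `T n`. -/
structure HasErgodicMeans [AddGroup E] [MeasureSpace E] (X : E → Ω → ℝ) (P : Measure Ω)
    (T : ℕ → Set E) (F : (E → ℝ) → ℝ) : Prop where
  measurable : Measurable F
  integrable : Integrable F (P.map (samplePath X))
  ae_tendsto : ∀ᵐ ω ∂P, Tendsto (fun n ↦ spatialMean (pathField X F) (T n) ω) atTop
    (𝓝 (P[F ∘ samplePath X | invariantEvents X P] ω))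

lemma HasErgodicMeans.const_smul [AddGroup E] [MeasureSpace E] {T : ℕ → Set E}
    {F : (E → ℝ) → ℝ} (hF : HasErgodicMeans X P T F) (a : ℝ) :
    HasErgodicMeans X P T (a • F) where
  measurable := hF.measurable.const_smul a
  integrable := hF.integrable.smul a
  ae_tendsto := by
    filter_upwards [hF.ae_tendsto, condExp_smul a (F ∘ samplePath X) (invariantEvents X P)]
      with ω hω hcond
    have hmean : ∀ n, spatialMean (pathField X (a • F)) (T n) ω =
        a • spatialMean (pathField X F) (T n) ω := fun n ↦ integral_smul a _
    simp only [hmean]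
    exact (hω.const_smul a).trans_eq (congrArg 𝓝 hcond.symm)

variable [AddCommGroup E] [MeasureSpace E] [MeasurableAdd₂ E] [IsFiniteMeasure P]
  {F G : (E → ℝ) → ℝ}

lemma ae_integrableOn_pathField (hX : Measurable (Function.uncurry X))
    (hhom : IsHomogeneous X P) (hF : Measurable F)
    (hFi : Integrable F (P.map (samplePath X)))
    {A : Set E} (hA : volume A ≠ ∞) : ∀ᵐ ω ∂P, IntegrableOn (fun t ↦ pathField X F t ω) A := by
  have hXt : ∀ t, Measurable (X t) := fun _ ↦ hX.of_uncurry_left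
  have : IsFiniteMeasure (volume.restrict A) := isFiniteMeasure_restrict.2 hA
  refine ((hhom.pathField hXt hF).integrable_prod (measurable_pathField hX hF) ?_
    (volume.restrict A)).prod_left_ae
  rw [pathField_zero]
  exact hFi.comp_measurable (measurable_samplePath hXt)

lemma ae_spatialMean_pathField_add (hX : Measurable (Function.uncurry X))
    (hhom : IsHomogeneous X P) (hF : Measurable F)
    (hFi : Integrable F (P.map (samplePath X)))
    (hG : Measurable G) (hGi : Integrable G (P.map (samplePath X))) {T : ℕ → Set E}
    (hT : ∀ n, volume (T n) ≠ ∞) :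
    ∀ᵐ ω ∂P, ∀ n, spatialMean (pathField X (F + G)) (T n) ω =
      spatialMean (pathField X F) (T n) ω + spatialMean (pathField X G) (T n) ω := by
  refine ae_all_iff.2 fun n ↦ ?_
  filter_upwards [ae_integrableOn_pathField hX hhom hF hFi (hT n),
    ae_integrableOn_pathField hX hhom hG hGi (hT n)] with ω hFω hGω
  simp only [spatialMean, setAverage_eq]
  rw [← smul_add, ← integral_add hFω hGω]
  rfl

lemma HasErgodicMeans.add (hX : Measurable (Function.uncurry X))
    (hhom : IsHomogeneous X P) {T : ℕ → Set E}
    (hT : ∀ n, volume (T n) ≠ ∞)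
    (hF : HasErgodicMeans X P T F) (hG : HasErgodicMeans X P T G) :
    HasErgodicMeans X P T (F + G) where
  measurable := hF.measurable.add hG.measurable
  integrable := hF.integrable.add hG.integrable
  ae_tendsto := by
    have hpath := measurable_samplePath fun t ↦ hX.of_uncurry_left (x := t)
    filter_upwards [hF.ae_tendsto, hG.ae_tendsto,
      ae_spatialMean_pathField_add hX hhom hF.measurable hF.integrable hG.measurable
        hG.integrable hT, condExp_add (hF.integrable.comp_measurable hpath)
        (hG.integrable.comp_measurable hpath) (invariantEvents X P)] with ω hFω hGω hmean hcond
    simp only [hmean]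
    exact (hFω.add hGω).trans_eq (congrArg 𝓝 hcond.symm)

lemma HasErgodicMeans.of_invariant (hX : Measurable (Function.uncurry X)) {T : ℕ → Set E}
    (hT₀ : ∀ n, volume (T n) ≠ 0) (hT : ∀ n, volume (T n) ≠ ∞) (hF : Measurable F)
    (hFi : Integrable F (P.map (samplePath X)))
    (hFinv : ∀ t, F ∘ shift t =ᵐ[P.map (samplePath X)] F) : HasErgodicMeans X P T F where
  measurable := hF
  integrable := hFi
  ae_tendsto := by
    have hXt : ∀ t, Measurable (X t) := fun _ ↦ hX.of_uncurry_left
    have hpath := measurable_samplePath hXt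
    have hconst : ∀ᵐ ω ∂P, ∀ n, ∀ᵐ t ∂volume.restrict (T n),
        pathField X F t ω = F (samplePath X ω) := by
      have (n : ℕ) : IsFiniteMeasure (volume.restrict (T n)) := isFiniteMeasure_restrict.2 (hT n)
      refine ae_all_iff.2 fun n ↦ (Measure.ae_ae_comm ?_).1 <|
        Eventually.of_forall fun t ↦ ae_of_ae_map hpath.aemeasurable (hFinv t)
      exact measurableSet_eq_fun (measurable_pathField hX hF)
        (hF.comp (hpath.comp measurable_snd))
    filter_upwards [hconst] with ω hω
    rw [condExp_comp_samplePath_of_invariant hXt hF hFi hFinv]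
    refine tendsto_const_nhds.congr fun n ↦ ?_
    rw [spatialMean, average_congr (hω n), setAverage_const (hT₀ n) (hT n)]
    rfl

end ErgodicMeans

section PointwiseErgodicTheorem

variable {E : Type*} [NormedAddCommGroup E] [NormedSpace ℝ E] [FiniteDimensional ℝ E]
  [MeasureSpace E] [BorelSpace E] [(volume : Measure E).IsAddHaarMeasure]
  {Ω : Type*} [MeasurableSpace Ω] {P : Measure Ω} [IsFiniteMeasure P] {X : E → Ω → ℝ}
  {T : ℕ → Set E} {F G : (E → ℝ) → ℝ}

lemma IsAveragingSequence.hasErgodicMeans_coboundary (hT : IsAveragingSequence T)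
    (hX : Measurable (Function.uncurry X)) (hhom : IsHomogeneous X P) {h : (E → ℝ) → ℝ}
    (hh : Measurable h) {C : ℝ} (hC : ∀ x, ‖h x‖ ≤ C) (s : E) :
    HasErgodicMeans X P T (h - h ∘ shift s) := by
  have hXt : ∀ t, Measurable (X t) := fun _ ↦ hX.of_uncurry_left
  have hpath := measurable_samplePath hXt
  have hint : Integrable h (P.map (samplePath X)) :=
    Integrable.of_bound hh.aestronglyMeasurable C (Eventually.of_forall hC)
  have hints := (hhom.measurePreserving_shift hXt s).integrable_comp_of_integrable hint
  refine ⟨hh.sub (hh.comp (measurable_shift s)), hint.sub hints, ?_⟩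
  filter_upwards [condExp_sub (hint.comp_measurable hpath) (hints.comp_measurable hpath)
    (invariantEvents X P), hhom.condExp_comp_shift_comp_samplePath hXt hint s] with ω hsub hshift
  have hmean : ∀ n, spatialMean (pathField X (h - h ∘ shift s)) (T n) ω =
      ⨍ t in T n, (pathField X h t ω - pathField X h (s + t) ω) := fun n ↦ by
    simp only [spatialMean, pathField, Pi.sub_apply, Function.comp_apply, shift_shift]
  have hlim : (P[(h - h ∘ shift s) ∘ samplePath X | invariantEvents X P]) ω = 0 :=
    hsub.trans (sub_eq_zero.2 hshift.symm)
  simp only [hmean, hlim]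
  exact hT.tendsto_average_sub_translate (f := fun t ↦ pathField X h t ω)
    (measurable_pathField hX hh).of_uncurry_right (fun _ ↦ hC _) s

lemma HasErgodicMeans.ae_eventually_abs_sub_condExp_le (hT : IsAveragingSequence T)
    (hX : Measurable (Function.uncurry X)) (hhom : IsHomogeneous X P)
    (hG : HasErgodicMeans X P T G) (hF : Measurable F)
    (hFi : Integrable F (P.map (samplePath X))) {a : ℝ} (ha : 0 < a) :
    ∀ᵐ ω ∂P, (∀ n, |spatialMean (pathField X (F - G)) (T n) ω| ≤ a) →
      |(P[(F - G) ∘ samplePath X | invariantEvents X P]) ω| < a →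
      ∀ᶠ n in atTop, |spatialMean (pathField X F) (T n) ω -
        (P[F ∘ samplePath X | invariantEvents X P]) ω| ≤ 3 * a := by
  have hpath := measurable_samplePath fun t ↦ hX.of_uncurry_left (x := t)
  have hFGi := hFi.sub hG.integrable
  filter_upwards [hG.ae_tendsto, ae_spatialMean_pathField_add hX hhom hG.measurable
    hG.integrable (hF.sub hG.measurable) hFGi hT.measure_ne_top,
    condExp_add (hG.integrable.comp_measurable hpath) (hFGi.comp_measurable hpath)
      (invariantEvents X P)] with ω hlim hmean hcond hsmall hsmall'
  rw [add_sub_cancel G F] at hmean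
  replace hcond : (P[F ∘ samplePath X | invariantEvents X P]) ω =
      (P[G ∘ samplePath X | invariantEvents X P]) ω +
        (P[(F - G) ∘ samplePath X | invariantEvents X P]) ω := by
    rw [← Pi.add_apply, ← hcond, ← Pi.add_comp, add_sub_cancel G F]
  filter_upwards [(tendsto_iff_norm_sub_tendsto_zero.1 hlim).eventually_le_const ha] with n hn
  rw [hmean, hcond]
  rw [Real.norm_eq_abs, abs_le] at hn
  have hn' := abs_le.1 (hsmall n)
  rw [abs_lt] at hsmall'
  exact abs_le.2 ⟨by linarith, by linarith⟩

lemma HasErgodicMeans.ofReal_mul_measure_not_eventually_le (hT : IsAveragingSequence T)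
    (hX : Measurable (Function.uncurry X)) (hhom : IsHomogeneous X P)
    (hG : HasErgodicMeans X P T G) (hF : Measurable F)
    (hFi : Integrable F (P.map (samplePath X))) {a : ℝ} (ha : 0 < a) :
    ENNReal.ofReal a * P {ω | ¬ ∀ᶠ n in atTop, |spatialMean (pathField X F) (T n) ω -
        (P[F ∘ samplePath X | invariantEvents X P]) ω| ≤ 3 * a} ≤
      (8 ^ Module.finrank ℝ E + 1) * eLpNorm (F - G) 1 (P.map (samplePath X)) := by
  have hXt : ∀ t, Measurable (X t) := fun _ ↦ hX.of_uncurry_left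
  have hpath := measurable_samplePath hXt
  have hD : Measurable (F - G) := hF.sub hG.measurable
  have hDi : Integrable (pathField X (F - G) 0) P := by
    rw [pathField_zero]
    exact (hFi.sub hG.integrable).comp_measurable hpath
  have hsub : {ω | ¬ ∀ᶠ n in atTop, |spatialMean (pathField X F) (T n) ω -
        (P[F ∘ samplePath X | invariantEvents X P]) ω| ≤ 3 * a} ≤ᵐ[P]
      ({ω | ∃ n, a < |spatialMean (pathField X (F - G)) (T n) ω|} ∪
        {ω | ENNReal.ofReal a ≤ ‖(P[pathField X (F - G) 0 | invariantEvents X P]) ω‖ₑ} :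
          Set Ω) := by
    rw [pathField_zero]
    filter_upwards [hG.ae_eventually_abs_sub_condExp_le hT hX hhom hF hFi ha] with ω hω hnot
    by_contra hsmall
    obtain ⟨hmean, hcond⟩ := not_or.1 hsmall
    refine hnot (hω (fun n ↦ not_lt.1 fun hn ↦ hmean ⟨n, hn⟩) (not_le.1 fun hle ↦ hcond ?_))
    exact (ENNReal.ofReal_le_ofReal hle).trans_eq (Real.enorm_eq_ofReal_abs _).symm
  rw [eLpNorm_map_measure hD.aestronglyMeasurable hpath.aemeasurable,
    ← pathField_zero (F := F - G), add_mul, one_mul]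
  refine (mul_le_mul_right ((measure_mono_ae hsub).trans (measure_union_le _ _)) _).trans ?_
  rw [mul_add]
  refine add_le_add ?_ (ofReal_mul_measure_le_enorm_condExp_le _ a)
  rw [eLpNorm_one_eq_lintegral_enorm]
  exact mul_measure_exists_lt_abs_spatialMean_le hT.monotone hT.convex hT.isOpen hT.isBounded
    hT.nonempty (measurable_pathField hX hD) (hhom.pathField hXt hD) hDi a

lemma HasErgodicMeans.of_forall_exists_eLpNorm_sub_le (hT : IsAveragingSequence T)
    (hX : Measurable (Function.uncurry X)) (hhom : IsHomogeneous X P) (hF : Measurable F)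
    (hFi : Integrable F (P.map (samplePath X)))
    (happrox : ∀ ε : ℝ≥0∞, ε ≠ 0 → ∃ G, HasErgodicMeans X P T G ∧
      eLpNorm (F - G) 1 (P.map (samplePath X)) ≤ ε) : HasErgodicMeans X P T F := by
  refine ⟨hF, hFi, ?_⟩
  have hae : ∀ a : ℝ, 0 < a → ∀ᵐ ω ∂P, ∀ᶠ n in atTop, |spatialMean (pathField X F) (T n) ω -
      (P[F ∘ samplePath X | invariantEvents X P]) ω| ≤ 3 * a := fun a ha ↦ by
    refine (mul_eq_zero.1 (nonpos_iff_eq_zero.1 ?_)).resolve_left (ENNReal.ofReal_pos.2 ha).ne'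
    refine ge_of_tendsto (x := 𝓝[>] (0 : ℝ≥0∞))
      (f := fun ε ↦ (8 ^ Module.finrank ℝ E + 1) * ε) ?_
      (eventually_mem_nhdsWithin.mono fun ε (hε : ε ∈ Ioi 0) ↦ ?_)
    · have := ENNReal.Tendsto.const_mul (a := (8 ^ Module.finrank ℝ E + 1 : ℝ≥0∞))
        (tendsto_id (x := 𝓝 0)) (Or.inr (by finiteness))
      simpa using this.mono_left nhdsWithin_le_nhds
    · obtain ⟨G, hG, hGε⟩ := happrox ε (ne_of_gt hε)
      exact (hG.ofReal_mul_measure_not_eventually_le hT hX hhom hF hFi ha).trans (by gcongr)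
  have hall := ae_all_iff.2 fun j : ℕ ↦ hae (1 / ((j : ℝ) + 1)) Nat.one_div_pos_of_nat
  filter_upwards [hall] with ω hω
  refine Metric.tendsto_nhds.2 fun δ hδ ↦ ?_
  obtain ⟨j, hj⟩ := exists_nat_one_div_lt (show 0 < δ / 3 by positivity)
  filter_upwards [hω j] with n hn
  rw [Real.dist_eq]
  linarith

lemma HasErgodicMeans.congr_ae (hT : IsAveragingSequence T) (hX : Measurable (Function.uncurry X))
    (hhom : IsHomogeneous X P) (hG : HasErgodicMeans X P T G) (hF : Measurable F)
    (hFG : F =ᵐ[P.map (samplePath X)] G) : HasErgodicMeans X P T F := by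
  refine .of_forall_exists_eLpNorm_sub_le hT hX hhom hF (hG.integrable.congr hFG.symm)
    fun ε _ ↦ ⟨G, hG, ?_⟩
  have hzero : F - G =ᵐ[P.map (samplePath X)] 0 := hFG.mono fun x hx ↦ sub_eq_zero.2 hx
  rw [eLpNorm_congr_ae hzero, eLpNorm_zero]
  exact zero_le

variable {P : Measure Ω} [IsProbabilityMeasure P]

/-- The functionals in `L²` that satisfy the pointwise ergodic theorem form a closed subspace. It
contains the bounded coboundaries, so its orthogonal complement consists of invariant functionals,
which belong to it as well. -/
lemma hasErgodicMeans_of_mem_L2 (hT : IsAveragingSequence T)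
    (hX : Measurable (Function.uncurry X)) (hhom : IsHomogeneous X P)
    (f : Lp ℝ 2 (P.map (samplePath X))) : HasErgodicMeans X P T f := by
  have hXt : ∀ t, Measurable (X t) := fun _ ↦ hX.of_uncurry_left
  let ν := P.map (samplePath X)
  have : IsProbabilityMeasure ν :=
    Measure.isProbabilityMeasure_map (measurable_samplePath hXt).aemeasurable
  have hLp : ∀ f : Lp ℝ 2 ν, Measurable f := fun f ↦ (Lp.stronglyMeasurable f).measurable
  have hLpi : ∀ f : Lp ℝ 2 ν, Integrable f ν := fun f ↦ (Lp.memLp f).integrable one_le_two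
  let M : Submodule ℝ (Lp ℝ 2 ν) :=
    { carrier := {f | HasErgodicMeans X P T f}
      add_mem' := fun {f g} hf hg ↦
        (hf.add hX hhom hT.measure_ne_top hg).congr_ae hT hX hhom (hLp _) (Lp.coeFn_add f g)
      zero_mem' := (HasErgodicMeans.of_invariant hX hT.measure_ne_zero hT.measure_ne_top
        measurable_const (integrable_zero _ _ _) fun _ ↦ .rfl).congr_ae hT hX hhom (hLp _)
          (Lp.coeFn_zero ℝ 2 ν)
      smul_mem' := fun a f hf ↦
        (hf.const_smul a).congr_ae hT hX hhom (hLp _) (Lp.coeFn_smul a f) }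
  have hclosed : IsClosed (M : Set (Lp ℝ 2 ν)) := by
    refine isClosed_of_closure_subset fun f hf ↦ ?_
    refine .of_forall_exists_eLpNorm_sub_le hT hX hhom (hLp f) (hLpi f) fun ε hε ↦ ?_
    obtain ⟨g, hg, hfg⟩ := EMetric.mem_closure_iff.1 hf ε (pos_iff_ne_zero.2 hε)
    rw [Lp.edist_def] at hfg
    exact ⟨g, hg, (eLpNorm_le_eLpNorm_of_exponent_le one_le_two
      ((Lp.aestronglyMeasurable f).sub (Lp.aestronglyMeasurable g))).trans hfg.le⟩
  have hinv : ∀ u ∈ Mᗮ, u ∈ M := fun u hu ↦ by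
    refine .of_invariant hX hT.measure_ne_zero hT.measure_ne_top (hLp u) (hLpi u)
      (hhom.comp_shift_ae_eq_of_setIntegral_eq hXt (hLpi u) fun t B hB ↦ ?_)
    have hmem : indicatorConstLp 2 hB (measure_ne_top ν _) (1 : ℝ) -
        indicatorConstLp 2 (measurable_shift t hB) (measure_ne_top ν _) (1 : ℝ) ∈ M :=
      (hT.hasErgodicMeans_coboundary hX hhom (measurable_one.indicator hB)
        (fun x ↦ (norm_indicator_le_norm_self 1 x).trans_eq norm_one) t).congr_ae hT hX hhom (hLp _)
        ((Lp.coeFn_sub _ _).trans (indicatorConstLp_coeFn.sub indicatorConstLp_coeFn))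
    have horth := (Submodule.mem_orthogonal _ _).1 hu _ hmem
    rwa [inner_sub_left, L2.inner_indicatorConstLp_one, L2.inner_indicatorConstLp_one,
      sub_eq_zero] at horth
  have : CompleteSpace M := hclosed.completeSpace_coe
  have htop : M = ⊤ := by
    rw [← Submodule.orthogonal_eq_bot_iff, ← le_bot_iff, ← M.inf_orthogonal_eq_bot]
    exact fun u hu ↦ ⟨hinv u hu, hu⟩
  exact htop.ge (Submodule.mem_top (x := f))

theorem ae_tendsto_spatialMean (hT : IsAveragingSequence T)
    (hX : Measurable (Function.uncurry X)) (hhom : IsHomogeneous X P) (hF : Measurable F)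
    (hFi : Integrable F (P.map (samplePath X))) :
    ∀ᵐ ω ∂P, Tendsto (fun n ↦ spatialMean (pathField X F) (T n) ω) atTop
      (𝓝 (P[F ∘ samplePath X | invariantEvents X P] ω)) := by
  refine (HasErgodicMeans.of_forall_exists_eLpNorm_sub_le hT hX hhom hF hFi
    fun ε hε ↦ ?_).ae_tendsto
  obtain ⟨g, hFg, -⟩ := (memLp_one_iff_integrable.2 hFi).exists_simpleFunc_eLpNorm_sub_lt
    ENNReal.one_ne_top hε
  have hg : MemLp g 2 (P.map (samplePath X)) := g.memLp_of_isFiniteMeasure 2 _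
  exact ⟨g, (hasErgodicMeans_of_mem_L2 hT hX hhom hg.toLp).congr_ae hT hX hhom g.measurable
    hg.coeFn_toLp.symm, hFg.le⟩

end PointwiseErgodicTheorem

section LindebergCentralLimitTheorem

lemma norm_finsetProd_sub_finsetProd_le {ι R : Type*} [NormedCommRing R] [NormOneClass R]
    (s : Finset ι) {a b : ι → R} (ha : ∀ i ∈ s, ‖a i‖ ≤ 1) (hb : ∀ i ∈ s, ‖b i‖ ≤ 1) :
    ‖∏ i ∈ s, a i - ∏ i ∈ s, b i‖ ≤ ∑ i ∈ s, ‖a i - b i‖ := by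
  induction s using Finset.cons_induction with
  | empty => simp
  | cons j s hj ih =>
    rw [Finset.forall_mem_cons] at ha hb
    have hprod : ‖∏ i ∈ s, b i‖ ≤ 1 :=
      (Finset.norm_prod_le s b).trans (Finset.prod_le_one (fun _ _ ↦ norm_nonneg _) hb.2)
    have hsplit : a j * ∏ i ∈ s, a i - b j * ∏ i ∈ s, b i =
        (a j - b j) * ∏ i ∈ s, b i + a j * (∏ i ∈ s, a i - ∏ i ∈ s, b i) := by ring
    rw [Finset.prod_cons, Finset.prod_cons, Finset.sum_cons, hsplit]
    refine (norm_add_le _ _).trans (add_le_add ?_ ?_)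
    · exact (norm_mul_le _ _).trans (mul_le_of_le_one_right (norm_nonneg _) hprod)
    · exact (norm_mul_le _ _).trans
        ((mul_le_of_le_one_left (norm_nonneg _) ha.1).trans (ih ha.2 hb.2))

lemma norm_exp_mul_I_sub_taylor_le_abs_pow_three {x : ℝ} (hx : |x| ≤ 1) :
    ‖Complex.exp (x * Complex.I) - (1 + x * Complex.I - x ^ 2 / 2)‖ ≤ |x| ^ 3 := by
  have hnorm : ‖(x : ℂ) * Complex.I‖ = |x| := by simp
  have hbound := Complex.exp_bound (x := x * Complex.I) (by rwa [hnorm]) (n := 3) (by norm_num)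
  have htaylor : ∑ m ∈ Finset.range 3, ((x : ℂ) * Complex.I) ^ m / m.factorial =
      1 + x * Complex.I - x ^ 2 / 2 := by
    simp only [Finset.sum_range_succ, Finset.sum_range_zero, mul_pow, Nat.factorial,
      Complex.I_sq]
    push_cast
    ring
  rw [hnorm, htaylor] at hbound
  refine hbound.trans (mul_le_of_le_one_right (by positivity) ?_)
  norm_num [Nat.factorial]

lemma norm_exp_mul_I_sub_taylor_le_sq (x : ℝ) :
    ‖Complex.exp (x * Complex.I) - (1 + x * Complex.I - x ^ 2 / 2)‖ ≤ 4 * x ^ 2 := by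
  rw [← sq_abs x]
  rcases le_total |x| 1 with hx | hx
  · refine (norm_exp_mul_I_sub_taylor_le_abs_pow_three hx).trans ?_
    nlinarith [sq_nonneg |x|]
  · have htaylor : ‖(1 : ℂ) + x * Complex.I - x ^ 2 / 2‖ ≤ 1 + |x| + |x| ^ 2 / 2 := by
      refine (norm_sub_le _ _).trans (add_le_add ((norm_add_le _ _).trans ?_) ?_) <;> simp
    refine (norm_sub_le _ _).trans ?_
    rw [Complex.norm_exp_ofReal_mul_I]
    nlinarith

lemma abs_exp_neg_sub_one_sub_le_sq {x : ℝ} (hx : 0 ≤ x) : |Real.exp (-x) - (1 - x)| ≤ x ^ 2 := by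
  rcases le_total x 1 with hx1 | hx1
  · have h := Real.abs_exp_sub_one_sub_id_le (x := -x) (by rwa [abs_neg, abs_of_nonneg hx])
    rwa [neg_sq, sub_neg_eq_add, sub_add] at h
  · rw [abs_of_nonneg (sub_nonneg.2 (Real.one_sub_le_exp_neg x))]
    nlinarith [Real.exp_le_one_iff.2 (neg_nonpos.2 hx)]

variable {Ω : Type*} [MeasurableSpace Ω] {Q : Measure Ω}

/-- The part of the second moment of `ξ` carried by the values of modulus larger than `ε`, as in
Lindeberg's condition. -/
noncomputable def tailMoment (Q : Measure Ω) (ξ : Ω → ℝ) (ε : ℝ) : ℝ :=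
  ∫ ω in {ω | ε < |ξ ω|}, ξ ω ^ 2 ∂Q

lemma tailMoment_nonneg (ξ : Ω → ℝ) (ε : ℝ) : 0 ≤ tailMoment Q ξ ε :=
  integral_nonneg fun _ ↦ sq_nonneg _

lemma tailMoment_const_mul_le {ξ : Ω → ℝ} (hξ : MemLp ξ 2 Q) {w C : ℝ} (hC : 0 < C)
    (hw : |w| ≤ C) (ε : ℝ) :
    tailMoment Q (fun ω ↦ w * ξ ω) ε ≤ C ^ 2 * tailMoment Q ξ (ε / C) := by
  have hsub : {ω | ε < |w * ξ ω|} ⊆ {ω | ε / C < |ξ ω|} := fun ω (hω : ε < |w * ξ ω|) ↦ by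
    rw [abs_mul] at hω
    exact (div_lt_iff₀' hC).2 (hω.trans_le (by gcongr))
  have hw2 : w ^ 2 ≤ C ^ 2 := sq_le_sq' (abs_le.1 hw).1 (abs_le.1 hw).2
  calc tailMoment Q (fun ω ↦ w * ξ ω) ε
      = w ^ 2 * ∫ ω in {ω | ε < |w * ξ ω|}, ξ ω ^ 2 ∂Q := by
        rw [tailMoment, ← integral_const_mul]
        simp only [mul_pow]
    _ ≤ C ^ 2 * tailMoment Q ξ (ε / C) := by
        refine mul_le_mul hw2 (setIntegral_mono_set hξ.integrable_sq.integrableOn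
          (ae_of_all _ fun _ ↦ sq_nonneg _) hsub.eventuallyLE)
          (integral_nonneg fun _ ↦ sq_nonneg _) (sq_nonneg C)

/-- Triangular arrays with independent, eventually centred square-integrable rows whose variance
tends to `v` and which satisfy Lindeberg's condition. -/
structure IsLindebergArray {ι : ℕ → Type*} [∀ n, Fintype (ι n)] (ξ : ∀ n, ι n → Ω → ℝ)
    (Q : Measure Ω) (v : ℝ) : Prop where
  measurable : ∀ n i, Measurable (ξ n i)
  iIndepFun : ∀ n, iIndepFun (ξ n) Q
  memLp : ∀ᶠ n in atTop, ∀ i, MemLp (ξ n i) 2 Q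
  integral_eq_zero : ∀ᶠ n in atTop, ∀ i, ∫ ω, ξ n i ω ∂Q = 0
  tendsto_sum_integral_sq : Tendsto (fun n ↦ ∑ i, ∫ ω, ξ n i ω ^ 2 ∂Q) atTop (𝓝 v)
  tendsto_sum_tailMoment : ∀ ε : ℝ, 0 < ε →
    Tendsto (fun n ↦ ∑ i, tailMoment Q (ξ n i) ε) atTop (𝓝 0)

namespace IsLindebergArray

variable {ι : ℕ → Type*} [∀ n, Fintype (ι n)] {ξ : ∀ n, ι n → Ω → ℝ} {v : ℝ}

lemma const_mul (hξ : IsLindebergArray ξ Q v) {w : ∀ n, ι n → ℝ} {C : ℝ}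
    (hw : ∀ n i, |w n i| ≤ C) {v' : ℝ}
    (hv' : Tendsto (fun n ↦ ∑ i, w n i ^ 2 * ∫ ω, ξ n i ω ^ 2 ∂Q) atTop (𝓝 v')) :
    IsLindebergArray (fun n i ω ↦ w n i * ξ n i ω) Q v' where
  measurable n i := (hξ.measurable n i).const_mul _
  iIndepFun n := (hξ.iIndepFun n).comp (fun i x ↦ w n i * x) fun i ↦ measurable_const_mul _
  memLp := hξ.memLp.mono fun n hn i ↦ (hn i).const_mul _
  integral_eq_zero := hξ.integral_eq_zero.mono fun n hn i ↦ by
    rw [integral_const_mul, hn i, mul_zero]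
  tendsto_sum_integral_sq := by simpa only [mul_pow, integral_const_mul] using hv'
  tendsto_sum_tailMoment ε hε := by
    have hC : 0 < |C| + 1 := by positivity
    have hlim := (hξ.tendsto_sum_tailMoment (ε / (|C| + 1)) (by positivity)).const_mul
      ((|C| + 1) ^ 2)
    rw [mul_zero] at hlim
    refine squeeze_zero' (Eventually.of_forall fun n ↦ Finset.sum_nonneg fun i _ ↦
      tailMoment_nonneg _ _) (hξ.memLp.mono fun n hn ↦ ?_) hlim
    rw [Finset.mul_sum]
    exact Finset.sum_le_sum fun i _ ↦ tailMoment_const_mul_le (hn i) hC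
      ((hw n i).trans ((le_abs_self C).trans (le_add_of_nonneg_right zero_le_one))) ε

end IsLindebergArray

variable [IsProbabilityMeasure Q]

lemma integral_sq_le_sq_add_tailMoment {ξ : Ω → ℝ} (hξ : Measurable ξ) (hξ2 : MemLp ξ 2 Q)
    (ε : ℝ) : ∫ ω, ξ ω ^ 2 ∂Q ≤ ε ^ 2 + tailMoment Q ξ ε := by
  have hset : MeasurableSet {ω | ε < |ξ ω|} := measurableSet_lt measurable_const hξ.abs
  rw [← integral_add_compl hset hξ2.integrable_sq, add_comm, tailMoment]
  gcongr
  calc ∫ ω in {ω | ε < |ξ ω|}ᶜ, ξ ω ^ 2 ∂Q ≤ ∫ _ in {ω | ε < |ξ ω|}ᶜ, ε ^ 2 ∂Q := by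
        refine setIntegral_mono_on hξ2.integrable_sq.integrableOn integrableOn_const hset.compl
          fun ω hω ↦ ?_
        rw [← sq_abs]
        exact pow_le_pow_left₀ (abs_nonneg _) (not_lt.1 (show ¬ε < |ξ ω| from hω)) 2
    _ ≤ ε ^ 2 := by
        rw [setIntegral_const, smul_eq_mul]
        exact mul_le_of_le_one_left (sq_nonneg ε) measureReal_le_one

lemma integral_taylor_exp_mul_I {ξ : Ω → ℝ} (hξ2 : MemLp ξ 2 Q) (hmean : ∫ ω, ξ ω ∂Q = 0) :
    ∫ ω, (1 + ξ ω * Complex.I - (ξ ω : ℂ) ^ 2 / 2) ∂Q =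
      1 - ((∫ ω, ξ ω ^ 2 ∂Q : ℝ) : ℂ) / 2 := by
  have hlinear : Integrable (fun ω ↦ (ξ ω : ℂ) * Complex.I) Q :=
    ((hξ2.integrable one_le_two).ofReal).mul_const _
  have hquadratic : Integrable (fun ω ↦ ((ξ ω ^ 2 : ℝ) : ℂ) / 2) Q :=
    hξ2.integrable_sq.ofReal.div_const 2
  simp only [← Complex.ofReal_pow]
  rw [integral_sub (by exact (integrable_const _).add hlinear) hquadratic,
    integral_add (integrable_const _) hlinear, integral_mul_const, integral_div]
  simp only [integral_complex_ofReal, hmean]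
  simp

lemma norm_charFun_map_one_sub_le {ξ : Ω → ℝ} (hξ : Measurable ξ) (hξ2 : MemLp ξ 2 Q)
    (hmean : ∫ ω, ξ ω ∂Q = 0) {ε : ℝ} (hε0 : 0 ≤ ε) (hε : ε ≤ 1) :
    ‖charFun (Q.map ξ) 1 - (1 - ((∫ ω, ξ ω ^ 2 ∂Q : ℝ) : ℂ) / 2)‖ ≤
      ε * ∫ ω, ξ ω ^ 2 ∂Q + 4 * tailMoment Q ξ ε := by
  have hset : MeasurableSet {ω | ε < |ξ ω|} := measurableSet_lt measurable_const hξ.abs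
  have hexp : Integrable (fun ω ↦ Complex.exp (ξ ω * Complex.I)) Q :=
    Integrable.of_bound (by fun_prop) 1
      (ae_of_all _ fun ω ↦ (Complex.norm_exp_ofReal_mul_I _).le)
  have htaylor : Integrable (fun ω ↦ 1 + ξ ω * Complex.I - (ξ ω : ℂ) ^ 2 / 2) Q := by
    have hsq : Integrable (fun ω ↦ (ξ ω : ℂ) ^ 2) Q := by
      simp only [← Complex.ofReal_pow]
      exact hξ2.integrable_sq.ofReal
    exact ((integrable_const 1).add
      ((hξ2.integrable one_le_two).ofReal.mul_const _)).sub (hsq.div_const 2)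
  have hchar : charFun (Q.map ξ) 1 = ∫ ω, Complex.exp (ξ ω * Complex.I) ∂Q := by
    rw [charFun_apply_real, integral_map hξ.aemeasurable (by fun_prop)]
    simp only [Complex.ofReal_one, one_mul]
  have hsmall := hξ2.integrable_sq.const_mul ε
  have htail := (hξ2.integrable_sq.const_mul 4).indicator hset
  rw [hchar, ← integral_taylor_exp_mul_I hξ2 hmean, ← integral_sub hexp htaylor, tailMoment,
    ← integral_const_mul, ← integral_const_mul, ← integral_indicator hset,
    ← integral_add hsmall htail]
  refine (norm_integral_le_integral_norm _).trans
    (integral_mono (hexp.sub htaylor).norm (hsmall.add htail) fun ω ↦ ?_)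
  by_cases hω : ε < |ξ ω|
  · rw [indicator_of_mem (by exact hω)]
    exact (norm_exp_mul_I_sub_taylor_le_sq _).trans (le_add_of_nonneg_left (by positivity))
  · rw [indicator_of_notMem (by exact hω), add_zero]
    have hωε : |ξ ω| ≤ ε := not_lt.1 hω
    calc _ ≤ |ξ ω| ^ 3 := norm_exp_mul_I_sub_taylor_le_abs_pow_three (hωε.trans hε)
      _ = |ξ ω| * ξ ω ^ 2 := by rw [← sq_abs (ξ ω)]; ring
      _ ≤ ε * ξ ω ^ 2 := by gcongr

lemma norm_charFun_map_one_sub_exp_le {ξ : Ω → ℝ} (hξ : Measurable ξ) (hξ2 : MemLp ξ 2 Q)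
    (hmean : ∫ ω, ξ ω ∂Q = 0) {ε : ℝ} (hε0 : 0 ≤ ε) (hε : ε ≤ 1) :
    ‖charFun (Q.map ξ) 1 - Real.exp (-((∫ ω, ξ ω ^ 2 ∂Q) / 2))‖ ≤
      (2 * ε + tailMoment Q ξ ε) * ∫ ω, ξ ω ^ 2 ∂Q + 4 * tailMoment Q ξ ε := by
  set v := ∫ ω, ξ ω ^ 2 ∂Q
  have hv0 : 0 ≤ v := integral_nonneg fun ω ↦ sq_nonneg (ξ ω)
  have hv : v ≤ ε + tailMoment Q ξ ε :=
    (integral_sq_le_sq_add_tailMoment hξ hξ2 ε).trans (by nlinarith)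
  have hgauss : ‖(1 - (v : ℂ) / 2) - Real.exp (-(v / 2))‖ ≤ v ^ 2 := by
    have h := abs_exp_neg_sub_one_sub_le_sq (div_nonneg hv0 zero_le_two)
    rw [norm_sub_rev, show (1 : ℂ) - v / 2 = ((1 - v / 2 : ℝ) : ℂ) by push_cast; rfl,
      ← Complex.ofReal_sub, Complex.norm_real, Real.norm_eq_abs]
    exact h.trans (by nlinarith)
  calc _ ≤ (ε * v + 4 * tailMoment Q ξ ε) + v ^ 2 :=
        (norm_sub_le_norm_sub_add_norm_sub _ _ _).trans
          (add_le_add (norm_charFun_map_one_sub_le hξ hξ2 hmean hε0 hε) hgauss)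
    _ ≤ _ := by nlinarith

lemma norm_charFun_map_sum_one_sub_exp_le {ι : Type*} [Fintype ι] {ξ : ι → Ω → ℝ}
    (hξ : ∀ i, Measurable (ξ i)) (hind : iIndepFun ξ Q) (hξ2 : ∀ i, MemLp (ξ i) 2 Q)
    (hmean : ∀ i, ∫ ω, ξ i ω ∂Q = 0) {ε : ℝ} (hε0 : 0 ≤ ε) (hε : ε ≤ 1) :
    ‖charFun (Q.map fun ω ↦ ∑ i, ξ i ω) 1 -
        Real.exp (-((∑ i, ∫ ω, ξ i ω ^ 2 ∂Q) / 2))‖ ≤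
      (2 * ε + ∑ i, tailMoment Q (ξ i) ε) * ∑ i, ∫ ω, ξ i ω ^ 2 ∂Q +
        4 * ∑ i, tailMoment Q (ξ i) ε := by
  have : ∀ i, IsProbabilityMeasure (Q.map (ξ i)) := fun i ↦
    Measure.isProbabilityMeasure_map (hξ i).aemeasurable
  rw [hind.charFun_map_fun_sum_eq_prod fun i ↦ (hξ i).aemeasurable, Finset.prod_apply,
    Finset.sum_div, ← Finset.sum_neg_distrib, Real.exp_sum, Complex.ofReal_prod]
  refine (norm_finsetProd_sub_finsetProd_le _ (fun i _ ↦ norm_charFun_le_one _)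
    fun i _ ↦ ?_).trans ?_
  · rw [Complex.norm_real, Real.norm_eq_abs, Real.abs_exp, Real.exp_le_one_iff, neg_nonpos]
    exact div_nonneg (integral_nonneg fun ω ↦ sq_nonneg (ξ i ω)) zero_le_two
  · rw [Finset.mul_sum, Finset.mul_sum, ← Finset.sum_add_distrib]
    refine Finset.sum_le_sum fun i _ ↦
      (norm_charFun_map_one_sub_exp_le (hξ i) (hξ2 i) (hmean i) hε0 hε).trans ?_
    gcongr
    exact Finset.single_le_sum (fun j _ ↦ tailMoment_nonneg (ξ j) ε) (Finset.mem_univ i)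

namespace IsLindebergArray

variable {ι : ℕ → Type*} [∀ n, Fintype (ι n)] {ξ : ∀ n, ι n → Ω → ℝ} {v : ℝ}

lemma tendsto_charFun_one (hξ : IsLindebergArray ξ Q v) :
    Tendsto (fun n ↦ charFun (Q.map fun ω ↦ ∑ i, ξ n i ω) 1) atTop
      (𝓝 (Real.exp (-(v / 2)) : ℝ)) := by
  have hgauss : Tendsto (fun n ↦ ((Real.exp (-((∑ i, ∫ ω, ξ n i ω ^ 2 ∂Q) / 2)) : ℝ) : ℂ)) atTop
      (𝓝 (Real.exp (-(v / 2)) : ℝ)) :=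
    ((Complex.continuous_ofReal.comp Real.continuous_exp).tendsto _).comp
      (hξ.tendsto_sum_integral_sq.div_const 2).neg
  suffices hdiff : Tendsto (fun n ↦ charFun (Q.map fun ω ↦ ∑ i, ξ n i ω) 1 -
      (Real.exp (-((∑ i, ∫ ω, ξ n i ω ^ 2 ∂Q) / 2)) : ℝ)) atTop (𝓝 0) by
    simpa only [sub_add_cancel, zero_add] using hdiff.add hgauss
  rw [Metric.tendsto_nhds]
  intro δ hδ
  obtain ⟨ε, ⟨hε0, hε1⟩, hεδ⟩ : ∃ ε ∈ Ioc (0 : ℝ) 1, (2 * ε + 0) * v + 4 * 0 < δ := by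
    have hcont : Tendsto (fun ε : ℝ ↦ (2 * ε + 0) * v + 4 * 0) (𝓝[>] 0) (𝓝 0) :=
      Tendsto.mono_left (Continuous.tendsto' (by fun_prop) _ _ (by simp)) nhdsWithin_le_nhds
    exact (Eventually.and (Ioc_mem_nhdsGT one_pos) (hcont.eventually_lt_const hδ)).exists
  have hlim := (((hξ.tendsto_sum_tailMoment ε hε0).const_add (2 * ε)).mul
    hξ.tendsto_sum_integral_sq).add ((hξ.tendsto_sum_tailMoment ε hε0).const_mul 4)
  filter_upwards [hξ.memLp, hξ.integral_eq_zero, hlim.eventually_lt_const hεδ]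
    with n hmemLp hmean hlt
  rw [dist_zero_right]
  exact (norm_charFun_map_sum_one_sub_exp_le (hξ.measurable n) (hξ.iIndepFun n) hmemLp hmean
    hε0.le hε1).trans_lt hlt

theorem tendsto_charFun (hξ : IsLindebergArray ξ Q v) (u : ℝ) :
    Tendsto (fun n ↦ charFun (Q.map fun ω ↦ ∑ i, ξ n i ω) u) atTop
      (𝓝 (Real.exp (-(v * u ^ 2 / 2)) : ℝ)) := by
  have hscaled : IsLindebergArray (fun n i ω ↦ u * ξ n i ω) Q (u ^ 2 * v) :=
    hξ.const_mul (C := |u|) (fun _ _ ↦ le_rfl)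
      (by simpa only [← Finset.mul_sum] using hξ.tendsto_sum_integral_sq.const_mul (u ^ 2))
  have hchar : ∀ n, charFun (Q.map fun ω ↦ ∑ i, u * ξ n i ω) 1 =
      charFun (Q.map fun ω ↦ ∑ i, ξ n i ω) u := fun n ↦ by
    have hmeas : Measurable fun ω ↦ ∑ i, ξ n i ω :=
      Finset.measurable_sum _ fun i _ ↦ hξ.measurable n i
    simp only [← Finset.mul_sum]
    rw [← mul_one u, ← charFun_map_mul, mul_one, Measure.map_map (by fun_prop) hmeas]
    rfl
  simpa only [hchar, mul_comm v] using hscaled.tendsto_charFun_one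

end IsLindebergArray

end LindebergCentralLimitTheorem

section Ottaviani

variable {Ω : Type*} {m : MeasurableSpace Ω} {Q : Measure Ω} [IsProbabilityMeasure Q]

lemma measurableSet_disjointed_of_filtration {ℱ : Filtration ℕ m} {B : ℕ → Set Ω}
    (hB : ∀ j, MeasurableSet[ℱ j] (B j)) (j : ℕ) : MeasurableSet[ℱ j] (disjointed B j) := by
  rw [disjointed_apply, Finset.sup_set_eq_biUnion]
  exact (hB j).diff (Finset.measurableSet_biUnion _ fun i hi ↦
    ℱ.mono (Finset.mem_Iio.1 hi).le _ (hB i))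

/-- If `S` first exceeds `2 * ε` at time `j`, the later increment `S n - S j`, which is independent
of the past, stays below `ε` with probability at least `1 / 2` and then `ε ≤ ‖S n‖`. -/
lemma measure_exists_two_mul_lt_norm_le {F : Type*} [NormedAddCommGroup F]
    [MeasurableSpace F] [BorelSpace F] [SecondCountableTopology F] {ℱ : Filtration ℕ m}
    {S : ℕ → Ω → F} (hS : ∀ j, Measurable[ℱ j] (S j)) {n : ℕ}
    (hindep : ∀ j ≤ n, Indep (ℱ j) (MeasurableSpace.comap (S n - S j) inferInstance) Q) {ε : ℝ}
    (hhalf : ∀ j ≤ n, Q {ω | ε ≤ ‖S n ω - S j ω‖} ≤ 1 / 2) :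
    Q {ω | ∃ j ≤ n, 2 * ε < ‖S j ω‖} ≤ 2 * Q {ω | ε ≤ ‖S n ω‖} := by
  let A : ℕ → Set Ω := disjointed fun j ↦ {ω | 2 * ε < ‖S j ω‖}
  let G : ℕ → Set Ω := fun j ↦ {ω | ε ≤ ‖S n ω - S j ω‖}ᶜ
  have hSm : ∀ j, Measurable (S j) := fun j ↦ (hS j).mono (ℱ.le j) le_rfl
  have hA : ∀ j, MeasurableSet[ℱ j] (A j) := measurableSet_disjointed_of_filtration fun i ↦
    measurableSet_lt measurable_const (measurable_norm.comp (hS i))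
  have hcompl : ∀ j, MeasurableSet {ω | ε ≤ ‖S n ω - S j ω‖} := fun j ↦
    measurableSet_le measurable_const ((hSm n).sub (hSm j)).norm
  have hG : ∀ j ≤ n, 1 / 2 ≤ Q (G j) := fun j hj ↦ by
    rw [prob_compl_eq_one_sub (hcompl j)]
    calc (1 / 2 : ℝ≥0∞) = 1 - 1 / 2 := by rw [one_div, ENNReal.one_sub_inv_two]
      _ ≤ _ := tsub_le_tsub_left (hhalf j hj) 1
  have hAG : ∀ j ≤ n, Q (A j) ≤ 2 * Q (A j ∩ G j) := fun j hj ↦ by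
    have hGσ : MeasurableSet[MeasurableSpace.comap (S n - S j) inferInstance] (G j) :=
      ⟨{x | ε ≤ ‖x‖}ᶜ, (measurableSet_le measurable_const measurable_norm).compl, rfl⟩
    rw [(Indep_iff _ _ _).1 (hindep j hj) _ _ (hA j) hGσ, mul_left_comm]
    calc Q (A j) = Q (A j) * (2 * (1 / 2)) := by
          rw [one_div, ENNReal.mul_inv_cancel (by simp) (by simp), mul_one]
      _ ≤ _ := by gcongr; exact hG j hj
  have hdisj : (↑(Finset.range (n + 1)) : Set ℕ).PairwiseDisjoint fun j ↦ A j ∩ G j :=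
    fun i _ j _ hij ↦ ((disjoint_disjointed _) hij).mono inter_subset_left inter_subset_left
  have hlarge : ⋃ j ∈ Finset.range (n + 1), A j ∩ G j ⊆ {ω | ε ≤ ‖S n ω‖} :=
    iUnion₂_subset fun j _ ω ⟨hAω, hGω⟩ ↦ by
      have hj : 2 * ε < ‖S j ω‖ := disjointed_subset _ j hAω
      have hnj : ‖S n ω - S j ω‖ < ε := not_le.1 hGω
      have htri := norm_sub_norm_le (S j ω) (S n ω)
      rw [norm_sub_rev] at htri
      exact (by linarith : ε ≤ ‖S n ω‖)
  have hcover : {ω | ∃ j ≤ n, 2 * ε < ‖S j ω‖} = ⋃ j ∈ Finset.range (n + 1), A j := by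
    rw [biUnion_range_succ_disjointed]
    ext ω
    simp [partialSups_eq_biSup]
  calc _ ≤ ∑ j ∈ Finset.range (n + 1), Q (A j) := hcover ▸ measure_biUnion_finset_le _ _
    _ ≤ ∑ j ∈ Finset.range (n + 1), 2 * Q (A j ∩ G j) :=
        Finset.sum_le_sum fun j hj ↦ hAG j (Finset.mem_range_succ_iff.1 hj)
    _ = 2 * Q (⋃ j ∈ Finset.range (n + 1), A j ∩ G j) := by
        rw [← Finset.mul_sum, measure_biUnion_finset hdisj fun j _ ↦
          ((ℱ.le j) _ (hA j)).inter (hcompl j).compl]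
    _ ≤ _ := by gcongr

end Ottaviani

section CumulativeSums

/-- The sum of the first `j` terms of a finite sequence. -/
def cumSum {M : Type*} [AddCommMonoid M] {k : ℕ} (x : Fin k → M) (j : ℕ) : M :=
  ∑ r ∈ Finset.univ.filter (fun r : Fin k ↦ (r : ℕ) < j), x r

@[simp]
lemma cumSum_zero {M : Type*} [AddCommMonoid M] {k : ℕ} (x : Fin k → M) : cumSum x 0 = 0 := by
  simp [cumSum]

lemma cumSum_sub_cumSum {M : Type*} [AddCommGroup M] {k : ℕ} (x : Fin k → M) {a b : ℕ}
    (hab : a ≤ b) :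
    cumSum x b - cumSum x a =
      ∑ r ∈ Finset.univ.filter (fun r : Fin k ↦ a ≤ (r : ℕ) ∧ (r : ℕ) < b), x r := by
  rw [cumSum, cumSum, sub_eq_iff_eq_add, ← Finset.sum_union]
  · refine Finset.sum_congr ?_ fun _ _ ↦ rfl
    ext r
    simp only [Finset.mem_filter_univ, Finset.mem_union]
    omega
  · exact Finset.disjoint_filter.2 fun r _ h ↦ by omega

lemma card_filter_le_val_lt {k a b : ℕ} (hb : b ≤ k) :
    (Finset.univ.filter fun r : Fin k ↦ a ≤ (r : ℕ) ∧ (r : ℕ) < b).card = b - a := by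
  rw [← Nat.card_Ico, ← Finset.card_map Fin.valEmbedding]
  congr 1
  ext x
  simp only [Finset.mem_map, Finset.mem_filter_univ, Fin.valEmbedding_apply, Finset.mem_Ico]
  exact ⟨fun ⟨_, hr, hrx⟩ ↦ hrx ▸ hr, fun hx ↦ ⟨⟨x, hx.2.trans_le hb⟩, hx, rfl⟩⟩

variable {Ω : Type*} {m : MeasurableSpace Ω} {k : ℕ}

/-- The filtration generated by a finite sequence of random variables; at time `j` the variables
with index less than `j` are known. -/
def rowFiltration {ξ : Fin k → Ω → ℝ} (hξ : ∀ r, Measurable (ξ r)) : Filtration ℕ m where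
  seq j := ⨆ r ∈ {r : Fin k | (r : ℕ) < j}, MeasurableSpace.comap (ξ r) inferInstance
  mono' _ _ hij := biSup_mono fun _ hr ↦ lt_of_lt_of_le hr hij
  le' _ := iSup₂_le fun r _ ↦ (hξ r).comap_le

lemma measurable_cumSum {ξ : Fin k → Ω → ℝ} (hξ : ∀ r, Measurable (ξ r)) (j : ℕ) :
    Measurable fun ω ↦ cumSum (ξ · ω) j :=
  Finset.measurable_sum _ fun r _ ↦ hξ r

lemma measurable_rowFiltration_cumSum {ξ : Fin k → Ω → ℝ} (hξ : ∀ r, Measurable (ξ r)) {i j : ℕ}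
    (hij : i ≤ j) : Measurable[rowFiltration hξ j] fun ω ↦ cumSum (ξ · ω) i :=
  Finset.measurable_sum _ fun r hr ↦ (comap_measurable (ξ r)).mono
    (le_iSup₂_of_le r ((Finset.mem_filter_univ r).1 hr |>.trans_le hij) le_rfl) le_rfl

variable {Q : Measure Ω}

lemma indep_rowFiltration_cumSum_sub {ξ : Fin k → Ω → ℝ} (hξ : ∀ r, Measurable (ξ r))
    (hindep : iIndepFun ξ Q) {j b : ℕ} (hjb : j ≤ b) :
    Indep (rowFiltration hξ j) (MeasurableSpace.comap
      (fun ω ↦ cumSum (ξ · ω) b - cumSum (ξ · ω) j) inferInstance) Q := by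
  have hsplit := indep_iSup_of_disjoint (fun r ↦ (hξ r).comap_le) hindep.iIndep
    (S := {r : Fin k | (r : ℕ) < j}) (T := {r : Fin k | j ≤ (r : ℕ)})
    (Set.disjoint_left.2 fun r hlt hle ↦ absurd (show (r : ℕ) < j from hlt) (not_lt.2 hle))
  refine indep_of_indep_of_le_right hsplit (Measurable.comap_le ?_)
  simp_rw [cumSum_sub_cumSum _ hjb]
  exact Finset.measurable_sum _ fun r hr ↦ (comap_measurable (ξ r)).mono
    (le_iSup₂_of_le r ((Finset.mem_filter_univ r).1 hr).1 le_rfl) le_rfl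

variable [IsProbabilityMeasure Q]

lemma measure_exists_two_mul_lt_abs_cumSum_sub_le {ξ : Fin k → Ω → ℝ}
    (hξ : ∀ r, Measurable (ξ r)) (hindep : iIndepFun ξ Q) {a b : ℕ} (hab : a ≤ b) {ε : ℝ}
    (hhalf : ∀ j, a ≤ j → j ≤ b →
      Q {ω | ε ≤ |cumSum (ξ · ω) b - cumSum (ξ · ω) j|} ≤ 1 / 2) :
    Q {ω | ∃ j, a ≤ j ∧ j ≤ b ∧ 2 * ε < |cumSum (ξ · ω) j - cumSum (ξ · ω) a|} ≤
      2 * Q {ω | ε ≤ |cumSum (ξ · ω) b - cumSum (ξ · ω) a|} := by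
  obtain ⟨n, rfl⟩ := Nat.exists_eq_add_of_le hab
  let ℱ : Filtration ℕ m :=
    { seq j := rowFiltration hξ (a + j)
      mono' _ _ hij := (rowFiltration hξ).mono (Nat.add_le_add_left hij a)
      le' j := (rowFiltration hξ).le (a + j) }
  have hottaviani := measure_exists_two_mul_lt_norm_le (Q := Q) (ℱ := ℱ) (n := n) (ε := ε)
    (S := fun j ω ↦ cumSum (ξ · ω) (a + j) - cumSum (ξ · ω) a)
    (fun j ↦ (measurable_rowFiltration_cumSum hξ le_rfl).sub
      (measurable_rowFiltration_cumSum hξ (Nat.le_add_right a j)))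
    (fun j hj ↦ by
      have h := indep_rowFiltration_cumSum_sub hξ hindep (Nat.add_le_add_left hj a)
      convert h using 2
      ext ω
      simp)
    (fun j hj ↦ by
      simpa using hhalf (a + j) (Nat.le_add_right a j) (Nat.add_le_add_left hj a))
  refine (measure_mono ?_).trans hottaviani
  rintro ω ⟨j, haj, hjb, hlt⟩
  exact ⟨j - a, by omega, by simpa [Nat.add_sub_cancel' haj] using hlt⟩

lemma measure_le_abs_cumSum_sub_le {ξ : Fin k → Ω → ℝ} (hindep : iIndepFun ξ Q)
    (hξ2 : ∀ r, MemLp (ξ r) 2 Q) (hmean : ∀ r, ∫ ω, ξ r ω ∂Q = 0) {v : ℝ}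
    (hsq : ∀ r, ∫ ω, ξ r ω ^ 2 ∂Q = v) {a b : ℕ} (hab : a ≤ b) (hb : b ≤ k) {ε : ℝ}
    (hε : 0 < ε) :
    Q {ω | ε ≤ |cumSum (ξ · ω) b - cumSum (ξ · ω) a|} ≤
      ENNReal.ofReal ((b - a : ℕ) * v / ε ^ 2) := by
  set s := Finset.univ.filter fun r : Fin k ↦ a ≤ (r : ℕ) ∧ (r : ℕ) < b
  have hsum : ∀ ω, cumSum (ξ · ω) b - cumSum (ξ · ω) a = (∑ r ∈ s, ξ r) ω := fun ω ↦ by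
    rw [cumSum_sub_cumSum _ hab, Finset.sum_apply]
  have hmean_sum : ∫ ω, (∑ r ∈ s, ξ r) ω ∂Q = 0 := by
    simp_rw [Finset.sum_apply]
    rw [integral_finsetSum _ fun r _ ↦ (hξ2 r).integrable one_le_two]
    exact Finset.sum_eq_zero fun r _ ↦ hmean r
  have hvar : Var[∑ r ∈ s, ξ r; Q] = (b - a : ℕ) * v := by
    rw [IndepFun.variance_sum (fun r _ ↦ hξ2 r) fun i _ j _ hij ↦ hindep.indepFun hij,
      Finset.sum_congr rfl fun r _ ↦
        (variance_of_integral_eq_zero (hξ2 r).aemeasurable (hmean r)).trans (hsq r),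
      Finset.sum_const, card_filter_le_val_lt hb, nsmul_eq_mul]
  simpa only [hmean_sum, hvar, sub_zero, hsum] using
    meas_ge_le_variance_div_sq (memLp_finsetSum' s fun r _ ↦ hξ2 r) hε

end CumulativeSums

section Polygon

/-- The ramp that climbs from `0` to `1` on `[j / k, (j + 1) / k]`: the coefficient of the `j`-th
increment in `polygon k`. -/
noncomputable def ramp (k j : ℕ) (t : ℝ) : ℝ :=
  max 0 (min 1 (k * t - j))

lemma ramp_nonneg (k j : ℕ) (t : ℝ) : 0 ≤ ramp k j t :=
  le_max_left _ _

lemma ramp_le_one (k j : ℕ) (t : ℝ) : ramp k j t ≤ 1 :=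
  max_le zero_le_one (min_le_left _ _)

lemma monotone_ramp (k j : ℕ) : Monotone (ramp k j) := fun s t hst ↦ by
  unfold ramp
  gcongr

lemma polygon_eq_sum_ramp (k : ℕ) (s : ℕ → ℝ) (t : I) :
    polygon k s t = s 0 + ∑ j ∈ Finset.range k, (s (j + 1) - s j) * ramp k j t :=
  rfl

lemma continuous_polygon (k : ℕ) : Continuous fun s : ℕ → ℝ ↦ polygon k s := by
  let rampMap : ℕ → C(I, ℝ) := fun j ↦ ⟨fun t ↦ ramp k j t, by unfold ramp; fun_prop⟩
  have hlinear : (fun s : ℕ → ℝ ↦ polygon k s) = fun s ↦ s 0 • (1 : C(I, ℝ)) +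
      ∑ j ∈ Finset.range k, (s (j + 1) - s j) • rampMap j := by
    funext s
    ext t
    simp [polygon_eq_sum_ramp, rampMap]
  rw [hlinear]
  fun_prop

lemma polygon_congr {k : ℕ} {s s' : ℕ → ℝ} (h : ∀ i ≤ k, s i = s' i) :
    polygon k s = polygon k s' := by
  ext t
  rw [polygon_eq_sum_ramp, polygon_eq_sum_ramp, h 0 k.zero_le]
  refine congrArg _ (Finset.sum_congr rfl fun j hj ↦ ?_)
  rw [h j (Finset.mem_range.1 hj).le, h (j + 1) (Finset.mem_range.1 hj)]

lemma isCompact_image_polygon (k : ℕ) (R : ℝ) :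
    IsCompact (polygon k '' {s | ∀ i ≤ k, |s i| ≤ R}) := by
  have heq : polygon k '' {s | ∀ i ≤ k, |s i| ≤ R} =
      polygon k '' (univ.pi fun _ ↦ Icc (-R) R) := by
    refine Subset.antisymm ?_ (image_mono fun s hs i _ ↦ abs_le.2 (hs i (mem_univ i)))
    rintro _ ⟨s, hs, rfl⟩
    exact ⟨fun i ↦ s (min i k), fun i _ ↦ abs_le.1 (hs _ (min_le_right i k)),
      polygon_congr fun i hi ↦ by rw [min_eq_left hi]⟩
  rw [heq]
  exact (isCompact_univ_pi fun _ ↦ isCompact_Icc).image (continuous_polygon k)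

/-- The index `j < k` of a grid interval `[j / k, (j + 1) / k]` containing `t`; the right end point
of `[0, 1]` belongs to the last interval. -/
noncomputable def gridIndex (k : ℕ) (t : I) : ℕ :=
  min ⌊k * (t : ℝ)⌋₊ (k - 1)

lemma gridIndex_lt {k : ℕ} (hk : 0 < k) (t : I) : gridIndex k t < k := by
  unfold gridIndex
  omega

lemma gridIndex_le_mul (k : ℕ) (t : I) : (gridIndex k t : ℝ) ≤ k * t :=
  (Nat.cast_le.2 (min_le_left _ _)).trans (Nat.floor_le (mul_nonneg (Nat.cast_nonneg k) t.2.1))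

lemma mul_le_gridIndex_add_one {k : ℕ} (hk : 0 < k) (t : I) :
    k * (t : ℝ) ≤ gridIndex k t + 1 := by
  rcases le_total ⌊k * (t : ℝ)⌋₊ (k - 1) with hfloor | hfloor
  · rw [gridIndex, min_eq_left hfloor]
    exact (Nat.lt_floor_add_one _).le
  · rw [gridIndex, min_eq_right hfloor, Nat.cast_pred hk, sub_add_cancel]
    exact mul_le_of_le_one_right (Nat.cast_nonneg k) t.2.2

lemma le_gridIndex {k i : ℕ} {t : I} (hi : i < k) (hit : (i : ℝ) ≤ k * t) : i ≤ gridIndex k t :=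
  le_min (Nat.le_floor hit) (Nat.le_pred_of_lt hi)

lemma polygon_apply_gridIndex {k : ℕ} (hk : 0 < k) (s : ℕ → ℝ) (t : I) :
    polygon k s t = s (gridIndex k t) +
      (k * t - gridIndex k t) * (s (gridIndex k t + 1) - s (gridIndex k t)) :=
  polygon_apply s (gridIndex_lt hk t) t (gridIndex_le_mul k t) (mul_le_gridIndex_add_one hk t)

lemma sum_ramp (k : ℕ) (t : I) : ∑ j ∈ Finset.range k, ramp k j t = k * t := by
  rcases k.eq_zero_or_pos with rfl | hk
  · simp
  simpa [polygon_eq_sum_ramp] using polygon_apply_gridIndex hk (fun j ↦ (j : ℝ)) t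

lemma ramp_sq_eq_ramp {k j : ℕ} {t : ℝ} (hj : ⌊k * t⌋₊ ≠ j) : ramp k j t ^ 2 = ramp k j t := by
  unfold ramp
  rcases le_or_gt (k * t - j) 0 with hle | hgt
  · simp [max_eq_left ((min_le_right _ _).trans hle)]
  · have hge : 1 ≤ k * t - j := by
      by_contra! hlt
      exact hj <| (Nat.floor_eq_iff (by linarith [Nat.cast_nonneg (α := ℝ) j])).2
        ⟨by linarith, by linarith⟩
    simp [min_eq_left hge]

lemma sum_ramp_sub_sq_le_one (k : ℕ) (t : ℝ) :
    ∑ j ∈ Finset.range k, (ramp k j t - ramp k j t ^ 2) ≤ 1 :=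
  calc _ ≤ ∑ j ∈ Finset.range k, if ⌊k * t⌋₊ = j then (1 : ℝ) else 0 := by
        refine Finset.sum_le_sum fun j _ ↦ ?_
        split_ifs with hj
        · linarith [ramp_le_one k j t, sq_nonneg (ramp k j t)]
        · rw [ramp_sq_eq_ramp hj, sub_self]
    _ ≤ 1 := by
        rw [Finset.sum_ite_eq]
        split_ifs <;> norm_num

lemma abs_sum_ramp_mul_ramp_sub_le_one (k : ℕ) (s t : I) :
    |∑ j ∈ Finset.range k, ramp k j s * ramp k j t - k * min (s : ℝ) t| ≤ 1 := by
  wlog hst : (s : ℝ) ≤ t generalizing s t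
  · simpa only [min_comm, mul_comm] using this t s (le_of_not_ge hst)
  have hupper : ∑ j ∈ Finset.range k, ramp k j s * ramp k j t ≤ k * s :=
    (Finset.sum_le_sum fun j _ ↦
      mul_le_of_le_one_right (ramp_nonneg k j s) (ramp_le_one k j t)).trans_eq (sum_ramp k s)
  have hlower : ∑ j ∈ Finset.range k, ramp k j s ^ 2 ≤
      ∑ j ∈ Finset.range k, ramp k j s * ramp k j t :=
    Finset.sum_le_sum fun j _ ↦ (sq (ramp k j s)).trans_le <|
      mul_le_mul_of_nonneg_left (monotone_ramp k j hst) (ramp_nonneg k j s)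
  have hsq := sum_ramp_sub_sq_le_one k s
  rw [Finset.sum_sub_distrib, sum_ramp] at hsq
  rw [min_eq_left hst, abs_le]
  constructor <;> linarith

lemma tendsto_sum_sq_sum_mul_ramp_div {ι : Type*} [Fintype ι] (t : ι → I) (θ : ι → ℝ) :
    Tendsto (fun k : ℕ ↦ (∑ r : Fin k, (∑ i, θ i * ramp k r (t i)) ^ 2) / k) atTop
      (𝓝 (∑ i, ∑ j, θ i * θ j * min (t i : ℝ) (t j))) := by
  have hpair : ∀ s t : I, Tendsto
      (fun k : ℕ ↦ (∑ r ∈ Finset.range k, ramp k r s * ramp k r t) / k) atTop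
      (𝓝 (min (s : ℝ) t)) := fun s t ↦ by
    refine tendsto_iff_dist_tendsto_zero.2 (squeeze_zero' (Eventually.of_forall fun _ ↦
      dist_nonneg) ?_ tendsto_one_div_atTop_nhds_zero_nat)
    filter_upwards [eventually_gt_atTop 0] with k hk
    have hk' : (0 : ℝ) < k := Nat.cast_pos.2 hk
    rw [Real.dist_eq, div_sub' hk'.ne', abs_div, abs_of_pos hk']
    gcongr
    exact abs_sum_ramp_mul_ramp_sub_le_one k s t
  have hexpand : ∀ k : ℕ, (∑ r : Fin k, (∑ i, θ i * ramp k r (t i)) ^ 2) / k = ∑ i, ∑ j,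
      θ i * θ j * ((∑ r ∈ Finset.range k, ramp k r (t i) * ramp k r (t j)) / k) := fun k ↦ by
    simp_rw [Finset.sum_range, ← mul_div_assoc, ← Finset.sum_div, sq, Finset.sum_mul_sum,
      mul_mul_mul_comm (θ _), Finset.mul_sum]
    rw [Finset.sum_comm]
    congr 1
    exact Finset.sum_congr rfl fun i _ ↦ Finset.sum_comm
  simp_rw [hexpand]
  exact tendsto_finsetSum _ fun i _ ↦ tendsto_finsetSum _ fun j _ ↦
    (hpair (t i) (t j)).const_mul _

end Polygon

section CoarsePolygon

variable {k q : ℕ}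

lemma mul_gridIndex_div_le_gridIndex (hk : 0 < k) (hq : 0 < q) (t : I) :
    k * gridIndex q t / q ≤ gridIndex k t := by
  have hq' : (0 : ℝ) < q := Nat.cast_pos.2 hq
  refine le_gridIndex (Nat.div_lt_of_lt_mul ?_) (Nat.cast_div_le.trans ?_)
  · rw [mul_comm q]
    exact Nat.mul_lt_mul_of_pos_left (gridIndex_lt hq t) hk
  · rw [div_le_iff₀ hq']
    push_cast
    nlinarith [mul_le_mul_of_nonneg_left (gridIndex_le_mul q t) (Nat.cast_nonneg (α := ℝ) k)]

lemma gridIndex_le_mul_gridIndex_add_one_div (hq : 0 < q) (t : I) :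
    gridIndex k t ≤ k * (gridIndex q t + 1) / q := by
  rw [Nat.le_div_iff_mul_le hq]
  have hcast : (gridIndex k t * q : ℝ) ≤ k * (gridIndex q t + 1) :=
    calc (gridIndex k t * q : ℝ) ≤ k * t * q := by gcongr; exact gridIndex_le_mul k t
      _ = k * (q * t) := by ring
      _ ≤ _ := by gcongr; exact mul_le_gridIndex_add_one hq t
  exact_mod_cast hcast

variable {s : ℕ → ℝ} {δ : ℝ}

/-- If `j` is the last index of a block, then `j + 1` lies in the next one: hence `2 * δ`. -/
lemma abs_succ_sub_le_two_mul_of_block (hqk : q ≤ k) {i j : ℕ} (hi : i < q)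
    (h : ∀ i < q, ∀ j, k * i / q ≤ j → j ≤ k * (i + 1) / q → |s j - s (k * i / q)| ≤ δ)
    (hij : k * i / q ≤ j) (hji : j ≤ k * (i + 1) / q) (hjk : j < k) :
    |s (j + 1) - s (k * i / q)| ≤ 2 * δ := by
  have hδ : 0 ≤ δ := (abs_nonneg _).trans (h i hi j hij hji)
  have hq : 0 < q := i.zero_le.trans_lt hi
  rcases hji.lt_or_eq with hlt | rfl
  · exact (h i hi (j + 1) (hij.trans j.le_succ) hlt).trans (by linarith)
  have hi' : i + 1 < q := by
    refine lt_of_le_of_ne hi fun heq ↦ ?_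
    rw [heq, Nat.mul_div_cancel _ hq] at hjk
    exact hjk.false
  have hnext : k * (i + 1) / q + 1 ≤ k * (i + 1 + 1) / q := by
    rw [Nat.le_div_iff_mul_le hq, add_one_mul, mul_add_one k (i + 1)]
    exact add_le_add (Nat.div_mul_le_self _ _) hqk
  linarith [abs_sub_le (s (k * (i + 1) / q + 1)) (s (k * (i + 1) / q)) (s (k * i / q)),
    h (i + 1) hi' _ (Nat.le_succ _) hnext, h i hi _ hij le_rfl]

lemma dist_polygon_coarse_le (hq : 0 < q) (hqk : q ≤ k)
    (h : ∀ i < q, ∀ j, k * i / q ≤ j → j ≤ k * (i + 1) / q → |s j - s (k * i / q)| ≤ δ) :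
    dist (polygon k s) (polygon q fun i ↦ s (k * i / q)) ≤ 3 * δ := by
  have hk : 0 < k := hq.trans_le hqk
  have hδ : 0 ≤ δ := (abs_nonneg _).trans
    (h 0 hq (k * 0 / q) le_rfl (Nat.div_le_div_right (by simp)))
  refine (ContinuousMap.dist_le (by positivity)).2 fun t ↦ ?_
  rw [polygon_apply_gridIndex hk, polygon_apply_gridIndex hq, Real.dist_eq]
  set j := gridIndex k t
  set i := gridIndex q t
  have hi_lt : i < q := gridIndex_lt hq t
  have hij : k * i / q ≤ j := mul_gridIndex_div_le_gridIndex hk hq t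
  have hji : j ≤ k * (i + 1) / q := gridIndex_le_mul_gridIndex_add_one_div hq t
  have hleft := h i hi_lt j hij hji
  have hright := abs_succ_sub_le_two_mul_of_block hqk hi_lt h hij hji (gridIndex_lt hk t)
  have hcoarse := h i hi_lt _ (hij.trans hji) le_rfl
  have hx₀ : 0 ≤ k * (t : ℝ) - j := sub_nonneg.2 (gridIndex_le_mul k t)
  have hx₁ : k * (t : ℝ) - j ≤ 1 := by linarith [mul_le_gridIndex_add_one hk t]
  have hy₀ : 0 ≤ q * (t : ℝ) - i := sub_nonneg.2 (gridIndex_le_mul q t)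
  have hy₁ : q * (t : ℝ) - i ≤ 1 := by linarith [mul_le_gridIndex_add_one hq t]
  rw [abs_le] at hleft hright hcoarse ⊢
  constructor <;> nlinarith

end CoarsePolygon

section PolygonCumSum

lemma polygon_cumSum_apply {k : ℕ} (x : Fin k → ℝ) (t : I) :
    polygon k (cumSum x) t = ∑ r : Fin k, ramp k r t * x r := by
  rw [polygon_eq_sum_ramp, cumSum_zero, zero_add, Finset.sum_range]
  refine Finset.sum_congr rfl fun r _ ↦ ?_
  have hsingle : Finset.univ.filter (fun i : Fin k ↦ (r : ℕ) ≤ i ∧ (i : ℕ) < r + 1) = {r} := by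
    ext i
    simp only [Finset.mem_filter_univ, Finset.mem_singleton, Fin.ext_iff]
    omega
  rw [cumSum_sub_cumSum x (Nat.le_succ _), hsingle, Finset.sum_singleton, mul_comm]

lemma measurable_polygon_cumSum {Ω : Type*} [MeasurableSpace Ω] {k : ℕ} {ξ : Fin k → Ω → ℝ}
    (hξ : ∀ r, Measurable (ξ r)) : Measurable fun ω ↦ polygon k (cumSum (ξ · ω)) :=
  (continuous_polygon k).measurable.comp (measurable_pi_lambda _ fun j ↦ measurable_cumSum hξ j)

end PolygonCumSum

section DonskerArray

lemma eventually_measure_preimage_lt_of_tendstoInDistribution {S Ω Ω' ι : Type*}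
    [TopologicalSpace S] [HasOuterApproxClosed S] [MeasurableSpace S] [OpensMeasurableSpace S]
    [MeasurableSpace Ω] [MeasurableSpace Ω'] {μ : ι → Measure Ω} [∀ i, IsProbabilityMeasure (μ i)]
    {μ' : Measure Ω'} [IsProbabilityMeasure μ'] {l : Filter ι} {Y : ι → Ω → S} {Z : Ω' → S}
    (h : TendstoInDistribution Y l Z μ μ') {F : Set S} (hF : IsClosed F) {c : ℝ≥0∞}
    (hc : μ' (Z ⁻¹' F) < c) : ∀ᶠ i in l, μ i (Y i ⁻¹' F) < c := by
  have hlimsup := ProbabilityMeasure.limsup_measure_closed_le_of_tendsto h.tendsto hF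
  simp only [ProbabilityMeasure.coe_mk,
    Measure.map_apply_of_aemeasurable h.aemeasurable_limit hF.measurableSet,
    Measure.map_apply_of_aemeasurable (h.forall_aemeasurable _) hF.measurableSet] at hlimsup
  exact eventually_lt_of_limsup_lt (hlimsup.trans_lt hc)

variable {Ω : Type*} [MeasurableSpace Ω] {Q : Measure Ω}

/-- Lindeberg arrays whose `n`-th row consists of `k n` variables of variance `1 / k n`, with
`k n → ∞`: those for which the polygons through the partial sums, taken at equidistant times,
converge to Brownian motion. -/
structure IsDonskerArray {k : ℕ → ℕ} (ξ : ∀ n, Fin (k n) → Ω → ℝ) (Q : Measure Ω) : Prop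
    extends IsLindebergArray ξ Q 1 where
  tendsto_length : Tendsto k atTop atTop
  integral_sq : ∀ᶠ n in atTop, ∀ r, ∫ ω, ξ n r ω ^ 2 ∂Q = 1 / k n

variable {k : ℕ → ℕ} {ξ : ∀ n, Fin (k n) → Ω → ℝ}

lemma IsDonskerArray.isLindebergArray_mul (hξ : IsDonskerArray ξ Q) {w : ∀ n, Fin (k n) → ℝ}
    {C : ℝ} (hw : ∀ n r, |w n r| ≤ C) {v : ℝ}
    (hv : Tendsto (fun n ↦ (∑ r, w n r ^ 2) / k n) atTop (𝓝 v)) :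
    IsLindebergArray (fun n r ω ↦ w n r * ξ n r ω) Q v := by
  refine hξ.toIsLindebergArray.const_mul hw (hv.congr' ?_)
  filter_upwards [hξ.integral_sq] with n hsq
  simp only [hsq, mul_one_div, Finset.sum_div]

variable [IsProbabilityMeasure Q]

theorem IsLindebergArray.tendstoInDistribution_sum {ι : ℕ → Type*} [∀ n, Fintype (ι n)]
    {ξ : ∀ n, ι n → Ω → ℝ} {v : ℝ≥0} (hξ : IsLindebergArray ξ Q v) :
    TendstoInDistribution (fun n ω ↦ ∑ i, ξ n i ω) atTop id (fun _ ↦ Q) (gaussianReal 0 v) where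
  forall_aemeasurable n := (Finset.measurable_sum _ fun i _ ↦ hξ.measurable n i).aemeasurable
  tendsto := by
    refine ProbabilityMeasure.tendsto_of_tendsto_charFun fun u ↦ ?_
    have hgauss : charFun ((gaussianReal 0 v).map id) u = (Real.exp (-(v * u ^ 2 / 2)) : ℝ) := by
      rw [Measure.map_id, charFun_gaussianReal, Complex.ofReal_exp]
      congr 1
      push_cast
      ring
    exact hgauss ▸ hξ.tendsto_charFun u

namespace IsDonskerArray

theorem tendsto_charFun_sum_polygon (hξ : IsDonskerArray ξ Q) {ι : Type*} [Fintype ι] (t : ι → I)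
    (θ : ι → ℝ) (u : ℝ) :
    Tendsto (fun n ↦ charFun
        (Q.map fun ω ↦ ∑ i, θ i * polygon (k n) (cumSum (ξ n · ω)) (t i)) u) atTop
      (𝓝 (Real.exp (-((∑ i, ∑ j, θ i * θ j * min (t i : ℝ) (t j)) * u ^ 2 / 2)) : ℝ)) := by
  have hweights : ∀ n (r : Fin (k n)), |∑ i, θ i * ramp (k n) r (t i)| ≤ ∑ i, |θ i| := fun n r ↦
    (Finset.abs_sum_le_sum_abs _ _).trans <| Finset.sum_le_sum fun i _ ↦ by
      rw [abs_mul, abs_of_nonneg (ramp_nonneg _ _ _)]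
      exact mul_le_of_le_one_right (abs_nonneg _) (ramp_le_one _ _ _)
  have hpolygon : ∀ n ω, ∑ i, θ i * polygon (k n) (cumSum (ξ n · ω)) (t i) =
      ∑ r : Fin (k n), (∑ i, θ i * ramp (k n) r (t i)) * ξ n r ω := fun n ω ↦ by
    simp_rw [polygon_cumSum_apply, Finset.mul_sum, Finset.sum_mul]
    rw [Finset.sum_comm]
    simp only [mul_assoc]
  simp_rw [hpolygon]
  exact (hξ.isLindebergArray_mul hweights
    ((tendsto_sum_sq_sum_mul_ramp_div t θ).comp hξ.tendsto_length)).tendsto_charFun u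

theorem tendstoInDistribution_cumSum_sub_cumSum (hξ : IsDonskerArray ξ Q) {a b : ℕ → ℕ}
    (hab : ∀ n, a n ≤ b n) (hb : ∀ n, b n ≤ k n) {v : ℝ≥0}
    (hv : Tendsto (fun n ↦ (b n / k n - a n / k n : ℝ)) atTop (𝓝 v)) :
    TendstoInDistribution (fun n ω ↦ cumSum (ξ n · ω) (b n) - cumSum (ξ n · ω) (a n)) atTop id
      (fun _ ↦ Q) (gaussianReal 0 v) := by
  let w : ∀ n, Fin (k n) → ℝ := fun n r ↦ if a n ≤ (r : ℕ) ∧ (r : ℕ) < b n then 1 else 0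
  have hsum : ∀ n ω, cumSum (ξ n · ω) (b n) - cumSum (ξ n · ω) (a n) = ∑ r, w n r * ξ n r ω :=
    fun n ω ↦ by
      simp only [w, cumSum_sub_cumSum _ (hab n), Finset.sum_filter, ite_mul, one_mul, zero_mul]
  have hw : ∀ n r, |w n r| ≤ 1 := fun n r ↦ by
    simp only [w]
    split_ifs <;> norm_num
  have hwsq : ∀ n, (∑ r, w n r ^ 2) / k n = (b n / k n - a n / k n : ℝ) := fun n ↦ by
    simp only [w, ite_pow, one_pow, ne_eq, OfNat.ofNat_ne_zero, not_false_eq_true, zero_pow]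
    rw [Finset.sum_boole, card_filter_le_val_lt (hb n), Nat.cast_sub (hab n), sub_div]
  simp_rw [hsum]
  exact (hξ.isLindebergArray_mul hw (by simpa only [hwsq] using hv)).tendstoInDistribution_sum

end IsDonskerArray

lemma tendsto_natCast_mul_div_div {k : ℕ → ℕ} (hk : Tendsto k atTop atTop) (i q : ℕ) :
    Tendsto (fun n ↦ ((k n * i / q : ℕ) : ℝ) / k n) atTop (𝓝 ((i : ℝ) / q)) := by
  rcases q.eq_zero_or_pos with rfl | hq
  · simp
  have hlim : Tendsto (fun x : ℝ ↦ (⌊i / q * x⌋₊ : ℝ) / x) atTop (𝓝 (i / q)) :=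
    tendsto_nat_floor_mul_div_atTop (by positivity)
  refine (hlim.comp (tendsto_natCast_atTop_atTop.comp hk)).congr fun n ↦ ?_
  simp only [Function.comp_apply]
  rw [← Nat.floor_div_eq_div (K := ℝ)]
  push_cast
  congr 3
  ring

end DonskerArray

section Tightness

section MetricSpace

variable {S : Type*} [MetricSpace S] [CompleteSpace S]

lemma isCompact_iInter_cthickening {K : ℕ → Set S} (hK : ∀ j, IsCompact (K j)) {δ : ℕ → ℝ}
    (hδ0 : ∀ j, 0 ≤ δ j) (hδ : Tendsto δ atTop (𝓝 0)) :
    IsCompact (⋂ j, Metric.cthickening (δ j) (K j)) := by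
  refine TotallyBounded.isCompact_of_isClosed (Metric.totallyBounded_iff.2 fun ε hε ↦ ?_)
    (isClosed_iInter fun j ↦ Metric.isClosed_cthickening)
  obtain ⟨j, hj⟩ := (hδ.eventually_lt_const (half_pos hε)).exists
  obtain ⟨t, ht, hcover⟩ := Metric.totallyBounded_iff.1 (hK j).totallyBounded (ε / 2) (half_pos hε)
  refine ⟨t, ht, fun x hx ↦ ?_⟩
  have hxj := mem_iInter.1 hx j
  rw [(hK j).cthickening_eq_biUnion_closedBall (hδ0 j)] at hxj
  obtain ⟨y, hy, hxy⟩ := mem_iUnion₂.1 hxj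
  obtain ⟨z, hz, hyz⟩ := mem_iUnion₂.1 (hcover hy)
  refine mem_iUnion₂.2 ⟨z, hz, ?_⟩
  rw [Metric.mem_ball] at hyz ⊢
  rw [Metric.mem_closedBall] at hxy
  linarith [dist_triangle x y z]

variable [SecondCountableTopology S] [MeasurableSpace S] [BorelSpace S] {μ : ℕ → Measure S}
  [∀ n, IsFiniteMeasure (μ n)]

lemma exists_isCompact_forall_measure_compl_cthickening_le {ε : ℝ} {η : ℝ≥0∞} (hη : 0 < η)
    {K : Set S} (hK : IsCompact K) (h : ∀ᶠ n in atTop, μ n (Metric.cthickening ε K)ᶜ ≤ η) :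
    ∃ L : Set S, IsCompact L ∧ ∀ n, μ n (Metric.cthickening ε L)ᶜ ≤ η := by
  obtain ⟨N, hN⟩ := eventually_atTop.1 h
  have hsingle : ∀ n, ∃ L : Set S, IsCompact L ∧ μ n Lᶜ ≤ η := fun n ↦ by
    obtain ⟨L, hL, hle⟩ := isTightMeasureSet_iff_exists_isCompact_measure_compl_le.1
      (isTightMeasureSet_singleton (μ := μ n)) η hη
    exact ⟨L, hL, hle _ rfl⟩
  choose L hL hLle using hsingle
  refine ⟨K ∪ ⋃ n ∈ Finset.range N, L n,
    hK.union ((Finset.range N).isCompact_biUnion fun n _ ↦ hL n), fun n ↦ ?_⟩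
  rcases lt_or_ge n N with hn | hn
  · refine (measure_mono (compl_subset_compl.2 ?_)).trans (hLle n)
    exact ((subset_biUnion_of_mem (u := L) (Finset.mem_coe.2 (Finset.mem_range.2 hn))).trans
      subset_union_right).trans (Metric.self_subset_cthickening _)
  · exact (measure_mono (compl_subset_compl.2
      (Metric.cthickening_subset_of_subset _ subset_union_left))).trans (hN n hn)

lemma isTightMeasureSet_range_of_cthickening
    (h : ∀ ε : ℝ, 0 < ε → ∀ η : ℝ≥0∞, 0 < η → ∃ K : Set S, IsCompact K ∧
      ∀ᶠ n in atTop, μ n (Metric.cthickening ε K)ᶜ ≤ η) :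
    IsTightMeasureSet (range μ) := by
  have hall : ∀ ε : ℝ, 0 < ε → ∀ η : ℝ≥0∞, 0 < η → ∃ L : Set S, IsCompact L ∧
      ∀ n, μ n (Metric.cthickening ε L)ᶜ ≤ η := fun ε hε η hη ↦ by
    obtain ⟨K, hK, hev⟩ := h ε hε η hη
    exact exists_isCompact_forall_measure_compl_cthickening_le hη hK hev
  rw [isTightMeasureSet_iff_exists_isCompact_measure_compl_le]
  intro η hη
  obtain ⟨δ, hδ0, hδ⟩ := ENNReal.exists_pos_sum_of_countable' hη.ne' ℕ
  choose K hK hKle using fun j : ℕ ↦ hall (1 / ((j : ℝ) + 1)) (by positivity) (δ j) (hδ0 j)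
  refine ⟨⋂ j : ℕ, Metric.cthickening (1 / ((j : ℝ) + 1)) (K j), isCompact_iInter_cthickening hK
    (fun j ↦ by positivity) tendsto_one_div_add_atTop_nhds_zero_nat, ?_⟩
  rintro _ ⟨n, rfl⟩
  rw [compl_iInter]
  exact (measure_iUnion_le _).trans ((ENNReal.tsum_le_tsum fun j ↦ hKle j n).trans hδ.le)

end MetricSpace

section GaussianTail

lemma hasSubgaussianMGF_id_gaussianReal (v : ℝ≥0) : HasSubgaussianMGF id v (gaussianReal 0 v) where
  integrable_exp_mul t := integrable_exp_mul_gaussianReal t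
  mgf_le t := by simp [mgf_id_gaussianReal]

lemma gaussianReal_le_abs_le (v : ℝ≥0) {ε : ℝ} (hε : 0 ≤ ε) :
    gaussianReal 0 v {x | ε ≤ |x|} ≤ ENNReal.ofReal (2 * Real.exp (-ε ^ 2 / (2 * v))) := by
  have hright := (hasSubgaussianMGF_id_gaussianReal v).measure_ge_le hε
  have hleft := (hasSubgaussianMGF_id_gaussianReal v).neg.measure_ge_le hε
  have hunion : {x : ℝ | ε ≤ |x|} = {x | ε ≤ id x} ∪ {x | ε ≤ (-id) x} := by
    ext x
    change ε ≤ |x| ↔ ε ≤ x ∨ ε ≤ -x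
    exact le_abs
  rw [hunion, ← ofReal_measureReal]
  exact ENNReal.ofReal_le_ofReal ((measureReal_union_le _ _).trans (by linarith))

lemma tendsto_mul_gaussianReal_one_div_le_abs {ε : ℝ} (hε : 0 < ε) :
    Tendsto (fun q : ℕ ↦ (q : ℝ≥0∞) * gaussianReal 0 (1 / q) {x | ε ≤ |x|}) atTop (𝓝 0) := by
  have hexp : Tendsto (fun q : ℕ ↦ ENNReal.ofReal
      (2 * ((q : ℝ) ^ (1 : ℝ) * Real.exp (-(ε ^ 2 / 2) * q)))) atTop (𝓝 0) := by
    have hreal := ((tendsto_rpow_mul_exp_neg_mul_atTop_nhds_zero 1 (ε ^ 2 / 2)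
      (by positivity)).comp tendsto_natCast_atTop_atTop).const_mul 2
    rw [mul_zero] at hreal
    simpa using ENNReal.tendsto_ofReal hreal
  refine tendsto_of_tendsto_of_tendsto_of_le_of_le tendsto_const_nhds hexp (fun _ ↦ zero_le)
    fun q ↦ (mul_le_mul_right (gaussianReal_le_abs_le (1 / q) hε.le) _).trans_eq ?_
  rw [← ENNReal.ofReal_natCast, ← ENNReal.ofReal_mul q.cast_nonneg]
  push_cast
  rw [Real.rpow_one, mul_left_comm]
  congr 5
  field_simp

end GaussianTail

lemma abs_le_mul_of_block {s : ℕ → ℝ} (hs : s 0 = 0) {k q : ℕ} {δ : ℝ}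
    (h : ∀ i < q, ∀ j, k * i / q ≤ j → j ≤ k * (i + 1) / q → |s j - s (k * i / q)| ≤ δ)
    {i : ℕ} (hi : i ≤ q) : |s (k * i / q)| ≤ i * δ := by
  induction i with
  | zero => simp [hs]
  | succ i ih =>
    have hblock := h i hi _ (Nat.div_le_div_right (Nat.mul_le_mul_left _ i.le_succ)) le_rfl
    have htriangle := abs_sub_abs_le_abs_sub (s (k * (i + 1) / q)) (s (k * i / q))
    push_cast
    linarith [ih (Nat.le_of_succ_le hi)]

lemma polygon_mem_cthickening_of_block {s : ℕ → ℝ} (hs : s 0 = 0) {k q : ℕ} (hq : 0 < q)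
    (hqk : q ≤ k) {δ : ℝ}
    (h : ∀ i < q, ∀ j, k * i / q ≤ j → j ≤ k * (i + 1) / q → |s j - s (k * i / q)| ≤ δ) :
    polygon k s ∈ Metric.cthickening (3 * δ) (polygon q '' {s' | ∀ i ≤ q, |s' i| ≤ q * δ}) := by
  have hδ : 0 ≤ δ := (abs_nonneg _).trans
    (h 0 hq (k * 0 / q) le_rfl (Nat.div_le_div_right (by simp)))
  exact Metric.mem_cthickening_of_dist_le _ _ _ _
    ⟨_, fun i hi ↦ (abs_le_mul_of_block hs h hi).trans (by gcongr), rfl⟩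
    (dist_polygon_coarse_le hq hqk h)

lemma natCast_mul_succ_div_sub_le {k q i j : ℕ} (hq : 0 < q) (hqk : q ≤ k) (hij : k * i / q ≤ j)
    (hji : j ≤ k * (i + 1) / q) : ((k * (i + 1) / q - j : ℕ) : ℝ) ≤ 2 * (k / q) := by
  have hq' : (0 : ℝ) < q := Nat.cast_pos.2 hq
  have hupper : ((k * (i + 1) / q : ℕ) : ℝ) ≤ k * i / q + k / q :=
    Nat.cast_div_le.trans_eq (by push_cast; ring)
  have hlower : (k * i / q : ℝ) < j + 1 := by
    rw [div_lt_iff₀ hq']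
    exact_mod_cast Nat.lt_mul_of_div_lt (Nat.lt_succ_of_le hij) hq
  have hone : (1 : ℝ) ≤ k / q := (one_le_div hq').2 (Nat.cast_le.2 hqk)
  rw [Nat.cast_sub hji]
  linarith

variable {Ω : Type*} [MeasurableSpace Ω] {Q : Measure Ω} [IsProbabilityMeasure Q]

section Row

variable {k : ℕ} {ξ : Fin k → Ω → ℝ}

lemma measure_exists_two_mul_lt_abs_cumSum_sub_block_le (hξ : ∀ r, Measurable (ξ r))
    (hindep : iIndepFun ξ Q) (hξ2 : ∀ r, MemLp (ξ r) 2 Q) (hmean : ∀ r, ∫ ω, ξ r ω ∂Q = 0)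
    (hsq : ∀ r, ∫ ω, ξ r ω ^ 2 ∂Q = 1 / k) {ε : ℝ} (hε : 0 < ε) {q i : ℕ} (hi : i < q)
    (hqk : q ≤ k) (hqε : 4 / ε ^ 2 ≤ q) :
    Q {ω | ∃ j, k * i / q ≤ j ∧ j ≤ k * (i + 1) / q ∧
        2 * ε < |cumSum (ξ · ω) j - cumSum (ξ · ω) (k * i / q)|} ≤
      2 * Q {ω | ε ≤ |cumSum (ξ · ω) (k * (i + 1) / q) - cumSum (ξ · ω) (k * i / q)|} := by
  have hq : 0 < q := i.zero_le.trans_lt hi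
  have hq' : (0 : ℝ) < q := Nat.cast_pos.2 hq
  have hk : (0 : ℝ) < k := Nat.cast_pos.2 (hq.trans_le hqk)
  have hblock : k * (i + 1) / q ≤ k :=
    Nat.div_le_of_le_mul (by rw [mul_comm q]; exact Nat.mul_le_mul_left _ hi)
  refine measure_exists_two_mul_lt_abs_cumSum_sub_le hξ hindep
    (Nat.div_le_div_right (Nat.mul_le_mul_left _ i.le_succ)) fun j hij hji ↦ ?_
  calc _ ≤ ENNReal.ofReal ((k * (i + 1) / q - j : ℕ) * (1 / k) / ε ^ 2) :=
        measure_le_abs_cumSum_sub_le hindep hξ2 hmean hsq hji hblock hε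
    _ ≤ ENNReal.ofReal (2 * (k / q) * (1 / k) / ε ^ 2) := by
        gcongr
        exact natCast_mul_succ_div_sub_le hq hqk hij hji
    _ ≤ ENNReal.ofReal (1 / 2) := by
        refine ENNReal.ofReal_le_ofReal ?_
        rw [div_le_iff₀ (by positivity)] at hqε ⊢
        field_simp
        linarith
    _ = 1 / 2 := by simp

lemma measure_polygon_cumSum_notMem_cthickening_le (hξ : ∀ r, Measurable (ξ r))
    (hindep : iIndepFun ξ Q) (hξ2 : ∀ r, MemLp (ξ r) 2 Q) (hmean : ∀ r, ∫ ω, ξ r ω ∂Q = 0)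
    (hsq : ∀ r, ∫ ω, ξ r ω ^ 2 ∂Q = 1 / k) {ε : ℝ} (hε : 0 < ε) {q : ℕ} (hq : 0 < q)
    (hqk : q ≤ k) (hqε : 4 / ε ^ 2 ≤ q) :
    Q {ω | polygon k (cumSum (ξ · ω)) ∉ Metric.cthickening (3 * (2 * ε))
        (polygon q '' {s | ∀ i ≤ q, |s i| ≤ q * (2 * ε)})} ≤
      ∑ i ∈ Finset.range q, 2 *
        Q {ω | ε ≤ |cumSum (ξ · ω) (k * (i + 1) / q) - cumSum (ξ · ω) (k * i / q)|} := by
  let largeFluctuation : ℕ → Set Ω := fun i ↦ {ω | ∃ j, k * i / q ≤ j ∧ j ≤ k * (i + 1) / q ∧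
    2 * ε < |cumSum (ξ · ω) j - cumSum (ξ · ω) (k * i / q)|}
  have hsub : {ω | polygon k (cumSum (ξ · ω)) ∉ Metric.cthickening (3 * (2 * ε))
      (polygon q '' {s | ∀ i ≤ q, |s i| ≤ q * (2 * ε)})} ⊆
      ⋃ i ∈ Finset.range q, largeFluctuation i := fun ω hω ↦ by
    by_contra hsmall
    refine hω (polygon_mem_cthickening_of_block (cumSum_zero _) hq hqk fun i hi j hij hji ↦ ?_)
    by_contra! hlt
    exact hsmall (mem_iUnion₂.2 ⟨i, Finset.mem_range.2 hi, j, hij, hji, hlt⟩)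
  exact (measure_mono hsub).trans <| (measure_biUnion_finset_le _ _).trans <|
    Finset.sum_le_sum fun i hi ↦ measure_exists_two_mul_lt_abs_cumSum_sub_block_le hξ hindep hξ2
      hmean hsq hε (Finset.mem_range.1 hi) hqk hqε

end Row

namespace IsDonskerArray

variable {k : ℕ → ℕ} {ξ : ∀ n, Fin (k n) → Ω → ℝ}

lemma eventually_measure_le_abs_cumSum_sub_block_lt (hξ : IsDonskerArray ξ Q) {q i : ℕ}
    (hi : i < q) {ε : ℝ} {c : ℝ≥0∞} (hc : gaussianReal 0 (1 / q) {x | ε ≤ |x|} < c) :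
    ∀ᶠ n in atTop, Q {ω | ε ≤
      |cumSum (ξ n · ω) (k n * (i + 1) / q) - cumSum (ξ n · ω) (k n * i / q)|} < c := by
  have hlength : Tendsto (fun n ↦
      (((k n * (i + 1) / q : ℕ) : ℝ) / k n - ((k n * i / q : ℕ) : ℝ) / k n)) atTop
      (𝓝 ((1 / q : ℝ≥0) : ℝ)) := by
    have hdiff := (tendsto_natCast_mul_div_div hξ.tendsto_length (i + 1) q).sub
      (tendsto_natCast_mul_div_div hξ.tendsto_length i q)
    rw [← sub_div] at hdiff
    simpa using hdiff
  exact eventually_measure_preimage_lt_of_tendstoInDistribution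
    (hξ.tendstoInDistribution_cumSum_sub_cumSum
      (fun n ↦ Nat.div_le_div_right (Nat.mul_le_mul_left _ i.le_succ))
      (fun n ↦ Nat.div_le_of_le_mul (by rw [mul_comm q]; exact Nat.mul_le_mul_left _ hi)) hlength)
    (isClosed_le continuous_const continuous_abs) hc

theorem isTightMeasureSet (hξ : IsDonskerArray ξ Q) :
    IsTightMeasureSet (range fun n ↦ Q.map fun ω ↦ polygon (k n) (cumSum (ξ n · ω))) := by
  refine isTightMeasureSet_range_of_cthickening fun ε hε η hη ↦ ?_
  obtain ⟨δ, hδ, rfl⟩ : ∃ δ, 0 < δ ∧ ε = 3 * (2 * δ) := ⟨ε / 6, by positivity, by ring⟩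
  obtain ⟨q, hq, hqδ, hqη⟩ : ∃ q : ℕ, 0 < q ∧ 4 / δ ^ 2 ≤ q ∧
      (q : ℝ≥0∞) * gaussianReal 0 (1 / q) {x | δ ≤ |x|} < η / 2 :=
    ((eventually_gt_atTop 0).and ((tendsto_natCast_atTop_atTop.eventually_ge_atTop _).and
      ((tendsto_mul_gaussianReal_one_div_le_abs hδ).eventually_lt_const
        (ENNReal.half_pos hη.ne')))).exists
  have hgauss : gaussianReal 0 (1 / q) {x | δ ≤ |x|} < η / 2 / q :=
    ENNReal.lt_div_iff_mul_lt (by simp) (by simp) |>.2 (by rwa [mul_comm])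
  have hblocks := (Finset.eventually_all (Finset.range q)).2 fun i hi ↦
    hξ.eventually_measure_le_abs_cumSum_sub_block_lt (Finset.mem_range.1 hi) hgauss
  refine ⟨polygon q '' {s | ∀ i ≤ q, |s i| ≤ q * (2 * δ)},
    isCompact_image_polygon q _, ?_⟩
  filter_upwards [hblocks, hξ.memLp, hξ.integral_eq_zero, hξ.integral_sq,
    hξ.tendsto_length.eventually_ge_atTop q] with n hn hmemLp hmean hsq hqk
  rw [Measure.map_apply (measurable_polygon_cumSum (hξ.measurable n))
    Metric.isClosed_cthickening.measurableSet.compl]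
  calc _ ≤ ∑ i ∈ Finset.range q, 2 * (η / 2 / q) :=
        (measure_polygon_cumSum_notMem_cthickening_le (hξ.measurable n) (hξ.iIndepFun n) hmemLp
          hmean hsq hδ hq hqk hqδ).trans
          (Finset.sum_le_sum fun i hi ↦ mul_le_mul_right (hn i hi).le _)
    _ = q * (η / q) := by
        rw [Finset.sum_const, Finset.card_range, nsmul_eq_mul, mul_div_assoc',
          ENNReal.mul_div_cancel two_ne_zero ENNReal.ofNat_ne_top]
    _ ≤ η := ENNReal.mul_div_le

end IsDonskerArray

end Tightness

section WienerMeasure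

/-- The variance of `∑ i, θ i * B (t i)` for a standard Brownian motion `B`. -/
def brownianForm {ι : Type*} [Fintype ι] (t : ι → I) (θ : ι → ℝ) : ℝ :=
  ∑ i, ∑ j, θ i * θ j * min (t i : ℝ) (t j)

lemma brownianForm_const_mul {ι : Type*} [Fintype ι] (t : ι → I) (u : ℝ) (θ : ι → ℝ) :
    brownianForm t (fun i ↦ u * θ i) = u ^ 2 * brownianForm t θ := by
  simp only [brownianForm, Finset.mul_sum]
  exact Finset.sum_congr rfl fun i _ ↦ Finset.sum_congr rfl fun j _ ↦ by ring

lemma brownianForm_unit (t : I) : brownianForm (fun _ : Unit ↦ t) 1 = t := by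
  simp [brownianForm]

lemma brownianForm_pair (s t : I) : brownianForm ![s, t] 1 = s + t + 2 * min (s : ℝ) t := by
  simp only [brownianForm, Pi.one_apply, mul_one, one_mul, Fin.sum_univ_two, Matrix.cons_val_zero,
    Matrix.cons_val_one, min_self, min_comm (t : ℝ)]
  ring

lemma continuous_sum_eval {ι : Type*} [Fintype ι] (t : ι → I) (θ : ι → ℝ) :
    Continuous fun x : C(I, ℝ) ↦ ∑ i, θ i * x (t i) := by
  fun_prop

lemma measurable_eval {ι : Type*} (t : ι → I) :
    Measurable fun (x : C(I, ℝ)) (i : ι) ↦ x (t i) :=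
  measurable_pi_lambda _ fun i ↦ (continuous_eval_const (t i)).measurable

section PolygonApproximation

/-- The points `i / q` of the grid of mesh `1 / q` on `[0,1]`, with value `1` for `i > q`. -/
noncomputable def gridPoint (q i : ℕ) : I :=
  projIcc 0 1 zero_le_one (i / q : ℝ)

lemma dist_gridPoint_le {q i : ℕ} (hq : 0 < q) (hi : i ≤ q) {t : I} (ht : |i - q * (t : ℝ)| ≤ 1) :
    dist (gridPoint q i) t ≤ 1 / q := by
  have hq' : (0 : ℝ) < q := Nat.cast_pos.2 hq
  have hmem : (i / q : ℝ) ∈ Icc 0 1 := ⟨by positivity, (div_le_one hq').2 (Nat.cast_le.2 hi)⟩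
  rw [gridPoint, projIcc_of_mem _ hmem, Subtype.dist_eq, Real.dist_eq,
    show (i / q : ℝ) - t = (i - q * t) / q by field_simp, abs_div, abs_of_pos hq']
  gcongr

lemma abs_polygon_sub_le {k : ℕ} (hk : 0 < k) (s : ℕ → ℝ) (t : I) {c δ : ℝ}
    (hleft : |s (gridIndex k t) - c| ≤ δ) (hright : |s (gridIndex k t + 1) - c| ≤ δ) :
    |polygon k s t - c| ≤ δ := by
  have hlow := gridIndex_le_mul k t
  have hhigh := mul_le_gridIndex_add_one hk t
  have hconvex := (convex_closedBall c δ).add_smul_sub_mem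
    (Metric.mem_closedBall.2 hleft) (Metric.mem_closedBall.2 hright)
    (t := k * (t : ℝ) - gridIndex k t) ⟨by linarith, by linarith⟩
  rw [polygon_apply_gridIndex hk]
  exact Metric.mem_closedBall.1 hconvex

lemma tendsto_polygon_gridPoint (x : C(I, ℝ)) :
    Tendsto (fun q : ℕ ↦ polygon q fun i ↦ x (gridPoint q i)) atTop (𝓝 x) := by
  refine Metric.tendsto_nhds.2 fun ε hε ↦ ?_
  obtain ⟨δ, hδ, hx⟩ := Metric.uniformContinuous_iff.1
    (CompactSpace.uniformContinuous_of_continuous x.continuous) (ε / 2) (by positivity)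
  filter_upwards [tendsto_one_div_atTop_nhds_zero_nat.eventually_lt_const hδ,
    eventually_gt_atTop 0] with q hqδ hq
  refine ((ContinuousMap.dist_le (by positivity)).2 fun t ↦ ?_).trans_lt (half_lt_self hε)
  have hlow := gridIndex_le_mul q t
  have hhigh := mul_le_gridIndex_add_one hq t
  have hindex := gridIndex_lt hq t
  exact abs_polygon_sub_le hq _ t
    (hx ((dist_gridPoint_le hq hindex.le
      (abs_le.2 ⟨by linarith, by linarith⟩)).trans_lt hqδ)).le
    (hx ((dist_gridPoint_le hq hindex
      (abs_le.2 ⟨by push_cast; linarith, by push_cast; linarith⟩)).trans_lt hqδ)).le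

end PolygonApproximation

section Uniqueness

variable {μ ν : Measure C(I, ℝ)}

lemma exists_apply_eq_sum_mul {ι : Type*} [Fintype ι] (L : StrongDual ℝ (ι → ℝ)) :
    ∃ θ : ι → ℝ, ∀ y, L y = ∑ i, θ i * y i := by
  classical
  exact ⟨fun i ↦ L fun j ↦ if i = j then 1 else 0, fun y ↦
    (L.toLinearMap.pi_apply_eq_sum_univ y).trans <|
      Finset.sum_congr rfl fun i _ ↦ mul_comm _ _⟩

lemma integral_polygon_gridPoint_eq_of_map_eval_eq
    (h : ∀ (ι : Type) [Fintype ι] (t : ι → I),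
      μ.map (fun (x : C(I, ℝ)) (i : ι) ↦ x (t i)) = ν.map (fun x i ↦ x (t i)))
    (f : BoundedContinuousFunction C(I, ℝ) ℝ) (q : ℕ) :
    ∫ x : C(I, ℝ), f (polygon q fun i ↦ x (gridPoint q i)) ∂μ =
      ∫ x : C(I, ℝ), f (polygon q fun i ↦ x (gridPoint q i)) ∂ν := by
  let t : Fin (q + 1) → I := fun i ↦ gridPoint q i
  have hextend : Continuous fun (y : Fin (q + 1) → ℝ) (i : ℕ) ↦ y (Fin.ofNat (q + 1) i) := by
    fun_prop
  let g : (Fin (q + 1) → ℝ) → ℝ := fun y ↦ f (polygon q fun i ↦ y (Fin.ofNat (q + 1) i))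
  have hg : Continuous g :=
    f.continuous.comp ((continuous_polygon q).comp hextend)
  have hfactor : (fun x : C(I, ℝ) ↦ f (polygon q fun i ↦ x (gridPoint q i))) =
      fun x ↦ g fun i ↦ x (t i) := by
    refine funext fun x ↦ congrArg f (polygon_congr fun i hi ↦ ?_)
    simp only [t, Fin.val_ofNat, Nat.mod_eq_of_lt (Nat.lt_succ_of_le hi)]
  rw [hfactor, ← integral_map (measurable_eval t).aemeasurable hg.aestronglyMeasurable,
    ← integral_map (measurable_eval t).aemeasurable hg.aestronglyMeasurable, h]

variable [IsFiniteMeasure μ] [IsFiniteMeasure ν]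

lemma map_eval_eq_of_charFun {ι : Type*} [Fintype ι] (t : ι → I)
    (h : ∀ θ : ι → ℝ, charFun (μ.map fun x ↦ ∑ i, θ i * x (t i)) 1 =
      charFun (ν.map fun x ↦ ∑ i, θ i * x (t i)) 1) :
    μ.map (fun (x : C(I, ℝ)) (i : ι) ↦ x (t i)) = ν.map (fun x i ↦ x (t i)) := by
  refine Measure.ext_of_charFunDual (funext fun L ↦ ?_)
  obtain ⟨θ, hθ⟩ := exists_apply_eq_sum_mul L
  have hL : ⇑L ∘ (fun (x : C(I, ℝ)) i ↦ x (t i)) = fun x ↦ ∑ i, θ i * x (t i) :=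
    funext fun x ↦ hθ _
  simp only [charFunDual_eq_charFun_map_one,
    Measure.map_map L.continuous.measurable (measurable_eval t), hL, h θ]

lemma tendsto_integral_polygon_gridPoint (f : BoundedContinuousFunction C(I, ℝ) ℝ) :
    Tendsto (fun q : ℕ ↦ ∫ x : C(I, ℝ), f (polygon q fun i ↦ x (gridPoint q i)) ∂μ) atTop
      (𝓝 (∫ x, f x ∂μ)) := by
  have hcont : ∀ q : ℕ, Continuous fun (x : C(I, ℝ)) (i : ℕ) ↦ x (gridPoint q i) := fun q ↦ by
    fun_prop
  exact tendsto_integral_of_dominated_convergence (fun _ ↦ ‖f‖)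
    (fun q ↦ (f.continuous.comp ((continuous_polygon q).comp (hcont q))).aestronglyMeasurable)
    (integrable_const _) (fun q ↦ Eventually.of_forall fun x ↦ f.norm_coe_le_norm _)
    (Eventually.of_forall fun x ↦ (f.continuous.tendsto x).comp (tendsto_polygon_gridPoint x))

lemma ext_of_charFun_eval
    (h : ∀ (ι : Type) [Fintype ι] (t : ι → I) (θ : ι → ℝ),
      charFun (μ.map fun x ↦ ∑ i, θ i * x (t i)) 1 =
        charFun (ν.map fun x ↦ ∑ i, θ i * x (t i)) 1) : μ = ν :=
  ext_of_forall_integral_eq_of_IsFiniteMeasure fun f ↦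
    tendsto_nhds_unique (tendsto_integral_polygon_gridPoint f)
      ((tendsto_integral_polygon_gridPoint f).congr fun q ↦
        (integral_polygon_gridPoint_eq_of_map_eval_eq
          (fun ι _ t ↦ map_eval_eq_of_charFun t (h ι t)) f q).symm)

end Uniqueness

/-- The linear combinations of evaluations have under `W` the characteristic functions which they
have under Wiener measure. At this stage `W` is not known to be Gaussian; see
`HasWienerCharFun.isWienerMeasure`. -/
def HasWienerCharFun (W : Measure C(I, ℝ)) : Prop :=
  ∀ (ι : Type) [Fintype ι] (t : ι → I) (θ : ι → ℝ),
    charFun (W.map fun x ↦ ∑ i, θ i * x (t i)) 1 = (Real.exp (-(brownianForm t θ / 2)) : ℝ)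

namespace HasWienerCharFun

lemma ext {μ ν : Measure C(I, ℝ)} [IsFiniteMeasure μ] [IsFiniteMeasure ν]
    (hμ : HasWienerCharFun μ) (hν : HasWienerCharFun ν) : μ = ν :=
  ext_of_charFun_eval fun ι _ t θ ↦ (hμ ι t θ).trans (hν ι t θ).symm

variable {W : Measure C(I, ℝ)} {ι : Type} [Fintype ι]

lemma charFun_map_sum_eval (hW : HasWienerCharFun W) (t : ι → I) (θ : ι → ℝ) (u : ℝ) :
    charFun (W.map fun x ↦ ∑ i, θ i * x (t i)) u =
      (Real.exp (-(u ^ 2 * brownianForm t θ / 2)) : ℝ) := by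
  have hscale : (W.map fun x ↦ ∑ i, θ i * x (t i)).map (u * ·) =
      W.map fun x ↦ ∑ i, u * θ i * x (t i) := by
    rw [Measure.map_map (measurable_const_mul u) (continuous_sum_eval t θ).measurable]
    congr 1 with x
    simp only [Function.comp, Finset.mul_sum, mul_assoc]
  rw [← brownianForm_const_mul, ← hW, ← hscale, charFun_map_mul, mul_one]

variable [IsProbabilityMeasure W]

lemma brownianForm_nonneg (hW : HasWienerCharFun W) (t : ι → I) (θ : ι → ℝ) :
    0 ≤ brownianForm t θ := by
  have : IsProbabilityMeasure (W.map fun x ↦ ∑ i, θ i * x (t i)) :=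
    Measure.isProbabilityMeasure_map (continuous_sum_eval t θ).aemeasurable
  have hnorm := norm_charFun_le_one (μ := W.map fun x ↦ ∑ i, θ i * x (t i)) 1
  rw [hW, Complex.norm_real, Real.norm_of_nonneg (Real.exp_pos _).le, Real.exp_le_one_iff] at hnorm
  linarith

lemma hasLaw_sum_eval (hW : HasWienerCharFun W) (t : ι → I) (θ : ι → ℝ) :
    HasLaw (fun x : C(I, ℝ) ↦ ∑ i, θ i * x (t i))
      (gaussianReal 0 (brownianForm t θ).toNNReal) W where
  aemeasurable := (continuous_sum_eval t θ).aemeasurable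
  map_eq := by
    refine Measure.ext_of_charFun (funext fun u ↦ ?_)
    rw [hW.charFun_map_sum_eval, charFun_gaussianReal,
      Real.coe_toNNReal _ (hW.brownianForm_nonneg t θ)]
    push_cast
    ring_nf

lemma memLp_sum_eval (hW : HasWienerCharFun W) (t : ι → I) (θ : ι → ℝ) :
    MemLp (fun x : C(I, ℝ) ↦ ∑ i, θ i * x (t i)) 2 W := by
  have hlaw := hW.hasLaw_sum_eval t θ
  refine (memLp_map_measure_iff aestronglyMeasurable_id hlaw.aemeasurable).1 ?_
  rw [hlaw.map_eq]
  exact memLp_id_gaussianReal 2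

lemma integral_sum_eval (hW : HasWienerCharFun W) (t : ι → I) (θ : ι → ℝ) :
    ∫ x : C(I, ℝ), ∑ i, θ i * x (t i) ∂W = 0 :=
  (hW.hasLaw_sum_eval t θ).integral_eq.trans integral_id_gaussianReal

lemma variance_sum_eval (hW : HasWienerCharFun W) (t : ι → I) (θ : ι → ℝ) :
    Var[fun x : C(I, ℝ) ↦ ∑ i, θ i * x (t i); W] = brownianForm t θ :=
  (hW.hasLaw_sum_eval t θ).variance_eq.trans <| variance_id_gaussianReal.trans <|
    Real.coe_toNNReal _ (hW.brownianForm_nonneg t θ)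

lemma isGaussianProcess (hW : HasWienerCharFun W) :
    IsGaussianProcess (fun (t : I) (x : C(I, ℝ)) ↦ x t) W := by
  refine ⟨fun J ↦ ⟨isGaussian_of_map_eq_gaussianReal fun L ↦ ?_⟩⟩
  obtain ⟨θ, hθ⟩ := exists_apply_eq_sum_mul L
  refine ⟨0, (brownianForm (fun j : J ↦ (j : I)) θ).toNNReal, ?_⟩
  change (W.map fun (x : C(I, ℝ)) (j : J) ↦ x j).map L = _
  rw [Measure.map_map L.continuous.measurable (measurable_eval _),
    ← (hW.hasLaw_sum_eval _ θ).map_eq]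
  exact congrArg W.map (funext fun x ↦ hθ _)

lemma isWienerMeasure (hW : HasWienerCharFun W) : IsWienerMeasure W where
  isGaussianProcess := hW.isGaussianProcess
  mean_eq_zero t := by
    simpa using hW.integral_sum_eval (fun _ : Unit ↦ t) 1
  covariance_eq_min s t := by
    have hmemLp : ∀ r : I, MemLp (fun x : C(I, ℝ) ↦ x r) 2 W := fun r ↦ by
      simpa using hW.memLp_sum_eval (fun _ : Unit ↦ r) 1
    have hvar : ∀ r : I, Var[fun x : C(I, ℝ) ↦ x r; W] = r := fun r ↦ by
      simpa [brownianForm_unit] using hW.variance_sum_eval (fun _ : Unit ↦ r) 1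
    have hvar_add : Var[fun x : C(I, ℝ) ↦ x s + x t; W] = s + t + 2 * min (s : ℝ) t := by
      simpa [brownianForm_pair] using hW.variance_sum_eval ![s, t] 1
    have hpolarization := variance_fun_add (hmemLp s) (hmemLp t)
    rw [hvar_add, hvar, hvar] at hpolarization
    linarith

end HasWienerCharFun

lemma continuous_charFun_map {S : Type*} [TopologicalSpace S] [MeasurableSpace S]
    [OpensMeasurableSpace S] {L : S → ℝ} (hL : Continuous L) (u : ℝ) :
    Continuous fun ν : ProbabilityMeasure S ↦ charFun ((ν : Measure S).map L) u := by
  have hcharFun : Continuous fun ν : ProbabilityMeasure ℝ ↦ charFun (ν : Measure ℝ) u := by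
    refine continuous_iff_continuousAt.2 fun ν ↦ ?_
    have hintegral := (ProbabilityMeasure.tendsto_iff_forall_integral_rclike_tendsto ℂ).1
      (tendsto_id (x := 𝓝 ν)) (BoundedContinuousFunction.innerProbChar u)
    simpa only [ContinuousAt, id, charFun_eq_integral_innerProbChar] using hintegral
  exact hcharFun.comp (ProbabilityMeasure.continuous_map hL)

lemma hasWienerCharFun_of_mapClusterPt {μ : ℕ → ProbabilityMeasure C(I, ℝ)}
    (hμ : ∀ (ι : Type) [Fintype ι] (t : ι → I) (θ : ι → ℝ),
      Tendsto (fun n ↦ charFun ((μ n : Measure C(I, ℝ)).map fun x ↦ ∑ i, θ i * x (t i)) 1) atTop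
        (𝓝 (Real.exp (-(brownianForm t θ / 2)) : ℝ)))
    {W : ProbabilityMeasure C(I, ℝ)} (hW : MapClusterPt W atTop μ) :
    HasWienerCharFun (W : Measure C(I, ℝ)) := fun ι _ t θ ↦ by
  have hcont := continuous_charFun_map (continuous_sum_eval t θ) 1
  exact eq_of_nhds_neBot ((hW.continuousAt_comp hcont.continuousAt).clusterPt.mono (hμ ι t θ))

lemma exists_hasWienerCharFun_tendsto {μ : ℕ → ProbabilityMeasure C(I, ℝ)}
    (htight : IsTightMeasureSet (range fun n ↦ (μ n : Measure C(I, ℝ))))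
    (hμ : ∀ (ι : Type) [Fintype ι] (t : ι → I) (θ : ι → ℝ),
      Tendsto (fun n ↦ charFun ((μ n : Measure C(I, ℝ)).map fun x ↦ ∑ i, θ i * x (t i)) 1) atTop
        (𝓝 (Real.exp (-(brownianForm t θ / 2)) : ℝ))) :
    ∃ W : ProbabilityMeasure C(I, ℝ), HasWienerCharFun (W : Measure C(I, ℝ)) ∧
      Tendsto μ atTop (𝓝 W) := by
  have hcompact : IsCompact (closure (range μ)) := by
    refine isCompact_closure_of_isTightMeasureSet (htight.subset ?_)
    rintro _ ⟨_, ⟨n, rfl⟩, rfl⟩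
    exact mem_range_self n
  have hmem : ∀ᶠ n in atTop, μ n ∈ closure (range μ) :=
    Eventually.of_forall fun n ↦ subset_closure (mem_range_self n)
  obtain ⟨W, -, hW⟩ := hcompact.exists_mapClusterPt (tendsto_principal.2 hmem)
  refine ⟨W, hasWienerCharFun_of_mapClusterPt hμ hW,
    hcompact.tendsto_nhds_of_unique_mapClusterPt hmem fun W' _ hW' ↦
      ProbabilityMeasure.toMeasure_injective ?_⟩
  exact (hasWienerCharFun_of_mapClusterPt hμ hW').ext (hasWienerCharFun_of_mapClusterPt hμ hW)

theorem IsDonskerArray.exists_tendstoInDistribution {Ω : Type*} [MeasurableSpace Ω]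
    {Q : Measure Ω} [IsProbabilityMeasure Q] {k : ℕ → ℕ} {ξ : ∀ n, Fin (k n) → Ω → ℝ}
    (hξ : IsDonskerArray ξ Q) :
    ∃ W : ProbabilityMeasure C(I, ℝ), HasWienerCharFun (W : Measure C(I, ℝ)) ∧
      TendstoInDistribution (fun n ω ↦ polygon (k n) (cumSum (ξ n · ω))) atTop id (fun _ ↦ Q)
        W := by
  have hmeas := fun n ↦ measurable_polygon_cumSum (hξ.measurable n)
  let μ : ℕ → ProbabilityMeasure C(I, ℝ) := fun n ↦
    ⟨Q.map fun ω ↦ polygon (k n) (cumSum (ξ n · ω)),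
      Measure.isProbabilityMeasure_map (hmeas n).aemeasurable⟩
  obtain ⟨W, hW, hμW⟩ := exists_hasWienerCharFun_tendsto (μ := μ) hξ.isTightMeasureSet
    fun ι _ t θ ↦ by
      simpa [μ, Measure.map_map (continuous_sum_eval t θ).measurable (hmeas _), Function.comp_def,
        brownianForm] using hξ.tendsto_charFun_sum_polygon t θ 1
  have hid : W = ⟨(W : Measure C(I, ℝ)).map id,
      Measure.isProbabilityMeasure_map aemeasurable_id⟩ :=
    ProbabilityMeasure.toMeasure_injective Measure.map_id.symm
  exact ⟨W, hW, fun n ↦ (hmeas n).aemeasurable, aemeasurable_id, hμW.trans_eq (congrArg 𝓝 hid)⟩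

end WienerMeasure

section RandomSampling

variable {E : Type*} [MeasurableSpace E] {ρ : Measure E} {f : E → ℝ} {k : ℕ}

lemma tailMoment_comp {Ω : Type*} [MeasurableSpace Ω] {Q : Measure Ω} {τ : Ω → E}
    (hτ : MeasurePreserving τ Q ρ) (hf : Measurable f) (ε : ℝ) :
    tailMoment Q (f ∘ τ) ε = tailMoment ρ f ε := by
  rw [tailMoment, tailMoment, ← hτ.map_eq]
  exact (setIntegral_map (measurableSet_lt measurable_const hf.abs)
    (hf.pow_const 2).aestronglyMeasurable hτ.aemeasurable).symm

lemma tailMoment_anti (hf2 : MemLp f 2 ρ) {K L : ℝ} (h : K ≤ L) :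
    tailMoment ρ f L ≤ tailMoment ρ f K :=
  setIntegral_mono_set hf2.integrable_sq.integrableOn (ae_of_all _ fun _ ↦ sq_nonneg _)
    (ae_of_all _ fun _ ↦ h.trans_lt)

/-- The deviation of `f` from its mean under `ρ`, divided by the standard deviation of the sum of
`k` independent variables distributed as `f` under `ρ`. -/
noncomputable def rescaledDeviation (ρ : Measure E) (k : ℕ) (f : E → ℝ) (t : E) : ℝ :=
  (f t - ∫ s, f s ∂ρ) / √(k * Var[f; ρ])

lemma measurable_rescaledDeviation (hf : Measurable f) : Measurable (rescaledDeviation ρ k f) :=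
  (hf.sub_const _).div_const _

lemma memLp_rescaledDeviation [IsFiniteMeasure ρ] (hf2 : MemLp f 2 ρ) :
    MemLp (rescaledDeviation ρ k f) 2 ρ :=
  ((hf2.sub (memLp_const _)).mul_const (√(k * Var[f; ρ]))⁻¹).ae_eq
    (ae_of_all _ fun _ ↦ (div_eq_mul_inv _ _).symm)

lemma integral_rescaledDeviation [IsProbabilityMeasure ρ] (hf : Integrable f ρ) :
    ∫ t, rescaledDeviation ρ k f t ∂ρ = 0 := by
  simp only [rescaledDeviation]
  rw [integral_div, integral_sub hf (integrable_const _), integral_const, probReal_univ, one_smul,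
    sub_self, zero_div]

lemma integral_rescaledDeviation_sq (hf : AEMeasurable f ρ) (hV : Var[f; ρ] ≠ 0) :
    ∫ t, rescaledDeviation ρ k f t ^ 2 ∂ρ = 1 / k := by
  simp only [rescaledDeviation, div_pow]
  rw [integral_div, ← variance_eq_integral hf, Real.sq_sqrt
    (mul_nonneg (Nat.cast_nonneg k) (variance_nonneg f ρ)), div_mul_cancel_right₀ hV, one_div]

lemma tailMoment_rescaledDeviation_le [IsFiniteMeasure ρ] (hf : Measurable f)
    (hf2 : MemLp f 2 ρ) {ε K : ℝ} (hV : 0 < k * Var[f; ρ]) (hmean : |∫ t, f t ∂ρ| ≤ K)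
    (hK : 2 * K ≤ ε * √(k * Var[f; ρ])) :
    tailMoment ρ (rescaledDeviation ρ k f) ε ≤ 4 * tailMoment ρ f K / (k * Var[f; ρ]) := by
  have hpoint : ∀ t, ε < |rescaledDeviation ρ k f t| →
      K < |f t| ∧ rescaledDeviation ρ k f t ^ 2 ≤ 4 * f t ^ 2 / (k * Var[f; ρ]) := fun t ht ↦ by
    rw [rescaledDeviation, abs_div, abs_of_pos (Real.sqrt_pos.2 hV),
      lt_div_iff₀ (Real.sqrt_pos.2 hV)] at ht
    have htriangle := abs_sub (f t) (∫ t, f t ∂ρ)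
    have hsq : (f t - ∫ t, f t ∂ρ) ^ 2 ≤ (2 * f t) ^ 2 := sq_le_sq.2 <| by
      rw [abs_mul, abs_two]
      linarith
    rw [rescaledDeviation, div_pow, Real.sq_sqrt hV.le]
    exact ⟨by linarith, by gcongr; linarith⟩
  have hint : Integrable (fun t ↦ 4 * f t ^ 2 / (k * Var[f; ρ])) ρ :=
    (hf2.integrable_sq.const_mul 4).div_const _
  calc tailMoment ρ (rescaledDeviation ρ k f) ε
      ≤ ∫ t in {t | ε < |rescaledDeviation ρ k f t|}, 4 * f t ^ 2 / (k * Var[f; ρ]) ∂ρ :=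
        setIntegral_mono_on (memLp_rescaledDeviation hf2).integrable_sq.integrableOn
          hint.integrableOn
          (measurableSet_lt measurable_const (measurable_rescaledDeviation hf).abs)
          fun t ht ↦ (hpoint t ht).2
    _ ≤ ∫ t in {t | K < |f t|}, 4 * f t ^ 2 / (k * Var[f; ρ]) ∂ρ :=
        setIntegral_mono_set hint.integrableOn (ae_of_all _ fun _ ↦ by positivity)
          (ae_of_all _ fun t ht ↦ (hpoint t ht).1)
    _ = 4 * tailMoment ρ f K / (k * Var[f; ρ]) := by
        rw [integral_div, integral_const_mul, tailMoment]

end RandomSampling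

section SampledArray

variable {E : Type*} [MeasurableSpace E] {ρ : ℕ → Measure E} [∀ n, IsProbabilityMeasure (ρ n)]
  {f : E → ℝ} {k : ℕ → ℕ} {a v : ℝ}

theorem tendsto_mul_tailMoment_rescaledDeviation (hf : Measurable f) (hf2 : ∀ n, MemLp f 2 (ρ n))
    (hmean : Tendsto (fun n ↦ ∫ t, f t ∂ρ n) atTop (𝓝 a)) (hv : 0 < v)
    (hvar : Tendsto (fun n ↦ Var[f; ρ n]) atTop (𝓝 v))
    (htail : ∀ δ : ℝ, 0 < δ → ∃ K : ℝ, ∀ᶠ n in atTop, tailMoment (ρ n) f K < δ)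
    (hk : Tendsto k atTop atTop) {ε : ℝ} (hε : 0 < ε) :
    Tendsto (fun n ↦ k n * tailMoment (ρ n) (rescaledDeviation (ρ n) (k n) f) ε) atTop (𝓝 0) := by
  have hsd : Tendsto (fun n ↦ ε * √(k n * Var[f; ρ n])) atTop atTop :=
    (Real.tendsto_sqrt_atTop.comp
      ((tendsto_natCast_atTop_atTop.comp hk).atTop_mul_pos hv hvar)).const_mul_atTop hε
  refine tendsto_order.2 ⟨fun b hb ↦ Eventually.of_forall fun n ↦
    hb.trans_le (mul_nonneg (Nat.cast_nonneg _) (tailMoment_nonneg _ _)), fun δ hδ ↦ ?_⟩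
  obtain ⟨K, hK⟩ := htail (δ * v / 8) (by positivity)
  let L := max K (|a| + 1)
  filter_upwards [hK, hmean.abs.eventually_le_const (show |a| < L by simp [L]),
    hsd.eventually_ge_atTop (2 * L), hvar.eventually_const_lt (half_lt_self hv),
    hk.eventually_gt_atTop 0] with n hKn hmn hsn hvn hkn
  have hkn' : (0 : ℝ) < k n := Nat.cast_pos.2 hkn
  have hvn0 : 0 < Var[f; ρ n] := (half_pos hv).trans hvn
  calc k n * tailMoment (ρ n) (rescaledDeviation (ρ n) (k n) f) ε
      ≤ k n * (4 * tailMoment (ρ n) f L / (k n * Var[f; ρ n])) := by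
        gcongr
        exact tailMoment_rescaledDeviation_le hf (hf2 n) (mul_pos hkn' hvn0) hmn hsn
    _ = 4 * tailMoment (ρ n) f L / Var[f; ρ n] := by field_simp
    _ < δ := by
        rw [div_lt_iff₀ hvn0]
        have hLK := tailMoment_anti (hf2 n) (le_max_left K (|a| + 1))
        nlinarith

theorem isDonskerArray_rescaledDeviation (hf : Measurable f) (hf2 : ∀ n, MemLp f 2 (ρ n))
    (hmean : Tendsto (fun n ↦ ∫ t, f t ∂ρ n) atTop (𝓝 a)) (hv : 0 < v)
    (hvar : Tendsto (fun n ↦ Var[f; ρ n]) atTop (𝓝 v))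
    (htail : ∀ δ : ℝ, 0 < δ → ∃ K : ℝ, ∀ᶠ n in atTop, tailMoment (ρ n) f K < δ)
    (hk : Tendsto k atTop atTop) {Ω : Type*} [MeasurableSpace Ω] {Q : Measure Ω}
    {τ : ∀ n, Fin (k n) → Ω → E}
    (hτ : ∀ n r, MeasurePreserving (τ n r) Q (ρ n)) (hindep : ∀ n, iIndepFun (τ n) Q) :
    IsDonskerArray (fun n r ω ↦ rescaledDeviation (ρ n) (k n) f (τ n r ω)) Q := by
  have hmeas : ∀ n, Measurable (rescaledDeviation (ρ n) (k n) f) := fun n ↦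
    measurable_rescaledDeviation hf
  have hsq : ∀ᶠ n in atTop, ∀ r, ∫ ω, rescaledDeviation (ρ n) (k n) f (τ n r ω) ^ 2 ∂Q =
      1 / k n := by
    filter_upwards [hvar.eventually_ne hv.ne'] with n hn r
    rw [← integral_rescaledDeviation_sq hf.aemeasurable hn]
    exact (hτ n r).hasLaw.integral_comp ((hmeas n).pow_const 2).aestronglyMeasurable
  exact {
    measurable := fun n r ↦ (hmeas n).comp (hτ n r).measurable
    iIndepFun := fun n ↦ (hindep n).comp _ fun _ ↦ hmeas n
    memLp := Eventually.of_forall fun n r ↦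
      (memLp_rescaledDeviation (hf2 n)).comp_measurePreserving (hτ n r)
    integral_eq_zero := Eventually.of_forall fun n r ↦
      ((hτ n r).hasLaw.integral_comp (hmeas n).aestronglyMeasurable).trans
        (integral_rescaledDeviation ((hf2 n).integrable one_le_two))
    tendsto_sum_integral_sq := by
      refine tendsto_const_nhds.congr' ?_
      filter_upwards [hsq, hk.eventually_ne_atTop 0] with n hn hkn
      rw [Finset.sum_congr rfl fun r _ ↦ hn r, Finset.sum_const, Finset.card_univ,
        Fintype.card_fin, nsmul_eq_mul, mul_one_div_cancel (Nat.cast_ne_zero.2 hkn)]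
    tendsto_sum_tailMoment := fun ε hε ↦ by
      refine (tendsto_mul_tailMoment_rescaledDeviation hf hf2 hmean hv hvar htail hk hε).congr
        fun n ↦ ?_
      have hrow : ∀ r, tailMoment Q (fun ω ↦ rescaledDeviation (ρ n) (k n) f (τ n r ω)) ε =
          tailMoment (ρ n) (rescaledDeviation (ρ n) (k n) f) ε := fun r ↦
        tailMoment_comp (hτ n r) (hmeas n) ε
      rw [Finset.sum_congr rfl fun r _ ↦ hrow r, Finset.sum_const, Finset.card_univ,
        Fintype.card_fin, nsmul_eq_mul]
    tendsto_length := hk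
    integral_sq := hsq }

end SampledArray

section ConditionalTails

variable {Ω : Type*} {m mΩ : MeasurableSpace Ω} {P : Measure Ω}

lemma ae_exists_condExp_lt {h : ℕ → Ω → ℝ}
    (hh : Tendsto (fun n ↦ eLpNorm (h n) 1 P) atTop (𝓝 0)) :
    ∀ᵐ ω ∂P, ∀ δ : ℝ, 0 < δ → ∃ n, P[h n | m] ω < δ := by
  have hcond : Tendsto (fun n ↦ eLpNorm (P[h n | m] - 0) 1 P) atTop (𝓝 0) :=
    tendsto_of_tendsto_of_tendsto_of_le_of_le tendsto_const_nhds hh (fun _ ↦ zero_le) fun n ↦ by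
      rw [sub_zero]
      exact eLpNorm_condExp_le_eLpNorm _ le_rfl
  obtain ⟨ns, -, hns⟩ := (tendstoInMeasure_of_tendsto_eLpNorm one_ne_zero
    (fun _ ↦ integrable_condExp.aestronglyMeasurable) aestronglyMeasurable_zero
    hcond).exists_seq_tendsto_ae
  filter_upwards [hns] with ω hω δ hδ
  obtain ⟨i, hi⟩ := (hω.eventually_lt_const hδ).exists
  exact ⟨ns i, hi⟩

lemma tendsto_eLpNorm_indicator_lt_abs {g f : Ω → ℝ} (hf : Measurable f) (hg : Integrable g P) :
    Tendsto (fun K : ℕ ↦ eLpNorm ({ω | (K : ℝ) < |f ω|}.indicator g) 1 P) atTop (𝓝 0) := by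
  have hset : ∀ K : ℕ, MeasurableSet {ω | (K : ℝ) < |f ω|} := fun K ↦
    measurableSet_lt measurable_const hf.abs
  simp only [eLpNorm_one_eq_lintegral_enorm, enorm_indicator_eq_indicator_enorm]
  rw [← lintegral_zero (μ := P) (α := Ω)]
  refine tendsto_lintegral_of_dominated_convergence' (fun ω ↦ ‖g ω‖ₑ)
    (fun K ↦ hg.aestronglyMeasurable.enorm.indicator (hset K))
    (fun K ↦ ae_of_all _ fun ω ↦ indicator_le_self _ (fun ω ↦ ‖g ω‖ₑ) ω) hg.2.ne
    (ae_of_all _ fun ω ↦ ?_)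
  refine tendsto_const_nhds.congr' ?_
  filter_upwards [tendsto_natCast_atTop_atTop.eventually_ge_atTop |f ω|] with K hK
  have hω : ω ∉ {ω | (K : ℝ) < |f ω|} := not_lt.2 hK
  rw [indicator_of_notMem hω]

end ConditionalTails

section SpatialSampling

lemma measurable_spatialMean {E Ω : Type*} [MeasureSpace E] [MeasurableSpace Ω] {X : E → Ω → ℝ}
    (hX : Measurable (Function.uncurry X)) (T : Set E) : Measurable (spatialMean X T) := by
  rw [funext (spatialMean_eq_integral_cond X T)]
  exact ((hX.comp measurable_swap).stronglyMeasurable.integral_prod_right'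
    (ν := volume[|T])).measurable

lemma measurable_spatialVar {E Ω : Type*} [MeasureSpace E] [MeasurableSpace Ω] {X : E → Ω → ℝ}
    (hX : Measurable (Function.uncurry X)) (T : Set E) : Measurable (spatialVar X T) :=
  measurable_spatialMean (X := fun t ω ↦ (X t ω - spatialMean X T ω) ^ 2)
    ((hX.sub ((measurable_spatialMean hX T).comp measurable_snd)).pow_const 2) T

lemma measurable_brokenLine {E Ω Ω' : Type*} [MeasureSpace E] [MeasurableSpace Ω]
    [MeasurableSpace Ω'] {X : E → Ω → ℝ} (hX : Measurable (Function.uncurry X)) (T : Set E)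
    {k : ℕ} {τ : Fin k → Ω' → E} (hτ : ∀ r, Measurable (τ r)) :
    Measurable (brokenLine X T τ : Ω × Ω' → C(I, ℝ)) := by
  have hsum : ∀ j, Measurable (partialSum X T τ j : Ω × Ω' → ℝ) := fun j ↦
    Finset.measurable_sum _ fun r _ ↦
      (hX.comp (((hτ r).comp measurable_snd).prodMk measurable_fst)).sub
        ((measurable_spatialMean hX T).comp measurable_fst)
  exact (continuous_polygon k).measurable.comp <| measurable_pi_lambda _ fun j ↦
    (hsum j).div (((measurable_spatialVar hX T).comp measurable_fst).const_mul _).sqrt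

lemma spatialVar_eq_variance_cond {E Ω : Type*} [MeasureSpace E] {X : E → Ω → ℝ} {T : Set E}
    {ω : Ω} (hX : Measurable fun t ↦ X t ω) :
    spatialVar X T ω = Var[fun t ↦ X t ω; volume[|T]] := by
  rw [variance_eq_integral hX.aemeasurable, ← spatialMean_eq_integral_cond X T ω]
  exact spatialMean_eq_integral_cond (fun t ω ↦ (X t ω - spatialMean X T ω) ^ 2) T ω

lemma brokenLine_eq_polygon_cumSum {E Ω Ω' : Type*} [MeasureSpace E] {X : E → Ω → ℝ} {T : Set E}
    {ω : Ω} (hX : Measurable fun t ↦ X t ω) {k : ℕ} (τ : Fin k → Ω' → E) (ω' : Ω') :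
    brokenLine X T τ (ω, ω') =
      polygon k (cumSum fun r ↦ rescaledDeviation volume[|T] k (fun t ↦ X t ω) (τ r ω')) := by
  simp only [brokenLine, partialSum, rescaledDeviation, spatialVar_eq_variance_cond hX,
    spatialMean_eq_integral_cond, Finset.sum_div]
  rfl

variable {E : Type*} [NormedAddCommGroup E] [NormedSpace ℝ E] [FiniteDimensional ℝ E]
  [MeasurableSpace E] [BorelSpace E] {μ : Measure E} [μ.IsAddHaarMeasure]

lemma interior_ae_eq_self {T : Set E} (hT : Convex ℝ T) : interior T =ᵐ[μ] T :=
  interior_ae_eq_of_null_frontier (hT.addHaar_frontier μ)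

lemma cond_interior {T : Set E} (hT : Convex ℝ T) : μ[|interior T] = μ[|T] := by
  have h : interior T =ᵐ[μ] T := interior_ae_eq_self hT
  rw [ProbabilityTheory.cond, ProbabilityTheory.cond, measure_congr h, Measure.restrict_congr_set h]

lemma nonempty_interior_of_isUniform {Ω : Type*} [MeasurableSpace Ω] {Q : Measure Ω}
    [IsProbabilityMeasure Q] {τ : Ω → E} (hτ : AEMeasurable τ Q) {T : Set E} (hT : Convex ℝ T)
    (hunif : pdf.IsUniform τ T Q μ) : (interior T).Nonempty := by
  have hprob : IsProbabilityMeasure μ[|T] := hunif ▸ Measure.isProbabilityMeasure_map hτ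
  by_contra hempty
  have hT0 : μ T = 0 := by
    rw [← measure_congr (interior_ae_eq_self hT), not_nonempty_iff_eq_empty.1 hempty, measure_empty]
  exact hprob.ne_zero _ (cond_eq_zero_of_meas_eq_zero hT0)

end SpatialSampling

section SpatialLimits

variable {E Ω : Type*} [NormedAddCommGroup E] [NormedSpace ℝ E] [FiniteDimensional ℝ E]
  [MeasureSpace E] [BorelSpace E] [(volume : Measure E).IsAddHaarMeasure] [MeasurableSpace Ω]
  {P : Measure Ω} [IsProbabilityMeasure P] {X : E → Ω → ℝ} {T : ℕ → Set E}

lemma ae_tendsto_integral_cond (hT : IsAveragingSequence T)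
    (hX : Measurable (Function.uncurry X)) (hhom : IsHomogeneous X P) {h : ℝ → ℝ}
    (hh : Measurable h) (hi : Integrable (fun ω ↦ h (X 0 ω)) P) :
    ∀ᵐ ω ∂P, Tendsto (fun n ↦ ∫ t, h (X t ω) ∂volume[|T n]) atTop
      (𝓝 (P[fun ω ↦ h (X 0 ω) | invariantEvents X P] ω)) := by
  have hF : Measurable fun x : E → ℝ ↦ h (x 0) := hh.comp (measurable_pi_apply 0)
  have hFi : Integrable (fun x : E → ℝ ↦ h (x 0)) (P.map (samplePath X)) :=
    (integrable_map_measure hF.aestronglyMeasurable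
      (measurable_samplePath fun _ ↦ hX.of_uncurry_left).aemeasurable).2 hi
  filter_upwards [ae_tendsto_spatialMean hT hX hhom hF hFi] with ω hω
  simp only [spatialMean_eq_integral_cond, pathField, shift, samplePath, zero_add] at hω
  exact hω

lemma ae_forall_memLp_two_cond (hT : IsAveragingSequence T)
    (hX : Measurable (Function.uncurry X)) (hhom : IsHomogeneous X P) (hsq : MemLp (X 0) 2 P) :
    ∀ᵐ ω ∂P, ∀ n, MemLp (fun t ↦ X t ω) 2 volume[|T n] := by
  have hF : Measurable fun x : E → ℝ ↦ x 0 ^ 2 := (measurable_pi_apply 0).pow_const 2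
  have hFi : Integrable (fun x : E → ℝ ↦ x 0 ^ 2) (P.map (samplePath X)) :=
    (integrable_map_measure hF.aestronglyMeasurable
      (measurable_samplePath fun _ ↦ hX.of_uncurry_left).aemeasurable).2 hsq.integrable_sq
  refine ae_all_iff.2 fun n ↦ ?_
  filter_upwards [ae_integrableOn_pathField hX hhom hF hFi (hT.measure_ne_top n)] with ω hω
  simp only [pathField, shift, samplePath, zero_add] at hω
  exact (memLp_two_iff_integrable_sq hX.of_uncurry_right.aestronglyMeasurable).2
    (hω.smul_measure (ENNReal.inv_ne_top.2 (hT.measure_ne_zero n)))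

lemma ae_tendsto_variance_cond (hT : IsAveragingSequence T)
    (hX : Measurable (Function.uncurry X)) (hhom : IsHomogeneous X P) (hsq : MemLp (X 0) 2 P) :
    ∀ᵐ ω ∂P, Tendsto (fun n ↦ Var[fun t ↦ X t ω; volume[|T n]]) atTop
      (𝓝 (Var[X 0; P | invariantEvents X P] ω)) := by
  have (n : ℕ) : IsProbabilityMeasure (volume : Measure E)[|T n] :=
    cond_isProbabilityMeasure_of_finite (hT.measure_ne_zero n) (hT.measure_ne_top n)
  filter_upwards [ae_forall_memLp_two_cond hT hX hhom hsq,
    ae_tendsto_integral_cond hT hX hhom measurable_id (hsq.integrable one_le_two),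
    ae_tendsto_integral_cond hT hX hhom (measurable_id.pow_const 2) hsq.integrable_sq,
    condVar_ae_eq_condExp_sq_sub_sq_condExp
      (invariantEvents_le (X := X) fun _ ↦ hX.of_uncurry_left) hsq] with ω hmem hmean hsecond hcond
  rw [hcond]
  exact (hsecond.sub (hmean.pow 2)).congr fun n ↦ (variance_eq_sub (hmem n)).symm

lemma ae_exists_eventually_tailMoment_lt (hT : IsAveragingSequence T)
    (hX : Measurable (Function.uncurry X)) (hhom : IsHomogeneous X P) (hsq : MemLp (X 0) 2 P) :
    ∀ᵐ ω ∂P, ∀ δ : ℝ, 0 < δ →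
      ∃ K : ℝ, ∀ᶠ n in atTop, tailMoment volume[|T n] (fun t ↦ X t ω) K < δ := by
  have hset : ∀ K : ℕ, MeasurableSet {x : ℝ | (K : ℝ) < |x|} := fun _ ↦
    measurableSet_lt measurable_const measurable_norm
  have hX0 : Measurable (X 0) := hX.of_uncurry_left
  have hlim : ∀ᵐ ω ∂P, ∀ K : ℕ, Tendsto (fun n ↦ tailMoment volume[|T n] (fun t ↦ X t ω) K) atTop
      (𝓝 (P[{ω | (K : ℝ) < |X 0 ω|}.indicator fun ω ↦ X 0 ω ^ 2 | invariantEvents X P] ω)) :=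
    ae_all_iff.2 fun K ↦ by
      filter_upwards [ae_tendsto_integral_cond hT hX hhom
        (h := {x : ℝ | (K : ℝ) < |x|}.indicator fun x ↦ x ^ 2)
        ((measurable_id.pow_const 2).indicator (hset K))
        (hsq.integrable_sq.indicator (hX0 (hset K)))] with ω hω
      refine hω.congr fun n ↦ ?_
      exact integral_indicator (hX.of_uncurry_right (hset K))
  filter_upwards [hlim, ae_exists_condExp_lt (m := invariantEvents X P)
    (tendsto_eLpNorm_indicator_lt_abs hX0 hsq.integrable_sq)] with ω hω hsmall δ hδ
  obtain ⟨K, hK⟩ := hsmall δ hδ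
  exact ⟨K, (hω K).eventually_lt_const hK⟩

theorem ae_isDonskerArray (hT : IsAveragingSequence T)
    (hX : Measurable (Function.uncurry X)) (hhom : IsHomogeneous X P) (hsq : MemLp (X 0) 2 P)
    (hvar : ∀ᵐ ω ∂P, 0 < Var[X 0; P | invariantEvents X P] ω) {k : ℕ → ℕ}
    (hk : Tendsto k atTop atTop) {Ω' : Type*} [MeasurableSpace Ω'] {Q : Measure Ω'}
    {τ : ∀ n, Fin (k n) → Ω' → E} (hτ : ∀ n r, MeasurePreserving (τ n r) Q volume[|T n])
    (hindep : ∀ n, iIndepFun (τ n) Q) :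
    ∀ᵐ ω ∂P, IsDonskerArray (fun n r ω' ↦
      rescaledDeviation volume[|T n] (k n) (fun t ↦ X t ω) (τ n r ω')) Q := by
  have (n : ℕ) : IsProbabilityMeasure (volume : Measure E)[|T n] :=
    cond_isProbabilityMeasure_of_finite (hT.measure_ne_zero n) (hT.measure_ne_top n)
  filter_upwards [ae_forall_memLp_two_cond hT hX hhom hsq,
    ae_tendsto_integral_cond hT hX hhom measurable_id (hsq.integrable one_le_two), hvar,
    ae_tendsto_variance_cond hT hX hhom hsq,
    ae_exists_eventually_tailMoment_lt hT hX hhom hsq] with ω hmem hmean hpos hlim htail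
  exact isDonskerArray_rescaledDeviation hX.of_uncurry_right hmem hmean hpos hlim htail hk hτ hindep

end SpatialLimits

section ProductSpace

lemma tendstoInDistribution_iff_forall_integral_tendsto {S Ω Ω' ι : Type*} [TopologicalSpace S]
    [MeasurableSpace S] [OpensMeasurableSpace S] [MeasurableSpace Ω] [MeasurableSpace Ω']
    {μ : ι → Measure Ω} [∀ i, IsProbabilityMeasure (μ i)] {μ' : Measure Ω'}
    [IsProbabilityMeasure μ'] {l : Filter ι} {Y : ι → Ω → S} {Z : Ω' → S}
    (hY : ∀ i, AEMeasurable (Y i) (μ i)) (hZ : AEMeasurable Z μ') :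
    TendstoInDistribution Y l Z μ μ' ↔ ∀ F : BoundedContinuousFunction S ℝ,
      Tendsto (fun i ↦ ∫ ω, F (Y i ω) ∂μ i) l (𝓝 (∫ ω, F (Z ω) ∂μ')) := by
  have hmap : ∀ F : BoundedContinuousFunction S ℝ,
      (∀ i, ∫ x, F x ∂(μ i).map (Y i) = ∫ ω, F (Y i ω) ∂μ i) ∧
        ∫ x, F x ∂μ'.map Z = ∫ ω, F (Z ω) ∂μ' := fun F ↦
    ⟨fun i ↦ integral_map (hY i) F.continuous.measurable.aestronglyMeasurable,
      integral_map hZ F.continuous.measurable.aestronglyMeasurable⟩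
  simp only [← (hmap _).1, ← (hmap _).2]
  exact ⟨fun h ↦ ProbabilityMeasure.tendsto_iff_forall_integral_tendsto.1 h.tendsto,
    fun h ↦ ⟨hY, hZ, ProbabilityMeasure.tendsto_iff_forall_integral_tendsto.2 h⟩⟩

theorem tendstoInDistribution_prod {S Ω₁ Ω₂ Ω' ι : Type*} [TopologicalSpace S] [MeasurableSpace S]
    [OpensMeasurableSpace S] [MeasurableSpace Ω₁] [MeasurableSpace Ω₂] [MeasurableSpace Ω']
    {P : Measure Ω₁} [IsProbabilityMeasure P] {Q : Measure Ω₂} [IsProbabilityMeasure Q]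
    {μ' : Measure Ω'} [IsProbabilityMeasure μ'] {l : Filter ι} [l.IsCountablyGenerated]
    {Y : ι → Ω₁ × Ω₂ → S} {Z : Ω' → S} (hY : ∀ i, Measurable (Y i)) (hZ : AEMeasurable Z μ')
    (h : ∀ᵐ ω ∂P, TendstoInDistribution (fun i ω' ↦ Y i (ω, ω')) l Z (fun _ ↦ Q) μ') :
    TendstoInDistribution Y l Z (fun _ ↦ P.prod Q) μ' := by
  refine (tendstoInDistribution_iff_forall_integral_tendsto (fun i ↦ (hY i).aemeasurable) hZ).2
    fun F ↦ ?_
  have hint : ∀ i, Integrable (fun p ↦ F (Y i p)) (P.prod Q) := fun i ↦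
    .of_bound (F.continuous.measurable.comp (hY i)).aestronglyMeasurable ‖F‖
      (ae_of_all _ fun _ ↦ F.norm_coe_le_norm _)
  have hlim : Tendsto (fun i ↦ ∫ ω, ∫ ω', F (Y i (ω, ω')) ∂Q ∂P) l
      (𝓝 (∫ _, ∫ ω', F (Z ω') ∂μ' ∂P)) := by
    refine tendsto_integral_filter_of_dominated_convergence (fun _ ↦ ‖F‖)
      (Eventually.of_forall fun i ↦ (hint i).integral_prod_left.aestronglyMeasurable)
      (Eventually.of_forall fun i ↦ ae_of_all _ fun ω ↦ ?_) (integrable_const _) ?_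
    · simpa using norm_integral_le_of_norm_le_const (μ := Q)
        (ae_of_all _ fun ω' ↦ F.norm_coe_le_norm (Y i (ω, ω')))
    · filter_upwards [h] with ω hω
      exact (tendstoInDistribution_iff_forall_integral_tendsto hω.forall_aemeasurable hZ).1 hω F
  simpa only [integral_prod _ (hint _), integral_const, probReal_univ, one_smul] using hlim

end ProductSpace

section LimitTheorem

variable {E : Type*} [NormedAddCommGroup E] [NormedSpace ℝ E]

lemma isAveragingSequence_interior {T : ℕ → Set E} (hmono : Monotone T)
    (hconvex : ∀ n, Convex ℝ (T n)) (hbdd : ∀ n, Bornology.IsBounded (T n))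
    (hne : ∀ n, (interior (T n)).Nonempty) {c : ℕ → E} {r : ℕ → ℝ} (hr : Tendsto r atTop atTop)
    (hball : ∀ n, Metric.ball (c n) (r n) ⊆ T n) :
    IsAveragingSequence fun n ↦ interior (T n) where
  monotone _ _ hmn := interior_mono (hmono hmn)
  convex n := (hconvex n).interior
  isOpen _ := isOpen_interior
  isBounded n := (hbdd n).subset interior_subset
  nonempty := hne
  eventually_exists_ball_subset R := by
    filter_upwards [hr.eventually_ge_atTop R] with n hn
    exact ⟨c n, (Metric.ball_subset_ball hn).trans
      (Metric.isOpen_ball.subset_interior_iff.2 (hball n))⟩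

theorem ae_exists_tendstoInDistribution_brokenLine [FiniteDimensional ℝ E]
    [MeasureSpace E] [BorelSpace E] [(volume : Measure E).IsAddHaarMeasure]
    {Ω : Type*} [MeasurableSpace Ω] {P : Measure Ω} [IsProbabilityMeasure P]
    {Ω' : Type*} [MeasurableSpace Ω'] {Q : Measure Ω'} [IsProbabilityMeasure Q]
    {X : E → Ω → ℝ} (hX : Measurable (Function.uncurry X)) (hhom : IsHomogeneous X P)
    (hsq : MemLp (X 0) 2 P) (hvar : ∀ᵐ ω ∂P, 0 < Var[X 0; P | invariantEvents X P] ω)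
    {T : ℕ → Set E} (hT : IsAveragingSequence fun n ↦ interior (T n))
    (hconvex : ∀ n, Convex ℝ (T n)) {k : ℕ → ℕ} (hk : Tendsto k atTop atTop)
    {τ : ∀ n, Fin (k n) → Ω' → E} (hτ : ∀ n i, Measurable (τ n i))
    (hunif : ∀ n i, pdf.IsUniform (τ n i) (T n) Q volume) (hindep : ∀ n, iIndepFun (τ n) Q) :
    ∀ᵐ ω ∂P, ∃ W : ProbabilityMeasure C(I, ℝ), HasWienerCharFun (W : Measure C(I, ℝ)) ∧
      TendstoInDistribution (fun n ω' ↦ brokenLine X (T n) (τ n) (ω, ω')) atTop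
        id (fun _ ↦ Q) (W : Measure C(I, ℝ)) := by
  have hτ' : ∀ n i, MeasurePreserving (τ n i) Q volume[|interior (T n)] := fun n i ↦
    ⟨hτ n i, (hunif n i).trans (cond_interior (hconvex n)).symm⟩
  filter_upwards [ae_isDonskerArray hT hX hhom hsq hvar hk hτ' hindep] with ω hω
  obtain ⟨W, hW, hlim⟩ := hω.exists_tendstoInDistribution
  refine ⟨W, hW, ?_⟩
  simp only [brokenLine_eq_polygon_cumSum hX.of_uncurry_right]
  simpa only [cond_interior (hconvex _)] using hlim

end LimitTheorem

end RandomizedFCLT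

theorem mainTheorem5_general {E : Type*} [NormedAddCommGroup E] [NormedSpace ℝ E]
    [FiniteDimensional ℝ E] [MeasureSpace E] [BorelSpace E] [(volume : Measure E).IsAddHaarMeasure]
    {ΩX : Type*} [MeasurableSpace ΩX] (PX : Measure ΩX) [IsProbabilityMeasure PX]
    {Ωτ : Type*} [MeasurableSpace Ωτ] (Pτ : Measure Ωτ) [IsProbabilityMeasure Pτ]
    (X : E → ΩX → ℝ) (hX_meas : Measurable (Function.uncurry X))
    (hX_hom : RandomizedFCLT.IsHomogeneous X PX) (hX_sq : MemLp (X 0) 2 PX)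
    (hX_var : ∀ᵐ ω ∂PX, 0 < Var[X 0; PX | RandomizedFCLT.invariantEvents X PX] ω)
    (T : ℕ → Set E) (hT_mono : Monotone T) (hT_convex : ∀ n, Convex ℝ (T n))
    (hT_bdd : ∀ n, Bornology.IsBounded (T n)) (c : ℕ → E) (r : ℕ → ℝ)
    (hr : Tendsto r atTop atTop) (hT_ball : ∀ n, Metric.ball (c n) (r n) ⊆ T n)
    (k : ℕ → ℕ) (hk_pos : ∀ n, 0 < k n) (hk : Tendsto k atTop atTop)
    (τ : (n : ℕ) → Fin (k n) → Ωτ → E) (hτ_meas : ∀ n i, Measurable (τ n i))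
    (hτ_unif : ∀ n i, pdf.IsUniform (τ n i) (T n) Pτ volume)
    (hτ_indep : ∀ n, iIndepFun (τ n) Pτ) :
    ∃ W : ProbabilityMeasure C(I, ℝ),
      RandomizedFCLT.IsWienerMeasure (W : Measure C(I, ℝ)) ∧
      (∀ᵐ ω ∂PX, TendstoInDistribution
        (fun n ω' ↦ RandomizedFCLT.brokenLine X (T n) (τ n) (ω, ω')) atTop
        id (fun _ ↦ Pτ) (W : Measure C(I, ℝ))) ∧
      TendstoInDistribution
        (fun n p ↦ RandomizedFCLT.brokenLine X (T n) (τ n) p) atTop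
        id (fun _ ↦ PX.prod Pτ) (W : Measure C(I, ℝ)) := by
  have hT_interior : ∀ n, (interior (T n)).Nonempty := fun n ↦
    RandomizedFCLT.nonempty_interior_of_isUniform (hτ_meas n ⟨0, hk_pos n⟩).aemeasurable
      (hT_convex n) (hτ_unif n ⟨0, hk_pos n⟩)
  have hT_averaging := RandomizedFCLT.isAveragingSequence_interior hT_mono hT_convex hT_bdd
    hT_interior hr hT_ball
  have hquenched := RandomizedFCLT.ae_exists_tendstoInDistribution_brokenLine hX_meas hX_hom hX_sq
    hX_var hT_averaging hT_convex hk hτ_meas hτ_unif hτ_indep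
  obtain ⟨_, W, hW, -⟩ := hquenched.exists
  have hquenchedW : ∀ᵐ ω ∂PX, TendstoInDistribution
      (fun n ω' ↦ RandomizedFCLT.brokenLine X (T n) (τ n) (ω, ω')) atTop
      id (fun _ ↦ Pτ) (W : Measure C(I, ℝ)) := by
    filter_upwards [hquenched] with ω ⟨W', hW', hlim⟩
    obtain rfl : W' = W := ProbabilityMeasure.toMeasure_injective (hW'.ext hW)
    exact hlim
  exact ⟨W, hW.isWienerMeasure, hquenchedW, RandomizedFCLT.tendstoInDistribution_prod
    (fun n ↦ RandomizedFCLT.measurable_brokenLine hX_meas (T n) (hτ_meas n))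
    aemeasurable_id hquenchedW⟩

theorem mainTheorem5 {m : ℕ}
    {ΩX : Type*} [MeasurableSpace ΩX] (PX : Measure ΩX) [IsProbabilityMeasure PX]
    {Ωτ : Type*} [MeasurableSpace Ωτ] (Pτ : Measure Ωτ) [IsProbabilityMeasure Pτ]
    -- the random field: bi-measurable, homogeneous, with finite second moment and a.s. positive
    -- conditional variance given the shift-invariant events
    (X : EuclideanSpace ℝ (Fin m) → ΩX → ℝ)
    (hX_meas : Measurable (Function.uncurry X))
    (hX_hom : RandomizedFCLT.IsHomogeneous X PX)
    (hX_sq : MemLp (X 0) 2 PX)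
    (hX_var : ∀ᵐ ω ∂PX, 0 < Var[X 0; PX | RandomizedFCLT.invariantEvents X PX] ω)
    -- increasing bounded convex sets containing balls with radii tending to infinity
    (T : ℕ → Set (EuclideanSpace ℝ (Fin m)))
    (hT_mono : Monotone T)
    (hT_convex : ∀ n, Convex ℝ (T n))
    (hT_bdd : ∀ n, Bornology.IsBounded (T n))
    (c : ℕ → EuclideanSpace ℝ (Fin m)) (r : ℕ → ℝ)
    (hr : Tendsto r atTop atTop)
    (hT_ball : ∀ n, Metric.ball (c n) (r n) ⊆ T n)
    -- sample sizes
    (k : ℕ → ℕ) (hk_pos : ∀ n, 0 < k n) (hk_mono : Monotone k) (hk : Tendsto k atTop atTop)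
    -- for each `n`, `k n` independent random points uniformly distributed on `T n`
    (τ : (n : ℕ) → Fin (k n) → Ωτ → EuclideanSpace ℝ (Fin m))
    (hτ_meas : ∀ n i, Measurable (τ n i))
    (hτ_unif : ∀ n i, pdf.IsUniform (τ n i) (T n) Pτ volume)
    (hτ_indep : ∀ n, iIndepFun (τ n) Pτ) :
    ∃ W : ProbabilityMeasure C(unitInterval, ℝ),
      RandomizedFCLT.IsWienerMeasure (W : Measure C(unitInterval, ℝ)) ∧
      (∀ᵐ ω ∂PX, TendstoInDistribution
        (fun n ω' ↦ RandomizedFCLT.brokenLine X (T n) (τ n) (ω, ω')) atTop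
        id (fun _ ↦ Pτ) (W : Measure C(unitInterval, ℝ))) ∧
      TendstoInDistribution
        (fun n p ↦ RandomizedFCLT.brokenLine X (T n) (τ n) p) atTop
        id (fun _ ↦ PX.prod Pτ) (W : Measure C(unitInterval, ℝ)) :=
  mainTheorem5_general PX Pτ X hX_meas hX_hom hX_sq hX_var T hT_mono hT_convex hT_bdd c r hr hT_ball
    k hk_pos hk τ hτ_meas hτ_unif hτ_indep
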